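/- **Setting.** Let $k$ be a field, $\hat G$ a finite group with a homomorphism $\pi:\hat G\to\{\pm1\}$, and $\hat H\le\hat G$ a subgroup on which $\pi$ is surjective (so $\pi$ is surjective on $\hat G$); put $G=\ker\pi$, $H=\hat H\cap G$. Let $\hat\alpha\in Z^3(B\hat G,k^\times_\pi)$ be a normalized 3-cocycle, $\hat G$ acting on $k^\times$ by $\lambda\mapsto\lambda^{\pi(\omega)}$, that is, $$\hat\alpha([\omega_4\omega_3|\omega_2|\omega_1])\,\hat\alpha([\omega_4|\omega_3|\omega_2\omega_1])=\hat\alpha([\omega_3|\omega_2|\omega_1])^{\pi(\omega_4)}\,\hat\alpha([\omega_4|\omega_3\omega_2|\omega_1])\,\hat\alpha([\omega_4|\omega_3|\omega_2]).$$ For a category, functor or isomorphism of functors, the left superscript ${}^{\epsilon}(-)$ means nothing if $\epsilon=1$ and passage to opposites if $\epsilon=-1$; for an isomorphism $u$, ${}^{\epsilon}u^{\epsilon}$ is $u$ if $\epsilon=1$ and $(u^{-1})^{\mathrm{op}}$ if $\epsilon=-1$. **Real 2-representations.** An $\hat\alpha$-twisted linear Real 2-representation $\rho$ of $G$ (with Real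 structure $\hat G$) on a $k$-linear category $V$ consists of $k$-linear equivalences $\rho(\omega):{}^{\pi(\omega)}V\to V$ for $\omega\in\hat G$, natural isomorphisms $\psi_{\omega_2,\omega_1}:\rho(\omega_2)\circ{}^{\pi(\omega_2)}\rho(\omega_1)\Rightarrow\rho(\omega_2\omega_1)$ and $\psi_e:\rho(e)\Rightarrow 1_V$ with $$\hat\alpha([\omega_3|\omega_2|\omega_1])\;\psi_{\omega_3\omega_2,\omega_1}\bigl(\psi_{\omega_3,\omega_2}\circ{}^{\pi(\omega_3\omega_2)}\rho(\omega_1)\bigr)=\psi_{\omega_3,\omega_2\omega_1}\bigl(\rho(\omega_3)\circ{}^{\pi(\omega_3)}\psi_{\omega_2,\omega_1}^{\pi(\omega_3)}\bigr),$$ $\psi_{e,\omega}=\psi_e\circ\rho(\omega)$ and $\psi_{\omega,e}=\rho(\omega)\circ{}^{\pi(\omega)}\psi_e^{\pi(\omega)}$. **Loop groupoid and transgression.** $\Lambda_\pi^{\mathrm{ref}}B\hat G$ is the groupoid with objects $g\in G$ and morphisms $\omega:g\to\omega g^{\pi(\omega)}\omega^{-1}$, $\omega\in\hat G$, composed by multiplication.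 It carries the 2-cocycle $\theta=\tau_\pi^{\mathrm{ref}}(\hat\alpha)$, $$\theta([\omega_2|\omega_1]\gamma)=\hat\alpha([\gamma|\gamma^{-1}|\gamma])^{\delta}\left(\frac{\hat\alpha([\omega_1\gamma^{-\pi(\omega_1)}\omega_1^{-1}|\omega_1\gamma^{\pi(\omega_1)}\omega_1^{-1}|\omega_1])\,\hat\alpha([\omega_1|\gamma^{-\pi(\omega_1)}|\gamma^{\pi(\omega_1)}])}{\hat\alpha([\omega_1\gamma^{-\pi(\omega_1)}\omega_1^{-1}|\omega_1|\gamma^{\pi(\omega_1)}])}\right)^{\frac{\pi(\omega_2)-1}{2}}\frac{\hat\alpha([\omega_2|\omega_1|\gamma^{\varepsilon}])\,\hat\alpha([\omega_2\omega_1\gamma^{\varepsilon}(\omega_2\omega_1)^{-1}|\omega_2|\omega_1])}{\hat\alpha([\omega_2|\omega_1\gamma^{\varepsilon}\omega_1^{-1}|\omega_1])},$$ where $\varepsilon=\pi(\omega_2\omega_1)$, and $\delta=1$ if $\pi(\omega_1)=\pi(\omega_2)=-1$ and $\delta=0$ otherwise. A $\theta$-twisted representation of a groupoid is a family of $k$-vector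 spaces $E_x$ with linear maps $E(f):E_x\to E_y$ for $f:x\to y$ such that $E(\mathrm{id})=\mathrm{id}$ and $E(f_2)E(f_1)=\theta([f_2|f_1])E(f_2f_1)$. An isomorphism is a family of linear isomorphisms that commute with all the $E(f)$. **Real categorical character.** $\mathbb{T}\mathrm{r}_\rho(g)=\mathrm{Hom}(1_V,\rho(g))$ for $g\in G$, and $\omega$ acts by $\beta_{g,\omega}$: with $g'=\omega g^{\pi(\omega)}\omega^{-1}$, $\beta_{g,\omega}(\phi)$ is the composite $$1_V\Rightarrow\rho(\omega)\rho(\omega^{-1})\Rightarrow\rho(\omega)\rho(g^{\pi(\omega)})\rho(\omega^{-1})\Rightarrow\rho(\omega g^{\pi(\omega)})\rho(\omega^{-1})\Rightarrow\rho(g')\rho(\omega)\rho(\omega^{-1})\Rightarrow\rho(g')$$ (superscripts suppressed). Here the first and last arrows come from the isomorphism $\psi_e\psi_{\omega,\omega^{-1}}:\rho(\omega)\rho(\omega^{-1})\Rightarrow1_V$ (its inverse, resp. itself), the third and fourth arrows are $\psi_{\omega,g^{\pi(\omega)}}$ and $\psi_{g',\omega}^{-1}$, and the second arrow inserts $\phi$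 if $\pi(\omega)=1$ and the opposite of $\phi^\flat$ if $\pi(\omega)=-1$, where $\phi^\flat$ is the composite $\rho(g^{-1})\Rightarrow\rho(g^{-1})\rho(g)\Rightarrow1_V$ of $\rho(g^{-1})(\phi)$ and $\psi_e\psi_{g^{-1},g}$. **Real induction.** Fix representatives $\{\sigma_q\}$ of the cosets $q\in\hat G/\hat H$, and let $\rho$ be an $\hat\alpha_{|\hat H}$-twisted linear Real 2-representation of $H$ on $V$. $\mathrm{RInd}_{\hat H}^{\hat G}(\rho)$ lives on $\prod_q{}^{\pi(\sigma_q)}V$. The $(j,i)$ entry of $\omega$ is ${}^{\pi(\sigma_j)}\rho(\eta)$ if $\omega\sigma_i=\sigma_j\eta$ with $\eta\in\hat H$, and $0$ otherwise. If $\omega_1\sigma_i=\sigma_j\eta_1$ and $\omega_2\sigma_j=\sigma_l\eta_2$, the $(l,i)$ entry of the composition isomorphism for $(\omega_2,\omega_1)$ is $$\frac{\hat\alpha([\omega_2|\sigma_j|\eta_1])}{\hat\alpha([\omega_2|\omega_1|\sigma_i])\,\hat\alpha([\sigma_l|\eta_2|\eta_1])}\;{}^{\pi(\sigma_l)}\psi_{\eta_2,\eta_1}^{\pi(\sigma_l)},$$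 and the unit isomorphism has entries ${}^{\pi(\sigma_i)}\psi_e^{\pi(\sigma_i)}$. **Twisted induction.** For a $\theta_{|\Lambda_\pi^{\mathrm{ref}}B\hat H}$-twisted representation $E$ of $\Lambda_\pi^{\mathrm{ref}}B\hat H$, the fibre over $g$ of $\mathrm{Ind}(E)=\mathrm{Ind}_{\Lambda_\pi^{\mathrm{ref}}B\hat H}^{\Lambda_\pi^{\mathrm{ref}}B\hat G}(E)$ is spanned by symbols $s\otimes v$, linear in $v$, with $h\in H$, $s:h\to g$ a morphism of $\Lambda_\pi^{\mathrm{ref}}B\hat G$ and $v\in E_h$, modulo $s\otimes E(a)v=\theta([s|a])\,sa\otimes v$ for morphisms $a$ of $\Lambda_\pi^{\mathrm{ref}}B\hat H$; a morphism $f$ acts by $s\otimes v\mapsto\theta([f|s])\,fs\otimes v$. **Theorem.** $\mathrm{RInd}_{\hat H}^{\hat G}(\rho)$ is an $\hat\alpha$-twisted linear Real 2-representation of $G$; $\mathbb{T}\mathrm{r}(\rho)$ is a $\tau_\pi^{\mathrm{ref}}(\hat\alpha_{|\hat H})$-twisted representation of $\Lambda_\pi^{\mathrm{ref}}B\hat H$;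 $\mathbb{T}\mathrm{r}(\mathrm{RInd}_{\hat H}^{\hat G}(\rho))$ and $\mathrm{Ind}_{\Lambda_\pi^{\mathrm{ref}}B\hat H}^{\Lambda_\pi^{\mathrm{ref}}B\hat G}(\mathbb{T}\mathrm{r}(\rho))$ are $\tau_\pi^{\mathrm{ref}}(\hat\alpha)$-twisted representations of $\Lambda_\pi^{\mathrm{ref}}B\hat G$; and there is a canonical isomorphism of $\tau_\pi^{\mathrm{ref}}(\hat\alpha)$-twisted representations $$\mathbb{T}\mathrm{r}(\mathrm{RInd}_{\hat H}^{\hat G}(\rho))\;\simeq\;\mathrm{Ind}_{\Lambda_\pi^{\mathrm{ref}}B\hat H}^{\Lambda_\pi^{\mathrm{ref}}B\hat G}(\mathbb{T}\mathrm{r}(\rho)).$$ Canonical means: for every $g\in G$ and every coset $q$ fixed by $g$, with $h_q=\sigma_q^{-1}g^{\pi(\sigma_q)}\sigma_q\in H$, and every $v\in\mathbb{T}\mathrm{r}_\rho(h_q)$, the element $\sigma_q\otimes v$ corresponds to the natural transformation $1\Rightarrow\mathrm{RInd}_{\hat H}^{\hat G}(\rho)(g)$ whose $q$-component is $v:1_V\Rightarrow\rho(h_q)$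 if $\pi(\sigma_q)=1$ and the opposite of $v^\flat:\rho(h_q^{-1})\Rightarrow1_V$ if $\pi(\sigma_q)=-1$, and whose other components vanish. -/

import Mathlib

open CategoryTheory

universe w v u v₁ u₁ v₂ u₂ v₃ u₃

namespace RealTwoRep

/-! ## Signed categories -/

/-- For a sign `ε`, the category `Signed ε C` is `C` if `ε = 1` and the opposite of `C` if
`ε = -1`. -/
structure Signed (ε : ℤˣ) (C : Type u) : Type u where
  un : C

/-- Morphisms of `Signed ε C`: a morphism `x ⟶ y` if `ε = 1` and a morphism `y ⟶ x` if `ε = -1`.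
Exactly one of the two fields carries data, the other one has a contradictory hypothesis. -/
@[ext]
structure SHom (ε : ℤˣ) {C : Type u} [Category.{v} C] (x y : C) : Type v where
  pos : ε = 1 → (x ⟶ y)
  neg : ε = -1 → (y ⟶ x)

section SignedCategory

variable {C : Type u} [Category.{v} C]

instance signedCategory (ε : ℤˣ) : Category.{v} (Signed ε C) where
  Hom x y := SHom ε x.un y.un
  id x := ⟨fun _ => 𝟙 x.un, fun _ => 𝟙 x.un⟩
  comp f g := ⟨fun h => f.pos h ≫ g.pos h, fun h => g.neg h ≫ f.neg h⟩
  id_comp f := by ext h <;> simp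
  comp_id f := by ext h <;> simp
  assoc f g h := by ext h <;> simp

variable {ε : ℤˣ}

@[ext]
theorem Signed.hom_ext {x y : Signed ε C} (f g : x ⟶ y) (hp : ∀ h, f.pos h = g.pos h)
    (hn : ∀ h, f.neg h = g.neg h) : f = g :=
  SHom.ext (funext hp) (funext hn)

@[simp] theorem Signed.id_pos (x : Signed ε C) (h : ε = 1) : (𝟙 x : x ⟶ x).pos h = 𝟙 x.un := rfl
@[simp] theorem Signed.id_neg (x : Signed ε C) (h : ε = -1) : (𝟙 x : x ⟶ x).neg h = 𝟙 x.un := rfl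
@[simp] theorem Signed.comp_pos {x y z : Signed ε C} (f : x ⟶ y) (g : y ⟶ z) (h : ε = 1) :
    (f ≫ g).pos h = f.pos h ≫ g.pos h := rfl
@[simp] theorem Signed.comp_neg {x y z : Signed ε C} (f : x ⟶ y) (g : y ⟶ z) (h : ε = -1) :
    (f ≫ g).neg h = g.neg h ≫ f.neg h := rfl

/-- An isomorphism `e` of `C`, read in `Signed ε C`: it is `e` if `ε = 1` and the opposite of
`e⁻¹` if `ε = -1`. -/
@[simps]
def Signed.iso (ε : ℤˣ) {x y : C} (e : x ≅ y) : (⟨x⟩ : Signed ε C) ≅ ⟨y⟩ where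
  hom := ⟨fun _ => e.hom, fun _ => e.inv⟩
  inv := ⟨fun _ => e.inv, fun _ => e.hom⟩
  hom_inv_id := by ext h <;> simp
  inv_hom_id := by ext h <;> simp

end SignedCategory

section SignedLinear

variable {k : Type w} [Field k] {C : Type u} [Category.{v} C] [Preadditive C] [Linear k C]
variable {ε : ℤˣ}

instance sHomAddCommGroup (x y : C) : AddCommGroup (SHom ε x y) where
  add f g := ⟨fun h => f.pos h + g.pos h, fun h => f.neg h + g.neg h⟩
  zero := ⟨fun _ => 0, fun _ => 0⟩
  neg f := ⟨fun h => -f.pos h, fun h => -f.neg h⟩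
  nsmul n f := ⟨fun h => n • f.pos h, fun h => n • f.neg h⟩
  zsmul n f := ⟨fun h => n • f.pos h, fun h => n • f.neg h⟩
  add_assoc a b c := SHom.ext (funext fun _ => add_assoc _ _ _) (funext fun _ => add_assoc _ _ _)
  zero_add a := SHom.ext (funext fun _ => zero_add _) (funext fun _ => zero_add _)
  add_zero a := SHom.ext (funext fun _ => add_zero _) (funext fun _ => add_zero _)
  add_comm a b := SHom.ext (funext fun _ => add_comm _ _) (funext fun _ => add_comm _ _)
  neg_add_cancel a :=
    SHom.ext (funext fun _ => neg_add_cancel _) (funext fun _ => neg_add_cancel _)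
  nsmul_zero f := SHom.ext (funext fun _ => zero_nsmul _) (funext fun _ => zero_nsmul _)
  nsmul_succ n f := SHom.ext (funext fun _ => succ_nsmul _ _) (funext fun _ => succ_nsmul _ _)
  zsmul_zero' f := SHom.ext (funext fun _ => zero_zsmul _) (funext fun _ => zero_zsmul _)
  zsmul_succ' n f := SHom.ext (funext fun _ => SubNegMonoid.zsmul_succ' _ _)
    (funext fun _ => SubNegMonoid.zsmul_succ' _ _)
  zsmul_neg' n f := SHom.ext (funext fun _ => SubNegMonoid.zsmul_neg' _ _)
    (funext fun _ => SubNegMonoid.zsmul_neg' _ _)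

instance sHomModule (x y : C) : Module k (SHom ε x y) where
  smul c f := ⟨fun h => c • f.pos h, fun h => c • f.neg h⟩
  one_smul _ := SHom.ext (funext fun _ => one_smul _ _) (funext fun _ => one_smul _ _)
  mul_smul _ _ _ := SHom.ext (funext fun _ => mul_smul _ _ _) (funext fun _ => mul_smul _ _ _)
  smul_zero _ := SHom.ext (funext fun _ => smul_zero _) (funext fun _ => smul_zero _)
  smul_add _ _ _ := SHom.ext (funext fun _ => smul_add _ _ _) (funext fun _ => smul_add _ _ _)
  add_smul _ _ _ := SHom.ext (funext fun _ => add_smul _ _ _) (funext fun _ => add_smul _ _ _)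
  zero_smul _ := SHom.ext (funext fun _ => zero_smul _ _) (funext fun _ => zero_smul _ _)

instance signedPreadditive : Preadditive (Signed ε C) where
  homGroup x y := sHomAddCommGroup x.un y.un
  add_comp _ _ _ _ _ _ := SHom.ext (funext fun _ => Preadditive.add_comp _ _ _ _ _ _)
    (funext fun _ => Preadditive.comp_add _ _ _ _ _ _)
  comp_add _ _ _ _ _ _ := SHom.ext (funext fun _ => Preadditive.comp_add _ _ _ _ _ _)
    (funext fun _ => Preadditive.add_comp _ _ _ _ _ _)

instance signedLinear : Linear k (Signed ε C) where
  homModule x y := sHomModule x.un y.un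
  smul_comp _ _ _ _ _ _ := SHom.ext (funext fun _ => Linear.smul_comp _ _ _ _ _ _)
    (funext fun _ => Linear.comp_smul _ _ _ _ _ _)
  comp_smul _ _ _ _ _ _ := SHom.ext (funext fun _ => Linear.comp_smul _ _ _ _ _ _)
    (funext fun _ => Linear.smul_comp _ _ _ _ _ _)

@[simp] theorem Signed.add_pos {x y : Signed ε C} (f g : x ⟶ y) (h : ε = 1) :
    (f + g).pos h = f.pos h + g.pos h := rfl
@[simp] theorem Signed.add_neg {x y : Signed ε C} (f g : x ⟶ y) (h : ε = -1) :
    (f + g).neg h = f.neg h + g.neg h := rfl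
@[simp] theorem Signed.smul_pos (c : k) {x y : Signed ε C} (f : x ⟶ y) (h : ε = 1) :
    (c • f).pos h = c • f.pos h := rfl
@[simp] theorem Signed.smul_neg (c : k) {x y : Signed ε C} (f : x ⟶ y) (h : ε = -1) :
    (c • f).neg h = c • f.neg h := rfl

/-- A product of preadditive categories is preadditive. -/
instance piPreadditive {ι : Type u₁} (D : ι → Type u₂) [∀ i, Category.{v₂} (D i)]
    [∀ i, Preadditive (D i)] : Preadditive (∀ i, D i) where
  homGroup x y := inferInstanceAs (AddCommGroup (∀ i, x i ⟶ y i))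
  add_comp _ _ _ _ _ _ := funext fun _ => Preadditive.add_comp _ _ _ _ _ _
  comp_add _ _ _ _ _ _ := funext fun _ => Preadditive.comp_add _ _ _ _ _ _

/-- A product of `k`-linear categories is `k`-linear. -/
instance piLinear {ι : Type u₁} (D : ι → Type u₂) [∀ i, Category.{v₂} (D i)]
    [∀ i, Preadditive (D i)] [∀ i, Linear k (D i)] : Linear k (∀ i, D i) where
  homModule x y := inferInstanceAs (Module k (∀ i, x i ⟶ y i))
  smul_comp _ _ _ _ _ _ := funext fun _ => Linear.smul_comp _ _ _ _ _ _
  comp_smul _ _ _ _ _ _ := funext fun _ => Linear.comp_smul _ _ _ _ _ _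

end SignedLinear

/-! ## Signed functors -/

section SignedFunctors

variable {C : Type u₁} [Category.{v₁} C] {D : Type u₂} [Category.{v₂} D]
  {E : Type u₃} [Category.{v₃} E]

/-- The functor `F` if `ε = 1`, its opposite if `ε = -1`. -/
@[simps]
def Signed.functor (ε : ℤˣ) (F : C ⥤ D) : Signed ε C ⥤ Signed ε D where
  obj x := ⟨F.obj x.un⟩
  map f := ⟨fun h => F.map (f.pos h), fun h => F.map (f.neg h)⟩
  map_id x := by ext h <;> simp
  map_comp f g := by ext h <;> simp

/-- The identification of `Signed (ε₂ * ε₁) C` with `Signed ε₂ (Signed ε₁ C)`. -/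
@[simps]
def Signed.split {ε ε₂ ε₁ : ℤˣ} (h : ε = ε₂ * ε₁) : Signed ε C ⥤ Signed ε₂ (Signed ε₁ C) where
  obj x := ⟨⟨x.un⟩⟩
  map f :=
    ⟨fun h₂ => ⟨fun h₁ => f.pos (by simp [h, h₁, h₂]), fun h₁ => f.neg (by simp [h, h₁, h₂])⟩,
     fun h₂ => ⟨fun h₁ => f.neg (by simp [h, h₁, h₂]), fun h₁ => f.pos (by simp [h, h₁, h₂])⟩⟩
  map_id x := by ext h <;> simp
  map_comp f g := by ext h <;> simp

theorem eq_neg_one_of_ne {ε : ℤˣ} (h : ¬ ε = 1) : ε = -1 :=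
  (Int.units_eq_one_or ε).resolve_left h

/-- The inverse identification of `Signed ε₂ (Signed ε₁ C)` with `Signed (ε₂ * ε₁) C`. -/
@[simps]
def Signed.merge {ε ε₂ ε₁ : ℤˣ} (h : ε = ε₂ * ε₁) : Signed ε₂ (Signed ε₁ C) ⥤ Signed ε C where
  obj x := ⟨x.un.un⟩
  map f :=
    ⟨fun h' => if h₂ : ε₂ = 1 then (f.pos h₂).pos (by simpa [h₂, h'] using h.symm)
        else (f.neg (eq_neg_one_of_ne h₂)).neg (by
          simpa [eq_neg_one_of_ne h₂, h', neg_eq_iff_eq_neg] using h.symm),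
     fun h' => if h₂ : ε₂ = 1 then (f.pos h₂).neg (by simpa [h₂, h'] using h.symm)
        else (f.neg (eq_neg_one_of_ne h₂)).pos (by
          simpa [eq_neg_one_of_ne h₂, h', neg_eq_iff_eq_neg] using h.symm)⟩
  map_id x := by ext h <;> simp
  map_comp f g := by
    ext h' <;> by_cases h₂ : ε₂ = 1 <;> simp [h₂]

/-- `Signed 1 C` is `C`; this is the identity `1`-morphism of `C`, as a signed functor. -/
@[simps]
def Signed.unit {ε : ℤˣ} (h : ε = 1) : Signed ε C ⥤ C where
  obj x := x.un
  map f := f.pos h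

/-- Composition of covariant and contravariant functors: for `G : {}^{ε₁}C ⥤ D` and
`F : {}^{ε₂}D ⥤ E` this is `F ∘ {}^{ε₂}G : {}^{ε₂ ε₁}C ⥤ E`. -/
@[simps!]
def sComp {ε ε₂ ε₁ : ℤˣ} (h : ε = ε₂ * ε₁) (F : Signed ε₂ D ⥤ E) (G : Signed ε₁ C ⥤ D) :
    Signed ε C ⥤ E :=
  Signed.split h ⋙ Signed.functor ε₂ G ⋙ F

end SignedFunctors

/-! ## Real `2`-representations on `k`-linear categories -/

section RealTwoReps

variable {k : Type w} [Field k] {Γ : Type u₁} [Group Γ] {π : Γ →* ℤˣ}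

/-- The data of a twisted Real `2`-representation of `ker π`, with Real structure
`π : Γ →* ℤˣ`, on a `k`-linear category `V`: a `k`-linear functor
`act ω : {}^{π ω}V ⥤ V` for each `ω`, natural isomorphisms
`psi ω₂ ω₁ ω : act ω₂ ∘ {}^{π ω₂}(act ω₁) ≅ act ω` whenever `ω₂ ω₁ = ω`, and a natural isomorphism
`psiE : act 1 ≅ 1_V`. -/
structure RealTwoRepData (k : Type w) [Field k] {Γ : Type u₁} [Group Γ] (π : Γ →* ℤˣ)
    (V : Type u) [Category.{v} V] [Preadditive V] [Linear k V] where
  act (ω : Γ) : Signed (π ω) V ⥤ V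
  act_additive (ω : Γ) : (act ω).Additive
  act_linear (ω : Γ) : (act ω).Linear k
  psi (ω₂ ω₁ ω : Γ) (h : ω₂ * ω₁ = ω) :
    sComp (show π ω = π ω₂ * π ω₁ by rw [← h, map_mul]) (act ω₂) (act ω₁) ≅ act ω
  psiE : act 1 ≅ Signed.unit (map_one π)

namespace RealTwoRepData

variable {V : Type u} [Category.{v} V] [Preadditive V] [Linear k V] (ρ : RealTwoRepData k π V)

attribute [instance] act_additive act_linear

/-- The value of `ρ(ω)` on the object `x`. -/
abbrev obj (ω : Γ) (x : V) : V := (ρ.act ω).obj ⟨x⟩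

/-- The component at `x` of `ψ_{ω₂,ω₁}`. -/
def psiApp (ω₂ ω₁ ω : Γ) (h : ω₂ * ω₁ = ω) (x : V) : ρ.obj ω₂ (ρ.obj ω₁ x) ≅ ρ.obj ω x :=
  (ρ.psi ω₂ ω₁ ω h).app ⟨x⟩

/-- The component at `x` of `ψ_e`. -/
def psiEApp (x : V) : ρ.obj 1 x ≅ x :=
  ρ.psiE.app ⟨x⟩

/-- The effect of `{}^{ε}(-)^{ε}` followed by `ρ(ω)`, `ε = π(ω)`, on isomorphisms: `ρ(ω)` is applied
to `e` if `π(ω) = 1` and to `e⁻¹` if `π(ω) = -1`. -/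
def actIso (ω : Γ) {x y : V} (e : x ≅ y) : ρ.obj ω x ≅ ρ.obj ω y :=
  (ρ.act ω).mapIso (Signed.iso (π ω) e)

/-- The identification of `ρ(ω)(x)` and `ρ(ω')(x')` for equal arguments. -/
def castIso {ω ω' : Γ} {x x' : V} (h : ω = ω') (hx : x = x') : ρ.obj ω x ≅ ρ.obj ω' x' :=
  eqToIso (by subst h hx; rfl)

/-- The laws of an `α`-twisted Real `2`-representation. -/
structure IsTwisted (α : Γ → Γ → Γ → kˣ) : Prop where
  isEquivalence (ω : Γ) : (ρ.act ω).IsEquivalence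
  assoc (ω₃ ω₂ ω₁ : Γ) (x : V) :
    (α ω₃ ω₂ ω₁ : k) • ((ρ.psiApp ω₃ ω₂ (ω₃ * ω₂) rfl (ρ.obj ω₁ x)).hom ≫
        (ρ.psiApp (ω₃ * ω₂) ω₁ (ω₃ * ω₂ * ω₁) rfl x).hom) =
      (ρ.actIso ω₃ (ρ.psiApp ω₂ ω₁ (ω₂ * ω₁) rfl x)).hom ≫
        (ρ.psiApp ω₃ (ω₂ * ω₁) (ω₃ * ω₂ * ω₁) (mul_assoc _ _ _).symm x).hom
  unit_left (ω : Γ) (x : V) : ρ.psiApp 1 ω ω (one_mul ω) x = ρ.psiEApp (ρ.obj ω x)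
  unit_right (ω : Γ) (x : V) : ρ.psiApp ω 1 ω (mul_one ω) x = ρ.actIso ω (ρ.psiEApp x)

end RealTwoRepData

end RealTwoReps

/-! ## Cocycles and the unoriented loop groupoid -/

section Loops

/-- Normalized `π`-twisted `3`-cocycles on `BΓ` with values in `kˣ`, on which `Γ` acts through `π`
by inversion. The value on the simplex `[ω₃ | ω₂ | ω₁]` is `α ω₃ ω₂ ω₁`. -/
structure ThreeCocycle (k : Type w) [Field k] {Γ : Type u₁} [Group Γ] (π : Γ →* ℤˣ) where
  toFun : Γ → Γ → Γ → kˣ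
  cocycle (ω₄ ω₃ ω₂ ω₁ : Γ) :
    toFun (ω₄ * ω₃) ω₂ ω₁ * toFun ω₄ ω₃ (ω₂ * ω₁) =
      toFun ω₃ ω₂ ω₁ ^ ((π ω₄ : ℤˣ) : ℤ) * toFun ω₄ (ω₃ * ω₂) ω₁ * toFun ω₄ ω₃ ω₂
  one_left (b a : Γ) : toFun 1 b a = 1
  one_mid (c a : Γ) : toFun c 1 a = 1
  one_right (c b : Γ) : toFun c b 1 = 1

variable {k : Type w} [Field k] {Γ : Type u₁} [Group Γ]

/-- Restriction of a `3`-cocycle to a subgroup. -/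
@[simps]
def ThreeCocycle.restrict {π : Γ →* ℤˣ} (α : ThreeCocycle k π) (H : Subgroup Γ) :
    ThreeCocycle k (π.comp H.subtype) where
  toFun c b a := α.toFun c b a
  cocycle d c b a := α.cocycle d c b a
  one_left b a := α.one_left b a
  one_mid c a := α.one_mid c a
  one_right c b := α.one_right c b

/-- Objects of the unoriented loop groupoid of `BΓ`: the loops of degree one. -/
@[ext]
structure Loop (π : Γ →* ℤˣ) : Type u₁ where
  el : Γ
  deg : π el = 1

/-- Real conjugation `γ ↦ ω γ^{π(ω)} ω⁻¹`. -/
def realConj (π : Γ →* ℤˣ) (ω γ : Γ) : Γ := ω * γ ^ ((π ω : ℤˣ) : ℤ) * ω⁻¹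

theorem realConj_one (π : Γ →* ℤˣ) (γ : Γ) : realConj π 1 γ = γ := by simp [realConj]

theorem realConj_mul (π : Γ →* ℤˣ) (ω₂ ω₁ γ : Γ) :
    realConj π (ω₂ * ω₁) γ = realConj π ω₂ (realConj π ω₁ γ) := by
  rcases Int.units_eq_one_or (π ω₂) with h₂ | h₂ <;>
    rcases Int.units_eq_one_or (π ω₁) with h₁ | h₁ <;>
    simp [realConj, h₁, h₂, mul_assoc]

theorem realConj_deg (π : Γ →* ℤˣ) (ω : Γ) {γ : Γ} (h : π γ = 1) : π (realConj π ω γ) = 1 := by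
  simp [realConj, h]

/-- The unoriented loop groupoid of `BΓ`: a morphism `γ₁ ⟶ γ₂` is an element `ω` of `Γ` with
`γ₂ = ω γ₁^{π(ω)} ω⁻¹`. The composition of `ω₁` followed by `ω₂` is `ω₂ ω₁`. -/
instance loopGroupoid (π : Γ →* ℤˣ) : Groupoid.{u₁} (Loop π) where
  Hom γ₁ γ₂ := {ω : Γ // realConj π ω γ₁.el = γ₂.el}
  id γ := ⟨1, realConj_one π γ.el⟩
  comp f g := ⟨g.1 * f.1, by rw [realConj_mul, f.2, g.2]⟩
  id_comp f := Subtype.ext (mul_one _)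
  comp_id f := Subtype.ext (one_mul _)
  assoc f g h := Subtype.ext (mul_assoc _ _ _).symm
  inv {γ₁ _} f := ⟨f.1⁻¹, (congrArg _ f.2.symm).trans (by
    rw [← realConj_mul, inv_mul_cancel, realConj_one])⟩
  inv_comp f := Subtype.ext (mul_inv_cancel f.1)
  comp_inv f := Subtype.ext (inv_mul_cancel f.1)

/-- The canonical functor from the unoriented loop groupoid of a subgroup. -/
def loopInclusion (π : Γ →* ℤˣ) (H : Subgroup Γ) : Loop (π.comp H.subtype) ⥤ Loop π where
  obj γ := ⟨γ.el, γ.deg⟩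
  map f := ⟨f.1, by
    have := congrArg Subtype.val f.2
    simpa [realConj] using this⟩
  map_id _ := rfl
  map_comp _ _ := rfl

/-- Normalized `2`-cocycles on a category with values in `kˣ`. The value on the simplex
`[f₂ | f₁]` is `θ f₂ f₁`. -/
structure TwoCocycle (k : Type w) [Field k] (C : Type u) [Category.{v} C] where
  toFun {x y z : C} (f₂ : y ⟶ z) (f₁ : x ⟶ y) : kˣ
  cocycle {x y z t : C} (f₃ : z ⟶ t) (f₂ : y ⟶ z) (f₁ : x ⟶ y) :
    toFun f₃ f₂ * toFun (f₂ ≫ f₃) f₁ = toFun f₃ (f₁ ≫ f₂) * toFun f₂ f₁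
  id_left {x y : C} (f : x ⟶ y) : toFun (𝟙 y) f = 1
  id_right {x y : C} (f : x ⟶ y) : toFun f (𝟙 x) = 1

/-- The value of the reflection twisted loop transgression of `α` on `[ω₂ | ω₁]γ`. -/
def transgressionFun (π : Γ →* ℤˣ) (α : Γ → Γ → Γ → kˣ) (ω₂ ω₁ γ : Γ) : kˣ :=
  α γ γ⁻¹ γ ^ (if π ω₂ = -1 ∧ π ω₁ = -1 then 1 else 0 : ℕ) *
    (α (ω₁ * γ ^ (-((π ω₁ : ℤˣ) : ℤ)) * ω₁⁻¹) (ω₁ * γ ^ ((π ω₁ : ℤˣ) : ℤ) * ω₁⁻¹) ω₁ *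
        α ω₁ (γ ^ (-((π ω₁ : ℤˣ) : ℤ))) (γ ^ ((π ω₁ : ℤˣ) : ℤ)) /
        α (ω₁ * γ ^ (-((π ω₁ : ℤˣ) : ℤ)) * ω₁⁻¹) ω₁ (γ ^ ((π ω₁ : ℤˣ) : ℤ))) ^
      ((((π ω₂ : ℤˣ) : ℤ) - 1) / 2) *
    (α ω₂ ω₁ (γ ^ ((π (ω₂ * ω₁) : ℤˣ) : ℤ)) *
        α (ω₂ * ω₁ * γ ^ ((π (ω₂ * ω₁) : ℤˣ) : ℤ) * (ω₂ * ω₁)⁻¹) ω₂ ω₁ /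
        α ω₂ (ω₁ * γ ^ ((π (ω₂ * ω₁) : ℤˣ) : ℤ) * ω₁⁻¹) ω₁)

theorem ThreeCocycle.additive {π : Γ →* ℤˣ} (α : ThreeCocycle k π) (d c b a : Γ) :
    Additive.ofMul (α.toFun (d * c) b a) + Additive.ofMul (α.toFun d c (b * a)) =
      ((π d : ℤˣ) : ℤ) • Additive.ofMul (α.toFun c b a) + Additive.ofMul (α.toFun d (c * b) a) +
        Additive.ofMul (α.toFun d c b) := by
  have h := congrArg Additive.ofMul (α.cocycle d c b a)
  simpa only [ofMul_mul, ofMul_zpow] using h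

theorem transgressionFun_cocycle (π : Γ →* ℤˣ) (α : ThreeCocycle k π) (c b a g : Γ)
    (hg : π g = 1) :
    transgressionFun π α.toFun c b (realConj π a g) * transgressionFun π α.toFun (c * b) a g =
      transgressionFun π α.toFun c (b * a) g * transgressionFun π α.toFun b a g := by
  apply Additive.ofMul.injective
  rcases Int.units_eq_one_or (π a) with ha | ha <;>
    rcases Int.units_eq_one_or (π b) with hb | hb <;>
    rcases Int.units_eq_one_or (π c) with hc | hc
  · have r₁ := α.additive (c * b * a * g * (c * b * a)⁻¹) c b a
    have r₂ := α.additive c (b * a * g * (b * a)⁻¹) b a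
    have r₃ := α.additive c b (a * g * a⁻¹) a
    have r₄ := α.additive c b a g
    simp [transgressionFun, realConj, ha, hb, hc, hg, mul_assoc, α.one_left, α.one_mid, α.one_right] at *
    linear_combination (norm := module) r₂ - r₁ - r₃ + r₄
  · have r₁ := α.additive (c * b * a * g⁻¹ * (c * b * a)⁻¹) c b a
    have r₂ := α.additive c (b * a * g⁻¹ * (b * a)⁻¹) b a
    have r₃ := α.additive c b (a * g⁻¹ * a⁻¹) a
    have r₄ := α.additive c b a g⁻¹
    have s₁ := α.additive (b * a * g⁻¹ * (b * a)⁻¹) (b * a * g * (b * a)⁻¹) b a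
    have s₂ := α.additive (b * a * g⁻¹ * (b * a)⁻¹) b (a * g * a⁻¹) a
    have s₃ := α.additive (b * a * g⁻¹ * (b * a)⁻¹) b a g
    have s₄ := α.additive b (a * g⁻¹ * a⁻¹) (a * g * a⁻¹) a
    have s₅ := α.additive b (a * g⁻¹ * a⁻¹) a g
    have s₆ := α.additive b a g⁻¹ g
    simp [transgressionFun, realConj, ha, hb, hc, hg, mul_assoc, α.one_left, α.one_mid, α.one_right] at *
    linear_combination (norm := module) r₂ - r₁ - r₃ + r₄ + s₁ - s₂ + s₃ + s₄ - s₅ + s₆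
  · have r₁ := α.additive (c * b * a * g⁻¹ * (c * b * a)⁻¹) c b a
    have r₂ := α.additive c (b * a * g⁻¹ * (b * a)⁻¹) b a
    have r₃ := α.additive c b (a * g⁻¹ * a⁻¹) a
    have r₄ := α.additive c b a g⁻¹
    simp [transgressionFun, realConj, ha, hb, hc, hg, mul_assoc, α.one_left, α.one_mid, α.one_right] at *
    linear_combination (norm := module) r₂ - r₁ - r₃ + r₄
  · have r₁ := α.additive (c * b * a * g * (c * b * a)⁻¹) c b a
    have r₂ := α.additive c (b * a * g * (b * a)⁻¹) b a
    have r₃ := α.additive c b (a * g * a⁻¹) a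
    have r₄ := α.additive c b a g
    have s₁ := α.additive (b * a * g * (b * a)⁻¹) (b * a * g⁻¹ * (b * a)⁻¹) b a
    have s₂ := α.additive (b * a * g * (b * a)⁻¹) b (a * g⁻¹ * a⁻¹) a
    have s₃ := α.additive (b * a * g * (b * a)⁻¹) b a g⁻¹
    have s₄ := α.additive b (a * g * a⁻¹) (a * g⁻¹ * a⁻¹) a
    have s₅ := α.additive b (a * g * a⁻¹) a g⁻¹
    have s₆ := α.additive b a g g⁻¹
    have t₁ := α.additive (a * g * a⁻¹) (a * g⁻¹ * a⁻¹) (a * g * a⁻¹) a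
    have t₂ := α.additive (a * g * a⁻¹) (a * g⁻¹ * a⁻¹) a g
    have t₃ := α.additive (a * g * a⁻¹) a g⁻¹ g
    have t₄ := α.additive a g g⁻¹ g
    simp [transgressionFun, realConj, ha, hb, hc, hg, mul_assoc, α.one_left, α.one_mid, α.one_right] at *
    linear_combination (norm := module) r₂ - r₁ - r₃ + r₄ + s₁ - s₂ + s₃ + s₄ - s₅ + s₆ - t₁ + t₂ - t₃ + t₄
  · have r₁ := α.additive (c * b * a * g⁻¹ * (c * b * a)⁻¹) c b a
    have r₂ := α.additive c (b * a * g⁻¹ * (b * a)⁻¹) b a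
    have r₃ := α.additive c b (a * g⁻¹ * a⁻¹) a
    have r₄ := α.additive c b a g⁻¹
    simp [transgressionFun, realConj, ha, hb, hc, hg, mul_assoc, α.one_left, α.one_mid, α.one_right] at *
    linear_combination (norm := module) r₂ - r₁ - r₃ + r₄
  · have r₁ := α.additive (c * b * a * g * (c * b * a)⁻¹) c b a
    have r₂ := α.additive c (b * a * g * (b * a)⁻¹) b a
    have r₃ := α.additive c b (a * g * a⁻¹) a
    have r₄ := α.additive c b a g
    have s₁ := α.additive (b * a * g * (b * a)⁻¹) (b * a * g⁻¹ * (b * a)⁻¹) b a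
    have s₂ := α.additive (b * a * g * (b * a)⁻¹) b (a * g⁻¹ * a⁻¹) a
    have s₃ := α.additive (b * a * g * (b * a)⁻¹) b a g⁻¹
    have s₄ := α.additive b (a * g * a⁻¹) (a * g⁻¹ * a⁻¹) a
    have s₅ := α.additive b (a * g * a⁻¹) a g⁻¹
    have s₆ := α.additive b a g g⁻¹
    simp [transgressionFun, realConj, ha, hb, hc, hg, mul_assoc, α.one_left, α.one_mid, α.one_right] at *
    linear_combination (norm := module) r₂ - r₁ - r₃ + r₄ + s₁ - s₂ + s₃ + s₄ - s₅ + s₆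
  · have r₁ := α.additive (c * b * a * g * (c * b * a)⁻¹) c b a
    have r₂ := α.additive c (b * a * g * (b * a)⁻¹) b a
    have r₃ := α.additive c b (a * g * a⁻¹) a
    have r₄ := α.additive c b a g
    simp [transgressionFun, realConj, ha, hb, hc, hg, mul_assoc, α.one_left, α.one_mid, α.one_right] at *
    linear_combination (norm := module) r₂ - r₁ - r₃ + r₄
  · have r₁ := α.additive (c * b * a * g⁻¹ * (c * b * a)⁻¹) c b a
    have r₂ := α.additive c (b * a * g⁻¹ * (b * a)⁻¹) b a
    have r₃ := α.additive c b (a * g⁻¹ * a⁻¹) a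
    have r₄ := α.additive c b a g⁻¹
    have s₁ := α.additive (b * a * g⁻¹ * (b * a)⁻¹) (b * a * g * (b * a)⁻¹) b a
    have s₂ := α.additive (b * a * g⁻¹ * (b * a)⁻¹) b (a * g * a⁻¹) a
    have s₃ := α.additive (b * a * g⁻¹ * (b * a)⁻¹) b a g
    have s₄ := α.additive b (a * g⁻¹ * a⁻¹) (a * g * a⁻¹) a
    have s₅ := α.additive b (a * g⁻¹ * a⁻¹) a g
    have s₆ := α.additive b a g⁻¹ g
    have t₁ := α.additive (a * g⁻¹ * a⁻¹) (a * g * a⁻¹) (a * g⁻¹ * a⁻¹) a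
    have t₂ := α.additive (a * g⁻¹ * a⁻¹) (a * g * a⁻¹) a g⁻¹
    have t₃ := α.additive (a * g⁻¹ * a⁻¹) a g g⁻¹
    have t₄ := α.additive a g⁻¹ g g⁻¹
    have u₁ := α.additive g g⁻¹ g g⁻¹
    simp [transgressionFun, realConj, ha, hb, hc, hg, mul_assoc, α.one_left, α.one_mid, α.one_right] at *
    linear_combination (norm := module) r₂ - r₁ - r₃ + r₄ + s₁ - s₂ + s₃ + s₄ - s₅ + s₆ - t₁ + t₂ - t₃ + t₄ + u₁

/-- The reflection twisted loop transgression of a `3`-cocycle on `BΓ`, a `2`-cocycle on the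
unoriented loop groupoid. -/
def transgression {π : Γ →* ℤˣ} (α : ThreeCocycle k π) : TwoCocycle k (Loop π) where
  toFun {γ _ _} f₂ f₁ := transgressionFun π α.toFun f₂.1 f₁.1 γ.el
  cocycle {γ _ _ _} f₃ f₂ f₁ := by
    have h := transgressionFun_cocycle π α f₃.1 f₂.1 f₁.1 γ.el γ.deg
    rwa [show realConj π f₁.1 γ.el = _ from f₁.2] at h
  id_left f := by
    change transgressionFun π α.toFun 1 f.1 _ = 1
    simp [transgressionFun, α.one_left, α.one_mid]
  id_right f := by
    change transgressionFun π α.toFun f.1 1 _ = 1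
    simp [transgressionFun, α.one_left, α.one_mid, α.one_right]

end Loops

/-! ## Twisted representations of groupoids and their induction -/

section GroupoidReps

/-- A family of vector spaces indexed by the objects of `C`, with a linear map for each
morphism. -/
structure BundleData (k : Type w) [Field k] (C : Type u) [Category.{v} C] where
  fib : C → ModuleCat.{v₁} k
  map {x y : C} (f : x ⟶ y) : fib x →ₗ[k] fib y

variable {k : Type w} [Field k]

/-- The laws of a `θ`-twisted representation (a `θ`-twisted vector bundle) of `C`. -/
structure BundleData.IsTwisted {C : Type u} [Category.{v} C] (E : BundleData.{w, v, u, v₁} k C)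
    (θ : TwoCocycle k C) : Prop where
  map_id (x : C) : E.map (𝟙 x) = LinearMap.id
  map_comp {x y z : C} (f₂ : y ⟶ z) (f₁ : x ⟶ y) :
    E.map f₂ ∘ₗ E.map f₁ = (θ.toFun f₂ f₁ : k) • E.map (f₁ ≫ f₂)

/-- Isomorphisms of (twisted) representations. -/
structure BundleData.Iso {C : Type u} [Category.{v} C] (E : BundleData.{w, v, u, v₁} k C)
    (E' : BundleData.{w, v, u, v₂} k C) where
  equiv (x : C) : E.fib x ≃ₗ[k] E'.fib x
  comm {x y : C} (f : x ⟶ y) (e : E.fib x) : equiv y (E.map f e) = E'.map f (equiv x e)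

variable {C : Type u₁} [Category.{v₁} C] {D : Type u₂} [Category.{v₂} D]

open scoped DirectSum Classical in
/-- The relations `s ⊗ a v = θ(s, F a) (s ∘ F a) ⊗ v` in the direct sum of copies `s ⊗ E y` of
`E y`, over all objects `y` of `C` and all morphisms `s : F y ⟶ x`. -/
noncomputable def indRel (F : C ⥤ D) (θ : TwoCocycle k D) (E : BundleData.{w, v₁, u₁, v₃} k C)
    (x : D) : Submodule k (⨁ p : (y : C) × (F.obj y ⟶ x), E.fib p.1) :=
  Submodule.span k {z | ∃ (y y' : C) (a : y ⟶ y') (s : F.obj y' ⟶ x) (v : E.fib y),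
    z = DirectSum.lof k _ (fun p : (y : C) × (F.obj y ⟶ x) => E.fib p.1) ⟨y', s⟩ (E.map a v) -
      (θ.toFun s (F.map a) : k) •
        DirectSum.lof k _ (fun p : (y : C) × (F.obj y ⟶ x) => E.fib p.1) ⟨y, F.map a ≫ s⟩ v}

open scoped DirectSum Classical in
/-- Translation by `f`, `s ⊗ v ↦ θ(f, s) (f ∘ s) ⊗ v`, before passing to the quotient. -/
noncomputable def indPreMap (F : C ⥤ D) (θ : TwoCocycle k D) (E : BundleData.{w, v₁, u₁, v₃} k C)
    {x x' : D} (f : x ⟶ x') :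
    (⨁ p : (y : C) × (F.obj y ⟶ x), E.fib p.1) →ₗ[k]
      (⨁ p : (y : C) × (F.obj y ⟶ x'), E.fib p.1) :=
  DirectSum.toModule k _ _ fun p => (θ.toFun f p.2 : k) •
    DirectSum.lof k _ (fun p : (y : C) × (F.obj y ⟶ x') => E.fib p.1) ⟨p.1, p.2 ≫ f⟩

theorem indRel_le (F : C ⥤ D) (θ : TwoCocycle k D) (E : BundleData.{w, v₁, u₁, v₃} k C)
    {x x' : D} (f : x ⟶ x') :
    indRel F θ E x ≤ (indRel F θ E x').comap (indPreMap F θ E f) := by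
  classical
  refine Submodule.span_le.2 ?_
  rintro z ⟨y, y', a, s, v, rfl⟩
  have h : DirectSum.lof k _ (fun p : (y : C) × (F.obj y ⟶ x') => E.fib p.1)
      ⟨y, (F.map a ≫ s) ≫ f⟩ v =
      DirectSum.lof k _ (fun p : (y : C) × (F.obj y ⟶ x') => E.fib p.1)
        ⟨y, F.map a ≫ s ≫ f⟩ v := by
    rw [Category.assoc]
  have hc := congrArg (Units.val : kˣ → k) (θ.cocycle f s (F.map a))
  simp only [Units.val_mul] at hc
  have key : indPreMap F θ E f
      (DirectSum.lof k _ (fun p : (y : C) × (F.obj y ⟶ x) => E.fib p.1) ⟨y', s⟩ (E.map a v) -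
      (θ.toFun s (F.map a) : k) •
        DirectSum.lof k _ (fun p : (y : C) × (F.obj y ⟶ x) => E.fib p.1) ⟨y, F.map a ≫ s⟩ v) =
      (θ.toFun f s : k) •
        (DirectSum.lof k _ (fun p : (y : C) × (F.obj y ⟶ x') => E.fib p.1) ⟨y', s ≫ f⟩
            (E.map a v) -
          (θ.toFun (s ≫ f) (F.map a) : k) •
            DirectSum.lof k _ (fun p : (y : C) × (F.obj y ⟶ x') => E.fib p.1)
              ⟨y, F.map a ≫ s ≫ f⟩ v) := by
    simp only [indPreMap, map_sub, map_smul, DirectSum.toModule_lof, LinearMap.smul_apply,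
      smul_sub, smul_smul, hc, h]
    rw [mul_comm]
  simp only [Submodule.comap_coe, Set.mem_preimage, SetLike.mem_coe]
  rw [key]
  exact Submodule.smul_mem _ _ (Submodule.subset_span ⟨y, y', a, s ≫ f, v, rfl⟩)

open scoped DirectSum in
/-- Twisted induction along a functor `F`, that is, `k^θ[D] ⊗_{k^θ[C]} E`: the fibre over `x` is
spanned by symbols `s ⊗ v` with `s : F y ⟶ x` and `v ∈ E y`, modulo
`s ⊗ a v = θ(s, F a) (s ∘ F a) ⊗ v`, and a morphism `f` acts by `s ⊗ v ↦ θ(f, s) (f ∘ s) ⊗ v`. -/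
noncomputable def ind (F : C ⥤ D) (θ : TwoCocycle k D) (E : BundleData.{w, v₁, u₁, v₃} k C) :
    BundleData.{w, v₂, u₂, max v₃ u₁ v₂} k D where
  fib x := ModuleCat.of k
    ((⨁ p : (y : C) × (F.obj y ⟶ x), E.fib p.1) ⧸ indRel F θ E x)
  map f := Submodule.mapQ _ _ (indPreMap F θ E f) (indRel_le F θ E f)

open scoped Classical in
/-- The element `s ⊗ v` of the induced representation. -/
noncomputable def indMk (F : C ⥤ D) (θ : TwoCocycle k D) (E : BundleData.{w, v₁, u₁, v₃} k C)
    {x : D} {y : C} (s : F.obj y ⟶ x) (v : E.fib y) : (ind F θ E).fib x :=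
  Submodule.Quotient.mk (DirectSum.lof k _
    (fun p : (y : C) × (F.obj y ⟶ x) => E.fib p.1) ⟨y, s⟩ v)

end GroupoidReps

/-! ## The Real categorical character -/

section Character

variable {k : Type w} [Field k] {Γ : Type u₁} [Group Γ] {π : Γ →* ℤˣ}
  {V : Type u} [Category.{v} V] [Preadditive V] [Linear k V]

namespace RealTwoRepData

variable (ρ : RealTwoRepData k π V)

/-- The categorical trace of `ρ(g)`, the vector space of natural transformations from `1_V` to
`ρ(g)`. -/
abbrev Tr (g : Loop π) : Type (max u v) := (Signed.unit (C := V) g.deg ⟶ ρ.act g.el)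

/-- The component `x ⟶ ρ(g)(x)` at `x` of an element of the categorical trace. -/
def trApp {g : Loop π} (φ : ρ.Tr g) (x : V) : x ⟶ ρ.obj g.el x := φ.app ⟨x⟩

/-- The cap `ρ(ω) ∘ {}^{π(ω)}ρ(ω⁻¹) ≅ 1_V`. -/
def cap (ω ω' : Γ) (h : ω * ω' = 1) (x : V) : ρ.obj ω (ρ.obj ω' x) ≅ x :=
  ρ.psiApp ω ω' 1 h x ≪≫ ρ.psiEApp x

/-- A morphism `x ⟶ y` of `V`, read in `Signed ε V` with `ε = 1`. -/
def posHom {ε : ℤˣ} (h : ε = 1) {x y : V} (f : x ⟶ y) : (⟨x⟩ : Signed ε V) ⟶ ⟨y⟩ :=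
  ⟨fun _ => f, fun h' => absurd (h.symm.trans h') (by decide)⟩

/-- Bending an element `φ : 1_V ⟹ ρ(g)` of the categorical trace into a transformation
`ρ(g⁻¹) ⟹ 1_V`, namely `ρ(g⁻¹) ⟹ ρ(g⁻¹) ∘ ρ(g) ⟹ 1_V`. -/
def bend {g : Loop π} (φ : ρ.Tr g) (x : V) : ρ.obj g.el⁻¹ x ⟶ x :=
  (ρ.act g.el⁻¹).map (posHom (by rw [map_inv, g.deg, inv_one]) (ρ.trApp φ x)) ≫
    (ρ.cap g.el⁻¹ g.el (inv_mul_cancel _) x).hom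

/-- An element `φ` of the categorical trace of `ρ(g)`, viewed as a transformation
`1 ⟹ {}^{ε}ρ(g^ε)` of endofunctors of `{}^{ε}V`: it is `φ` if `ε = 1`, and the opposite of the
bent transformation `ρ(g⁻¹) ⟹ 1_V` if `ε = -1`. -/
def signedTr (ε : ℤˣ) {g : Loop π} (p : Γ) (hp : p = g.el ^ (ε : ℤ)) (φ : ρ.Tr g) (x : V) :
    (⟨x⟩ : Signed ε V) ⟶ ⟨ρ.obj p x⟩ :=
  ⟨fun h => ρ.trApp φ x ≫ (ρ.castIso (by rw [hp, h]; simp) rfl).hom,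
   fun h => (ρ.castIso (by rw [hp, h]; simp) rfl).hom ≫ ρ.bend φ x⟩

/-- The morphism `{}^{ε₂}ρ(ω₁)(f)` of `Signed ε₂ V`. -/
def innerMap {ε ε₂ : ℤˣ} (ω₁ : Γ) (h : ε = ε₂ * π ω₁) {x y : V}
    (f : (⟨x⟩ : Signed ε V) ⟶ ⟨y⟩) : (⟨ρ.obj ω₁ x⟩ : Signed ε₂ V) ⟶ ⟨ρ.obj ω₁ y⟩ :=
  (Signed.functor ε₂ (ρ.act ω₁)).map ((Signed.split h).map f)

theorem psiApp_naturality (ω₂ ω₁ ω : Γ) (h : ω₂ * ω₁ = ω) (h' : π ω = π ω₂ * π ω₁) {x y : V}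
    (f : (⟨x⟩ : Signed (π ω) V) ⟶ ⟨y⟩) :
    (ρ.act ω₂).map (ρ.innerMap ω₁ h' f) ≫ (ρ.psiApp ω₂ ω₁ ω h y).hom =
      (ρ.psiApp ω₂ ω₁ ω h x).hom ≫ (ρ.act ω).map f :=
  (ρ.psi ω₂ ω₁ ω h).hom.naturality f

theorem psiEApp_naturality {x y : V} (f : (⟨x⟩ : Signed (π 1) V) ⟶ ⟨y⟩) :
    (ρ.act 1).map f ≫ (ρ.psiEApp y).hom = (ρ.psiEApp x).hom ≫ f.pos (map_one π) :=
  ρ.psiE.hom.naturality f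

theorem cap_naturality (ω ω' : Γ) (h : ω * ω' = 1) (h' : π 1 = π ω * π ω') {x y : V}
    (f : x ⟶ y) :
    (ρ.act ω).map (ρ.innerMap ω' h' (posHom (map_one π) f)) ≫ (ρ.cap ω ω' h y).hom =
      (ρ.cap ω ω' h x).hom ≫ f := by
  have h₁ := ρ.psiApp_naturality ω ω' 1 h h' (posHom (map_one π) f)
  have h₂ := ρ.psiEApp_naturality (posHom (map_one π) f)
  simp only [cap, Iso.trans_hom, Category.assoc]
  rw [← Category.assoc, h₁, Category.assoc, h₂]
  rfl

theorem castIso_naturality {p q : Γ} (h : p = q) {x y : V} (f : x ⟶ y) (hp : π p = 1)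
    (hq : π q = 1) :
    (ρ.act p).map (posHom hp f) ≫ (ρ.castIso h rfl).hom =
      (ρ.castIso h rfl).hom ≫ (ρ.act q).map (posHom hq f) := by
  subst h
  simp [castIso]

theorem trApp_naturality {g : Loop π} (φ : ρ.Tr g) {x y : V} (f : x ⟶ y) :
    f ≫ ρ.trApp φ y = ρ.trApp φ x ≫ (ρ.act g.el).map (posHom g.deg f) :=
  φ.naturality (posHom g.deg f : (⟨x⟩ : Signed (π g.el) V) ⟶ ⟨y⟩)

theorem posHom_comp {ε : ℤˣ} (h : ε = 1) {x y z : V} (f : x ⟶ y) (g : y ⟶ z) :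
    (posHom h (f ≫ g) : (⟨x⟩ : Signed ε V) ⟶ ⟨z⟩) = posHom h f ≫ posHom h g := by
  ext h'
  · rfl
  · exact absurd (h.symm.trans h') (by decide)

theorem innerMap_pos {ε ε₂ : ℤˣ} (p : Γ) (hp : π p = 1) (h : ε = ε₂ * π p) {x y : V}
    (f : (⟨x⟩ : Signed ε V) ⟶ ⟨y⟩) :
    ρ.innerMap p h f =
      ⟨fun h' => (ρ.act p).map (posHom hp (f.pos (by rw [h, hp, h', mul_one]))),
        fun h' => (ρ.act p).map (posHom hp (f.neg (by rw [h, hp, h', mul_one])))⟩ := by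
  ext h'
  · refine congrArg (ρ.act p).map ?_
    ext h''
    · rfl
    · exact absurd (hp.symm.trans h'') (by decide)
  · refine congrArg (ρ.act p).map ?_
    ext h''
    · rfl
    · exact absurd (hp.symm.trans h'') (by decide)

theorem bend_naturality {g : Loop π} (φ : ρ.Tr g) {x y : V} (f : x ⟶ y)
    (hg : π g.el⁻¹ = 1) :
    (ρ.act g.el⁻¹).map (posHom hg f) ≫ ρ.bend φ y = ρ.bend φ x ≫ f := by
  have h₁ := ρ.cap_naturality g.el⁻¹ g.el (inv_mul_cancel _) (by rw [← map_mul, inv_mul_cancel]) f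
  have h₂ : (posHom hg f : (⟨x⟩ : Signed (π g.el⁻¹) V) ⟶ ⟨y⟩) ≫ posHom hg (ρ.trApp φ y) =
      posHom hg (ρ.trApp φ x) ≫ ρ.innerMap g.el (by rw [← map_mul, inv_mul_cancel])
        (posHom (map_one π) f) := by
    rw [← posHom_comp, trApp_naturality, posHom_comp]
    congr 1
    rw [ρ.innerMap_pos g.el g.deg]
    ext h'
    · rfl
    · exact absurd (hg.symm.trans h') (by decide)
  simp only [bend, Category.assoc]
  rw [← h₁, ← Category.assoc, ← Category.assoc, ← Functor.map_comp, ← Functor.map_comp, h₂]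

theorem signedTr_naturality {ε : ℤˣ} {g : Loop π} (p : Γ) (hp : p = g.el ^ (ε : ℤ))
    (hp' : π p = 1) (φ : ρ.Tr g) {x y : Signed ε V} (A : x ⟶ y) :
    A ≫ ρ.signedTr ε p hp φ y.un = (ρ.signedTr ε p hp φ x.un : x ⟶ _) ≫
      (⟨fun h => (ρ.act p).map (posHom hp' (A.pos h)),
        fun h => (ρ.act p).map (posHom hp' (A.neg h))⟩ :
          (⟨ρ.obj p x.un⟩ : Signed ε V) ⟶ ⟨ρ.obj p y.un⟩) := by
  ext h
  · simp only [Signed.comp_pos, signedTr, Category.assoc]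
    rw [← Category.assoc, trApp_naturality, Category.assoc, castIso_naturality _ _ _ g.deg hp']
  · simp only [Signed.comp_neg, signedTr, Category.assoc]
    rw [← bend_naturality ρ φ (A.neg h) (by rw [map_inv, g.deg, inv_one]), ← Category.assoc,
      ← Category.assoc, castIso_naturality]

theorem loop_zpow_deg (g : Loop π) (n : ℤ) : π (g.el ^ n) = 1 := by
  rw [map_zpow, g.deg, one_zpow]

/-- The component at `x` of `β_{g,ω}(φ)`, where `g' = ω g^{π(ω)} ω⁻¹`:
`1 ⟹ ρ(ω) ρ(ω⁻¹) ⟹ ρ(ω) ρ(g^{π(ω)}) ρ(ω⁻¹) ⟹ ρ(ω g^{π(ω)}) ρ(ω⁻¹) ⟹ ρ(g') ρ(ω) ρ(ω⁻¹) ⟹ ρ(g')`.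
-/
def betaApp {g g' : Loop π} (ω : Γ) (hω : realConj π ω g.el = g'.el) (φ : ρ.Tr g) (x : V) :
    x ⟶ ρ.obj g'.el x :=
  (ρ.cap ω ω⁻¹ (mul_inv_cancel _) x).inv ≫
    (ρ.act ω).map (ρ.signedTr (π ω) (g.el ^ ((π ω : ℤˣ) : ℤ)) rfl φ (ρ.obj ω⁻¹ x)) ≫
    (ρ.psiApp ω (g.el ^ ((π ω : ℤˣ) : ℤ)) (ω * g.el ^ ((π ω : ℤˣ) : ℤ)) rfl
      (ρ.obj ω⁻¹ x)).hom ≫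
    (ρ.psiApp g'.el ω (ω * g.el ^ ((π ω : ℤˣ) : ℤ)) (by
      rw [← hω, realConj, inv_mul_cancel_right]) (ρ.obj ω⁻¹ x)).inv ≫
    (ρ.actIso g'.el (ρ.cap ω ω⁻¹ (mul_inv_cancel _) x)).hom

theorem betaApp_naturality {g g' : Loop π} (ω : Γ) (hω : realConj π ω g.el = g'.el)
    (φ : ρ.Tr g) {x y : V} (f : (⟨x⟩ : Signed (π g'.el) V) ⟶ ⟨y⟩) :
    f.pos g'.deg ≫ ρ.betaApp ω hω φ y = ρ.betaApp ω hω φ x ≫ (ρ.act g'.el).map f := by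
  have hp' : π (g.el ^ ((π ω : ℤˣ) : ℤ)) = 1 := loop_zpow_deg g _
  have hg' : g'.el * ω = ω * g.el ^ ((π ω : ℤˣ) : ℤ) := by
    rw [← hω, realConj, inv_mul_cancel_right]
  have h₀ : π 1 = π ω * π ω⁻¹ := by rw [← map_mul, mul_inv_cancel]
  generalize hp : g.el ^ ((π ω : ℤˣ) : ℤ) = p at hp' hg'
  have hc : π (ω * p) = π ω := by rw [map_mul, hp', mul_one]
  let A : (⟨ρ.obj ω⁻¹ x⟩ : Signed (π ω) V) ⟶ ⟨ρ.obj ω⁻¹ y⟩ :=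
    ρ.innerMap ω⁻¹ h₀ (posHom (map_one π) (f.pos g'.deg))
  let A' : (⟨ρ.obj ω⁻¹ x⟩ : Signed (π (ω * p)) V) ⟶ ⟨ρ.obj ω⁻¹ y⟩ :=
    ⟨fun h => A.pos (hc.symm.trans h), fun h => A.neg (hc.symm.trans h)⟩
  have e₁ := ρ.cap_naturality ω ω⁻¹ (mul_inv_cancel _) h₀ (f.pos g'.deg)
  have e₁' : f.pos g'.deg ≫ (ρ.cap ω ω⁻¹ (mul_inv_cancel _) y).inv =
      (ρ.cap ω ω⁻¹ (mul_inv_cancel _) x).inv ≫ (ρ.act ω).map A := by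
    rw [Iso.comp_inv_eq, Category.assoc, Iso.eq_inv_comp, e₁]
  have e₂ := ρ.signedTr_naturality p hp.symm hp' φ A
  have e₃ := ρ.psiApp_naturality ω p (ω * p) rfl (map_mul _ _ _) A'
  have e₃' : ρ.innerMap p (map_mul π ω p) A' =
      (⟨fun h => (ρ.act p).map (posHom hp' (A.pos h)),
        fun h => (ρ.act p).map (posHom hp' (A.neg h))⟩ :
          (⟨ρ.obj p (ρ.obj ω⁻¹ x)⟩ : Signed (π ω) V) ⟶ ⟨ρ.obj p (ρ.obj ω⁻¹ y)⟩) :=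
    ρ.innerMap_pos p hp' _ A'
  have hd : π (ω * p) = π g'.el * π ω := by rw [← map_mul, hg']
  have e₄ := ρ.psiApp_naturality g'.el ω (ω * p) hg' hd A'
  have e₄' : (ρ.act (ω * p)).map A' ≫ (ρ.psiApp g'.el ω (ω * p) hg' (ρ.obj ω⁻¹ y)).inv =
      (ρ.psiApp g'.el ω (ω * p) hg' (ρ.obj ω⁻¹ x)).inv ≫
        (ρ.act g'.el).map (ρ.innerMap ω hd A') := by
    rw [Iso.comp_inv_eq, Category.assoc, Iso.eq_inv_comp, e₄]
  have e₅ : ρ.innerMap ω hd A' ≫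
        (Signed.iso (π g'.el) (ρ.cap ω ω⁻¹ (mul_inv_cancel _) y)).hom =
      (Signed.iso (π g'.el) (ρ.cap ω ω⁻¹ (mul_inv_cancel _) x)).hom ≫ f := by
    ext h
    · exact e₁
    · exact absurd (g'.deg.symm.trans h) (by decide)
  have e₅' : (ρ.act g'.el).map (ρ.innerMap ω hd A') ≫
        (ρ.actIso g'.el (ρ.cap ω ω⁻¹ (mul_inv_cancel _) y)).hom =
      (ρ.actIso g'.el (ρ.cap ω ω⁻¹ (mul_inv_cancel _) x)).hom ≫ (ρ.act g'.el).map f := by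
    have := congrArg (ρ.act g'.el).map e₅
    rw [Functor.map_comp, Functor.map_comp] at this
    exact this
  rw [e₃'] at e₃
  subst hp
  simp only [betaApp, Category.assoc]
  rw [← e₅', ← reassoc_of% e₄', ← reassoc_of% e₃, ← Functor.map_comp_assoc, reassoc_of% e₁',
    ← Functor.map_comp_assoc]
  congr 3

/-- The component form of an element of the categorical trace determines it. -/
theorem tr_ext {g : Loop π} {φ φ' : ρ.Tr g} (h : ∀ x, ρ.trApp φ x = ρ.trApp φ' x) : φ = φ' := by
  ext ⟨x⟩
  exact h x

theorem trApp_add {g : Loop π} (φ φ' : ρ.Tr g) (x : V) :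
    ρ.trApp (φ + φ') x = ρ.trApp φ x + ρ.trApp φ' x := rfl

theorem trApp_smul {g : Loop π} (c : k) (φ : ρ.Tr g) (x : V) :
    ρ.trApp (c • φ) x = c • ρ.trApp φ x := rfl

theorem posHom_add {ε : ℤˣ} (h : ε = 1) {x y : V} (f g : x ⟶ y) :
    (posHom h (f + g) : (⟨x⟩ : Signed ε V) ⟶ ⟨y⟩) = posHom h f + posHom h g := by
  ext h'
  · rfl
  · exact absurd (h.symm.trans h') (by decide)

theorem posHom_smul {ε : ℤˣ} (h : ε = 1) (c : k) {x y : V} (f : x ⟶ y) :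
    (posHom h (c • f) : (⟨x⟩ : Signed ε V) ⟶ ⟨y⟩) = c • posHom h f := by
  ext h'
  · rfl
  · exact absurd (h.symm.trans h') (by decide)

theorem signedTr_add (ε : ℤˣ) {g : Loop π} (p : Γ) (hp : p = g.el ^ (ε : ℤ)) (φ φ' : ρ.Tr g)
    (x : V) : ρ.signedTr ε p hp (φ + φ') x = ρ.signedTr ε p hp φ x + ρ.signedTr ε p hp φ' x := by
  ext h
  · simp [signedTr, trApp_add]
  · simp [signedTr, bend, trApp_add, posHom_add]

theorem signedTr_smul (ε : ℤˣ) {g : Loop π} (p : Γ) (hp : p = g.el ^ (ε : ℤ)) (c : k)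
    (φ : ρ.Tr g) (x : V) : ρ.signedTr ε p hp (c • φ) x = c • ρ.signedTr ε p hp φ x := by
  ext h
  · simp [signedTr, trApp_smul]
  · simp [signedTr, bend, trApp_smul, posHom_smul]

/-- The map `β_{g,ω}` of categorical traces, where `g' = ω g^{π(ω)} ω⁻¹`. -/
def beta {g g' : Loop π} (ω : Γ) (hω : realConj π ω g.el = g'.el) : ρ.Tr g →ₗ[k] ρ.Tr g' where
  toFun φ := ⟨fun x => ρ.betaApp ω hω φ x.un, fun _ _ f => ρ.betaApp_naturality ω hω φ f⟩
  map_add' φ φ' := ρ.tr_ext fun x => by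
    change ρ.betaApp ω hω (φ + φ') x = ρ.betaApp ω hω φ x + ρ.betaApp ω hω φ' x
    simp [betaApp, signedTr_add]
  map_smul' c φ := ρ.tr_ext fun x => by
    change ρ.betaApp ω hω (c • φ) x = c • ρ.betaApp ω hω φ x
    simp [betaApp, signedTr_smul]

/-- The Real categorical character of `ρ`: over the loop `g` the categorical trace of `ρ(g)`, on
which the morphism `ω` of loops acts by `β_{g,ω}`. -/
def realCatChar : BundleData.{w, u₁, u₁, max u v} k (Loop π) where
  fib g := ModuleCat.of k (ρ.Tr g)
  map f := ρ.beta f.1 f.2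

end RealTwoRepData
end Character

/-! ## Linearity of signed functors -/

section SignedFunctorsLinear

variable {k : Type w} [Field k] {C : Type u₁} [Category.{v₁} C] [Preadditive C] [Linear k C]
  {D : Type u₂} [Category.{v₂} D] [Preadditive D] [Linear k D]

instance signedFunctor_additive (ε : ℤˣ) (F : C ⥤ D) [F.Additive] :
    (Signed.functor ε F).Additive where
  map_add {_ _ _ _} := Signed.hom_ext _ _ (fun _ => F.map_add) (fun _ => F.map_add)

instance signedFunctor_linear (ε : ℤˣ) (F : C ⥤ D) [F.Additive] [F.Linear k] :
    (Signed.functor ε F).Linear k where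
  map_smul {_ _} _ c := Signed.hom_ext _ _ (fun _ => F.map_smul c _) (fun _ => F.map_smul c _)

instance split_additive {ε ε₂ ε₁ : ℤˣ} (h : ε = ε₂ * ε₁) :
    (Signed.split (C := C) h).Additive where
  map_add {_ _ _ _} := rfl

instance split_linear {ε ε₂ ε₁ : ℤˣ} (h : ε = ε₂ * ε₁) :
    (Signed.split (C := C) h).Linear k where
  map_smul {_ _} _ _ := rfl

instance merge_additive {ε ε₂ ε₁ : ℤˣ} (h : ε = ε₂ * ε₁) :
    (Signed.merge (C := C) h).Additive where
  map_add {_ _ _ _} := by ext h' <;> by_cases h₂ : ε₂ = 1 <;> simp [h₂] <;> rfl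

instance merge_linear {ε ε₂ ε₁ : ℤˣ} (h : ε = ε₂ * ε₁) :
    (Signed.merge (C := C) h).Linear k where
  map_smul {_ _} _ _ := by ext h' <;> by_cases h₂ : ε₂ = 1 <;> simp [h₂] <;> rfl

/-- An isomorphism multiplied by a unit of `k`. -/
@[simps]
def smulIso (c : kˣ) {x y : C} (e : x ≅ y) : x ≅ y where
  hom := (c : k) • e.hom
  inv := ((c⁻¹ : kˣ) : k) • e.inv
  hom_inv_id := by simp [smul_smul]
  inv_hom_id := by simp [smul_smul]

theorem smul_square (c : k) {x y z t : C} (f : x ⟶ y) (g : y ⟶ z) (f' : x ⟶ t) (g' : t ⟶ z)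
    (h : f ≫ g = f' ≫ g') : f ≫ (c • g) = (c • f') ≫ g' := by
  rw [Linear.comp_smul, Linear.smul_comp, h]

end SignedFunctorsLinear

/-! ## Real induction -/

section Induction

theorem Signed.merge_functor_split {C : Type u₁} [Category.{v₁} C] {D : Type u₂} [Category.{v₂} D]
    {c a b s t e m r : ℤˣ} (hc : c = a * b) (hr : r = b * s) (hr' : r = t * e) (hm : m = a * t)
    (hm' : c * s = m * e) (F : Signed e C ⥤ D) {x y : Signed s C}
    (f : (⟨x⟩ : Signed c (Signed s C)) ⟶ ⟨y⟩) :
    (Signed.merge hm).map ((Signed.functor a (Signed.merge hr ⋙ Signed.split hr' ⋙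
      Signed.functor t F)).map ((Signed.split hc).map f)) =
      (Signed.functor m F).map ((Signed.split hm').map ((Signed.merge rfl).map f)) := by
  subst hc hm hr
  rcases Int.units_eq_one_or a with rfl | rfl <;> rcases Int.units_eq_one_or b with rfl | rfl <;>
    rcases Int.units_eq_one_or s with rfl | rfl <;> rcases Int.units_eq_one_or t with rfl | rfl <;>
    ext h <;> rfl

variable {k : Type w} [Field k] {Γ : Type u₁} [Group Γ] {π : Γ →* ℤˣ} {H : Subgroup Γ}
  {V : Type u} [Category.{v} V] [Preadditive V] [Linear k V]

/-- For a transversal `σ` of `Γ ⧸ H` and `ω i = j`, the element `η` of `H` with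
`ω σ_i = σ_j η`. -/
def trans (σ : Γ ⧸ H → Γ) (hσ : ∀ q, (σ q : Γ ⧸ H) = q) (ω : Γ) (i j : Γ ⧸ H) (h : ω • i = j) :
    H :=
  ⟨(σ j)⁻¹ * (ω * σ i), by
    rw [← QuotientGroup.eq, hσ j, ← h]
    conv_lhs => rw [← hσ i]
    rfl⟩

theorem trans_mul (σ : Γ ⧸ H → Γ) (hσ : ∀ q, (σ q : Γ ⧸ H) = q) (ω₂ ω₁ ω : Γ) (hω : ω₂ * ω₁ = ω)
    (i j l : Γ ⧸ H) (h₁ : ω₁ • i = j) (h₂ : ω₂ • j = l) (h : ω • i = l) :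
    trans σ hσ ω₂ j l h₂ * trans σ hσ ω₁ i j h₁ = trans σ hσ ω i l h := by
  apply Subtype.ext
  simp [trans, ← hω, mul_assoc]

theorem trans_one (σ : Γ ⧸ H → Γ) (hσ : ∀ q, (σ q : Γ ⧸ H) = q) (i j : Γ ⧸ H)
    (h : (1 : Γ) • i = j) : trans σ hσ 1 i j h = 1 := by
  apply Subtype.ext
  have : i = j := by rw [← h, one_smul]
  subst this
  simp [trans]

theorem trans_deg (σ : Γ ⧸ H → Γ) (hσ : ∀ q, (σ q : Γ ⧸ H) = q) (ω : Γ) (i j : Γ ⧸ H)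
    (h : ω • i = j) :
    π ω * π (σ i) = π (σ j) * (π.comp H.subtype) (trans σ hσ ω i j h) := by
  rw [MonoidHom.comp_apply, ← map_mul, ← map_mul]
  simp [trans]

/-- The category underlying the Real induction: the product over `q ∈ Γ ⧸ H` of the categories
`{}^{π(σ_q)}V`. -/
abbrev RIndCat (π : Γ →* ℤˣ) (V : Type u) (σ : Γ ⧸ H → Γ) : Type (max u₁ u) :=
  ∀ q : Γ ⧸ H, Signed (π (σ q)) V

namespace RealTwoRepData

variable (ρ : RealTwoRepData k (π.comp H.subtype) V) (σ : Γ ⧸ H → Γ)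
  (hσ : ∀ q, (σ q : Γ ⧸ H) = q)

/-- The `(j, i)` entry of the action of `ω` on the Real induction, where `ω i = j`. It is
`{}^{π(σ_j)}ρ(η)`, where `ω σ_i = σ_j η`. -/
def rindEntry (ω : Γ) (i j : Γ ⧸ H) (h : ω • i = j) :
    Signed (π ω) (Signed (π (σ i)) V) ⥤ Signed (π (σ j)) V :=
  Signed.merge rfl ⋙ Signed.split (trans_deg σ hσ ω i j h) ⋙
    Signed.functor (π (σ j)) (ρ.act (trans σ hσ ω i j h))

/-- The action of `ω` on the Real induction. -/
def rindAct (ω : Γ) : Signed (π ω) (RIndCat π V σ) ⥤ RIndCat π V σ :=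
  Functor.pi' fun j => Signed.functor (π ω) (Pi.eval (fun q => Signed (π (σ q)) V) (ω⁻¹ • j)) ⋙
    ρ.rindEntry σ hσ ω (ω⁻¹ • j) j (smul_inv_smul ω j)

theorem rindAct_map (ω : Γ) {x y : RIndCat π V σ} (f : (⟨x⟩ : Signed (π ω) (RIndCat π V σ)) ⟶ ⟨y⟩)
    (j : Γ ⧸ H) : (ρ.rindAct σ hσ ω).map f j =
      (ρ.rindEntry σ hσ ω (ω⁻¹ • j) j (smul_inv_smul ω j)).map
        ⟨fun h => f.pos h (ω⁻¹ • j), fun h => f.neg h (ω⁻¹ • j)⟩ := rfl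

instance rindEntry_additive (ω : Γ) (i j : Γ ⧸ H) (h : ω • i = j) :
    (ρ.rindEntry σ hσ ω i j h).Additive := by
  unfold rindEntry; infer_instance

instance rindEntry_linear (ω : Γ) (i j : Γ ⧸ H) (h : ω • i = j) :
    (ρ.rindEntry σ hσ ω i j h).Linear k := by
  unfold rindEntry; infer_instance

instance rindAct_additive (ω : Γ) : (ρ.rindAct σ hσ ω).Additive where
  map_add {x y f g} := funext fun j => by
    have := (ρ.rindEntry σ hσ ω (ω⁻¹ • j) j (smul_inv_smul ω j)).map_add
      (X := ⟨x.un (ω⁻¹ • j)⟩) (Y := ⟨y.un (ω⁻¹ • j)⟩)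
      (f := ⟨fun h => f.pos h (ω⁻¹ • j), fun h => f.neg h (ω⁻¹ • j)⟩)
      (g := ⟨fun h => g.pos h (ω⁻¹ • j), fun h => g.neg h (ω⁻¹ • j)⟩)
    exact this

instance rindAct_linear (ω : Γ) : (ρ.rindAct σ hσ ω).Linear k where
  map_smul {x y} f c := funext fun j => by
    have := (ρ.rindEntry σ hσ ω (ω⁻¹ • j) j (smul_inv_smul ω j)).map_smul c
      (X := ⟨x.un (ω⁻¹ • j)⟩) (Y := ⟨y.un (ω⁻¹ • j)⟩)
      ⟨fun h => f.pos h (ω⁻¹ • j), fun h => f.neg h (ω⁻¹ • j)⟩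
    exact this

/-- The composition isomorphism of the `(l, i)` entries, where `ω₁ i = j` and `ω₂ j = l`. -/
def rindPsiApp (α : ThreeCocycle k π) (ω₂ ω₁ ω : Γ) (hω : ω₂ * ω₁ = ω) (i i' j l : Γ ⧸ H)
    (h₁ : ω₁ • i = j) (h₂ : ω₂ • j = l) (h' : ω • i' = l) (hi : i = i') (x : RIndCat π V σ) :
    (⟨ρ.obj (trans σ hσ ω₂ j l h₂) (ρ.obj (trans σ hσ ω₁ i j h₁) (x i).un)⟩ :
      Signed (π (σ l)) V) ≅ ⟨ρ.obj (trans σ hσ ω i' l h') (x i').un⟩ :=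
  smulIso (α.toFun ω₂ (σ j) (trans σ hσ ω₁ i j h₁ : Γ) /
      (α.toFun ω₂ ω₁ (σ i) *
        α.toFun (σ l) (trans σ hσ ω₂ j l h₂ : Γ) (trans σ hσ ω₁ i j h₁ : Γ)))
    (Signed.iso (π (σ l))
      (ρ.psiApp (trans σ hσ ω₂ j l h₂) (trans σ hσ ω₁ i j h₁) (trans σ hσ ω i l (hi ▸ h'))
          (trans_mul σ hσ ω₂ ω₁ ω hω i j l h₁ h₂ (hi ▸ h')) (x i).un ≪≫
        ρ.castIso (by subst hi; rfl) (by rw [hi])))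

theorem psi_signed_naturality {π' : H →* ℤˣ} (ρ : RealTwoRepData k π' V) (η₂ η₁ η : H)
    (hη : η₂ * η₁ = η) {s m m' : ℤˣ} (hm : m = s * π' η₂) (hm' : m' = m * π' η₁)
    (hn : m' = s * π' η)
    {x y : V} (f : (⟨x⟩ : Signed m' V) ⟶ ⟨y⟩) :
    (ρ.innerMap η₂ hm (ρ.innerMap η₁ hm' f) ≫ (Signed.iso s (ρ.psiApp η₂ η₁ η hη y)).hom :
        (⟨ρ.obj η₂ (ρ.obj η₁ x)⟩ : Signed s V) ⟶ ⟨ρ.obj η y⟩) =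
      (Signed.iso s (ρ.psiApp η₂ η₁ η hη x)).hom ≫ ρ.innerMap η hn f := by
  have hd : π' η = π' η₂ * π' η₁ := by rw [← hη, map_mul]
  ext h
  · exact ρ.psiApp_naturality η₂ η₁ η hη hd ((Signed.split hn).map f |>.pos h)
  · have := ρ.psiApp_naturality η₂ η₁ η hη hd ((Signed.split hn).map f |>.neg h)
    simp only [Signed.comp_neg, Signed.iso_hom_neg]
    rw [Iso.inv_comp_eq, ← Category.assoc, Iso.eq_comp_inv]
    exact this

theorem rindPsiApp_naturality (α : ThreeCocycle k π) (ω₂ ω₁ ω : Γ) (hω : ω₂ * ω₁ = ω)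
    (hd : π ω = π ω₂ * π ω₁) (i i' j l : Γ ⧸ H)
    (h₁ : ω₁ • i = j) (h₂ : ω₂ • j = l) (h' : ω • i' = l) (hi : i = i') {x y : RIndCat π V σ}
    (f : (⟨x⟩ : Signed (π ω) (RIndCat π V σ)) ⟶ ⟨y⟩) :
    (ρ.rindEntry σ hσ ω₂ j l h₂).map
        ((Signed.functor (π ω₂) (ρ.rindEntry σ hσ ω₁ i j h₁)).map ((Signed.split hd).map
          (⟨fun h => f.pos h i, fun h => f.neg h i⟩ : (⟨x i⟩ : Signed (π ω) _) ⟶ ⟨y i⟩))) ≫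
        (ρ.rindPsiApp σ hσ α ω₂ ω₁ ω hω i i' j l h₁ h₂ h' hi y).hom =
      (ρ.rindPsiApp σ hσ α ω₂ ω₁ ω hω i i' j l h₁ h₂ h' hi x).hom ≫
        (ρ.rindEntry σ hσ ω i' l h').map
          (⟨fun h => f.pos h i', fun h => f.neg h i'⟩ : (⟨x i'⟩ : Signed (π ω) _) ⟶ ⟨y i'⟩) := by
  subst hi
  have e₁ := Signed.merge_functor_split hd rfl (trans_deg σ hσ ω₁ i j h₁) rfl
    (show π ω * π (σ i) = π ω₂ * π (σ j) * (π.comp H.subtype) (trans σ hσ ω₁ i j h₁) by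
      rw [hd, mul_assoc, trans_deg σ hσ ω₁ i j h₁, mul_assoc]) (ρ.act (trans σ hσ ω₁ i j h₁))
    (⟨fun h => f.pos h i, fun h => f.neg h i⟩ : (⟨x i⟩ : Signed (π ω) _) ⟶ ⟨y i⟩)
  have e₂ := ρ.psi_signed_naturality (trans σ hσ ω₂ j l h₂) (trans σ hσ ω₁ i j h₁)
    (trans σ hσ ω i l h') (trans_mul σ hσ ω₂ ω₁ ω hω i j l h₁ h₂ h')
    (trans_deg σ hσ ω₂ j l h₂)
    (show π ω * π (σ i) = π ω₂ * π (σ j) * (π.comp H.subtype) (trans σ hσ ω₁ i j h₁) by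
      rw [hd, mul_assoc, trans_deg σ hσ ω₁ i j h₁, mul_assoc]) (trans_deg σ hσ ω i l h')
    ((Signed.merge rfl).map
      (⟨fun h => f.pos h i, fun h => f.neg h i⟩ : (⟨x i⟩ : Signed (π ω) _) ⟶ ⟨y i⟩))
  have e₃ : (ρ.rindEntry σ hσ ω₂ j l h₂).map
        ((Signed.functor (π ω₂) (ρ.rindEntry σ hσ ω₁ i j h₁)).map ((Signed.split hd).map
          (⟨fun h => f.pos h i, fun h => f.neg h i⟩ : (⟨x i⟩ : Signed (π ω) _) ⟶ ⟨y i⟩))) =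
      ρ.innerMap (trans σ hσ ω₂ j l h₂) (trans_deg σ hσ ω₂ j l h₂)
        ((Signed.functor _ (ρ.act (trans σ hσ ω₁ i j h₁))).map _) :=
    congrArg (ρ.innerMap (trans σ hσ ω₂ j l h₂) (trans_deg σ hσ ω₂ j l h₂)) e₁
  have e₄ : ∀ z : RIndCat π V σ, (ρ.rindPsiApp σ hσ α ω₂ ω₁ ω hω i i j l h₁ h₂ h' rfl z).hom =
      ((α.toFun ω₂ (σ j) (trans σ hσ ω₁ i j h₁ : Γ) /
        (α.toFun ω₂ ω₁ (σ i) *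
          α.toFun (σ l) (trans σ hσ ω₂ j l h₂ : Γ) (trans σ hσ ω₁ i j h₁ : Γ)) : kˣ) : k) •
        (Signed.iso (π (σ l)) (ρ.psiApp (trans σ hσ ω₂ j l h₂) (trans σ hσ ω₁ i j h₁)
          (trans σ hσ ω i l h') (trans_mul σ hσ ω₂ ω₁ ω hω i j l h₁ h₂ h') (z i).un)).hom := by
    intro z
    simp only [rindPsiApp, smulIso_hom, castIso, eqToIso_refl, Iso.trans_refl]
  rw [e₄, e₄]
  exact (congrArg (· ≫ _) e₃).trans (smul_square _ _ _ _ _ e₂)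

/-- The unit isomorphism of the `(j, i)` entry of the action of `1`, where `i = j`. -/
def rindPsiEApp (i j : Γ ⧸ H) (h : (1 : Γ) • i = j) (hi : i = j) (x : RIndCat π V σ) :
    (⟨ρ.obj (trans σ hσ 1 i j h) (x i).un⟩ : Signed (π (σ j)) V) ≅ x j :=
  Signed.iso (π (σ j)) (ρ.castIso (trans_one σ hσ i j h) (by rw [hi]) ≪≫ ρ.psiEApp (x j).un)

theorem psiE_signed_naturality {π' : H →* ℤˣ} (ρ : RealTwoRepData k π' V) (η : H) (hη : η = 1)
    {s m : ℤˣ} (hm : m = s * π' η) (hm' : m = s) {x y : V} (f : (⟨x⟩ : Signed m V) ⟶ ⟨y⟩) :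
    ρ.innerMap η hm f ≫ (Signed.iso s (ρ.castIso hη rfl ≪≫ ρ.psiEApp y)).hom =
      (Signed.iso s (ρ.castIso hη rfl ≪≫ ρ.psiEApp x)).hom ≫
        (⟨fun h => f.pos (hm'.trans h), fun h => f.neg (hm'.trans h)⟩ :
          (⟨x⟩ : Signed s V) ⟶ ⟨y⟩) := by
  subst hη
  simp only [castIso, eqToIso_refl, Iso.refl_trans]
  ext h
  · exact ρ.psiEApp_naturality (((Signed.split hm).map f).pos h)
  · have := ρ.psiEApp_naturality (((Signed.split hm).map f).neg h)
    simp only [Signed.comp_neg, Signed.iso_hom_neg]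
    rw [Iso.inv_comp_eq, ← Category.assoc, Iso.eq_comp_inv]
    exact this

theorem rindPsiEApp_naturality (i j : Γ ⧸ H) (h : (1 : Γ) • i = j) (hi : i = j)
    {x y : RIndCat π V σ} (f : (⟨x⟩ : Signed (π 1) (RIndCat π V σ)) ⟶ ⟨y⟩) :
    (ρ.rindEntry σ hσ 1 i j h).map
        (⟨fun h => f.pos h i, fun h => f.neg h i⟩ : (⟨x i⟩ : Signed (π 1) _) ⟶ ⟨y i⟩) ≫
        (ρ.rindPsiEApp σ hσ i j h hi y).hom =
      (ρ.rindPsiEApp σ hσ i j h hi x).hom ≫ f.pos (map_one π) j := by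
  subst hi
  have hm : π 1 * π (σ i) = π (σ i) := by rw [map_one, one_mul]
  refine (ρ.psiE_signed_naturality _ (trans_one σ hσ i i h) (trans_deg σ hσ 1 i i h) hm
    ((Signed.merge rfl).map (⟨fun h => f.pos h i, fun h => f.neg h i⟩ :
      (⟨x i⟩ : Signed (π 1) _) ⟶ ⟨y i⟩))).trans (congrArg (_ ≫ ·) ?_)
  have h₁ : (π 1 : ℤˣ) = 1 := map_one π
  refine Signed.hom_ext _ _ (fun h' => ?_) (fun h' => ?_)
  · exact dif_pos h₁
  · exact dif_pos h₁

/-- The Real induction of `ρ` from `H` to `Γ`, with respect to the transversal `σ`. -/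
def rind (α : ThreeCocycle k π) : RealTwoRepData k π (RIndCat π V σ) where
  act := ρ.rindAct σ hσ
  act_additive := ρ.rindAct_additive σ hσ
  act_linear := ρ.rindAct_linear σ hσ
  psi ω₂ ω₁ ω h := NatIso.ofComponents
    (fun x => Pi.isoMk fun l => ρ.rindPsiApp σ hσ α ω₂ ω₁ ω h (ω₁⁻¹ • ω₂⁻¹ • l) (ω⁻¹ • l)
      (ω₂⁻¹ • l) l (smul_inv_smul _ _) (smul_inv_smul _ _) (smul_inv_smul _ _)
      (by rw [← h, mul_inv_rev, mul_smul]) x.un)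
    (fun {_ _} f => funext fun l => ρ.rindPsiApp_naturality σ hσ α ω₂ ω₁ ω h
      (by rw [← h, map_mul]) (ω₁⁻¹ • ω₂⁻¹ • l) (ω⁻¹ • l)
      (ω₂⁻¹ • l) l (smul_inv_smul _ _) (smul_inv_smul _ _) (smul_inv_smul _ _)
      (by rw [← h, mul_inv_rev, mul_smul]) f)
  psiE := NatIso.ofComponents
    (fun x => Pi.isoMk fun l => ρ.rindPsiEApp σ hσ ((1 : Γ)⁻¹ • l) l (smul_inv_smul _ _)
      (by rw [inv_one, one_smul]) x.un)
    (fun {_ _} f => funext fun l => ρ.rindPsiEApp_naturality σ hσ ((1 : Γ)⁻¹ • l) l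
      (smul_inv_smul _ _) (by rw [inv_one, one_smul]) f)

end RealTwoRepData
end Induction

/-! ## The summands of the categorical trace of a Real induction -/

section Summands

variable {k : Type w} [Field k] {Γ : Type u₁} [Group Γ] {π : Γ →* ℤˣ} {H : Subgroup Γ}
  {V : Type u} [Category.{v} V] [Preadditive V] [Linear k V]
  (σ : Γ ⧸ H → Γ) (hσ : ∀ q, (σ q : Γ ⧸ H) = q)

/-- For a coset `q` fixed by the loop `g`, the loop `σ_q⁻¹ g^{π(σ_q)} σ_q` of `BH`. -/
def fixedLoop (g : Loop π) (q : Γ ⧸ H) (hq : g.el • q = q) : Loop (π.comp H.subtype) where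
  el := trans σ hσ g.el q q hq ^ ((π (σ q) : ℤˣ) : ℤ)
  deg := by
    have h := trans_deg (π := π) σ hσ g.el q q hq
    rw [g.deg, one_mul, left_eq_mul] at h
    rw [map_zpow, h, one_zpow]

/-- The representative `σ_q`, as a morphism from `σ_q⁻¹ g^{π(σ_q)} σ_q` to `g` in the unoriented
loop groupoid of `BΓ`. -/
def fixedLoopHom (g : Loop π) (q : Γ ⧸ H) (hq : g.el • q = q) :
    (loopInclusion π H).obj (fixedLoop σ hσ g q hq) ⟶ g :=
  ⟨σ q, by
    rcases Int.units_eq_one_or (π (σ q)) with h | h <;>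
      simp [realConj, loopInclusion, fixedLoop, trans, h, mul_assoc]⟩

/-- For a coset `q` fixed by the loop `g`, the natural transformation `T` from `1` to
`RInd(ρ)(g)` is concentrated in the summand `q`, and there it is `v` if `π(σ_q) = 1` and the
opposite of the bent transformation of `v` if `π(σ_q) = -1`. -/
structure IsSummandOf (ρ : RealTwoRepData k (π.comp H.subtype) V) (α : ThreeCocycle k π)
    (g : Loop π) (q : Γ ⧸ H) (hq : g.el • q = q) (v : ρ.Tr (fixedLoop σ hσ g q hq))
    (T : (ρ.rind σ hσ α).Tr g) : Prop where
  diagonal (x : RIndCat π V σ) (hq' : g.el⁻¹ • q = q) :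
    ((ρ.rind σ hσ α).trApp T x q ≫
        (Signed.iso (π (σ q)) (ρ.castIso
          (x := (x (g.el⁻¹ • q)).un) (x' := (x q).un)
          (show trans σ hσ g.el (g.el⁻¹ • q) q (smul_inv_smul _ _) = trans σ hσ g.el q q hq by
            simp only [hq']) (by rw [hq']))).hom :
        x q ⟶ ⟨ρ.obj (trans σ hσ g.el q q hq) (x q).un⟩) =
      ρ.signedTr (π (σ q)) (trans σ hσ g.el q q hq) (by
        rcases Int.units_eq_one_or (π (σ q)) with h | h <;> simp [fixedLoop, h]) v (x q).un
  off_diagonal (x : RIndCat π V σ) (r : Γ ⧸ H) (hr : r ≠ q) : (ρ.rind σ hσ α).trApp T x r = 0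

end Summands

end RealTwoRep

open RealTwoRep

/-!
An element of the categorical trace of the Real induction over `g` is a family of natural
transformations, one for each coset. Naturality with respect to the projection to a single component
kills the components at the cosets moved by `g`, and at a coset `q` fixed by `g` leaves an arbitrary
element of the trace of `ρ` over `h_q = σ_q⁻¹ g^{π(σ_q)} σ_q`, bent into a transformation
`ρ(h_q⁻¹) ⇒ 1` if `π(σ_q) = -1`. On the other side, the morphisms `σ_q : h_q ⟶ g` at fixed cosets
form a transversal of the inclusion of loop groupoids, so the induced fibre over `g` is the product
of the same spaces. The two actions agree because conjugation commutes with bending up to a scalar,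
and because the cocycle identity of `α` equates the scalars of the Real induction with the quotient
of transgressions by which the induced representation is twisted.

Bending exchanges the direction of arrows, so both signs are treated uniformly by working with
morphisms of the signed category `Signed ε V`.
-/

namespace RealTwoRep

/-- The type of morphisms `x ⟶ y` of `Signed ε C`, for objects `x` and `y` of `C`. -/
local notation:10 x:11 " ⟶[" ε "] " y:11 => Quiver.Hom (V := Signed ε _) ⟨x⟩ ⟨y⟩

/-! ### Morphisms of signed categories -/

section SignedMorphisms

variable {C : Type u} [Category.{v} C] {ε ε' : ℤˣ} {x y z : C}

theorem Signed.hom_ext_of_one (hε : ε = 1) {f g : x ⟶[ε] y} (h : f.pos hε = g.pos hε) : f = g :=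
  Signed.hom_ext _ _ (fun _ => h) (fun h' => absurd (hε.symm.trans h') (by decide))

theorem Signed.hom_ext_of_neg_one (hε : ε = -1) {f g : x ⟶[ε] y} (h : f.neg hε = g.neg hε) :
    f = g :=
  Signed.hom_ext _ _ (fun h' => absurd (h'.symm.trans hε) (by decide)) (fun _ => h)

theorem Signed.iso_trans_hom (ε : ℤˣ) (a : x ≅ y) (b : y ≅ z) :
    (Signed.iso ε (a ≪≫ b)).hom = (Signed.iso ε a).hom ≫ (Signed.iso ε b).hom := rfl

/-- A morphism of `Signed (-ε) C`, read backwards as a morphism of `Signed ε C`. -/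
def Signed.flip (h : ε' = -ε) (f : x ⟶[ε'] y) : y ⟶[ε] x :=
  ⟨fun h' => f.neg (by rw [h, h']), fun h' => f.pos (by rw [h, h', neg_neg])⟩

theorem Signed.flip_injective (h : ε' = -ε) :
    Function.Injective (Signed.flip h : (x ⟶[ε'] y) → (y ⟶[ε] x)) :=
  Function.LeftInverse.injective (g := Signed.flip (by rw [h, neg_neg])) fun _ => rfl

theorem Signed.flip_comp (h : ε' = -ε) (f : x ⟶[ε'] y) (f' : y ⟶[ε'] z) :
    Signed.flip h (f ≫ f') = Signed.flip h f' ≫ Signed.flip h f := rfl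

theorem Signed.flip_iso (h : ε' = -ε) (a : x ≅ y) :
    Signed.flip h (Signed.iso ε' a).hom = (Signed.iso ε a).inv := rfl

theorem Signed.flip_smul {k : Type w} [Field k] [Preadditive C] [Linear k C] (h : ε' = -ε) (c : k)
    (f : x ⟶[ε'] y) : Signed.flip h (c • f) = c • Signed.flip h f := rfl

end SignedMorphisms

namespace RealTwoRepData

variable {k : Type w} [Field k] {Γ : Type u₁} [Group Γ] {π : Γ →* ℤˣ}
  {V : Type u} [Category.{v} V] [Preadditive V] [Linear k V] (ρ : RealTwoRepData k π V)

/-! ### The action on signed morphisms -/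

section InnerMap

variable {ε ε' s s' : ℤˣ} {x y z : V}

theorem innerMap_comp (ω : Γ) (h : ε = s * π ω) (f : x ⟶[ε] y) (f' : y ⟶[ε] z) :
    ρ.innerMap ω h (f ≫ f') = ρ.innerMap ω h f ≫ ρ.innerMap ω h f' := by
  simp only [innerMap, Functor.map_comp]
  exact Functor.map_comp _ _ _

theorem innerMap_smul (ω : Γ) (h : ε = s * π ω) (c : k) (f : x ⟶[ε] y) :
    ρ.innerMap ω h (c • f) = c • ρ.innerMap ω h f := by
  simp only [innerMap, Functor.map_smul]
  exact Functor.map_smul _ _ _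

theorem innerMap_iso (ω : Γ) (h : ε = s * π ω) (a : x ≅ y) :
    ρ.innerMap ω h (Signed.iso ε a).hom = (Signed.iso s (ρ.actIso ω a)).hom := by
  subst h
  ext h' <;> refine congrArg (ρ.act ω).map ?_ <;> ext h'' <;> rfl

theorem actIso_trans (ω : Γ) (a : x ≅ y) (b : y ≅ z) :
    ρ.actIso ω (a ≪≫ b) = ρ.actIso ω a ≪≫ ρ.actIso ω b :=
  Iso.ext ((ρ.act ω).map_comp (Signed.iso _ a).hom (Signed.iso _ b).hom)

theorem flip_innerMap (ω : Γ) (h : ε = s * π ω) (h' : ε' = s' * π ω) (hε : ε' = -ε)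
    (hs : s' = -s) (f : x ⟶[ε'] y) :
    Signed.flip hs (ρ.innerMap ω h' f) = ρ.innerMap ω h (Signed.flip hε f) := by
  ext h₁ <;> refine congrArg (ρ.act ω).map ?_ <;> ext h₂ <;> rfl

theorem innerMap_psiApp (ω₂ ω₁ ω : Γ) (hω : ω₂ * ω₁ = ω) (h₂ : ε = s * π ω₂)
    (h₁ : ε' = ε * π ω₁) (h : ε' = s * π ω) (f : x ⟶[ε'] y) :
    ρ.innerMap ω₂ h₂ (ρ.innerMap ω₁ h₁ f) ≫ (Signed.iso s (ρ.psiApp ω₂ ω₁ ω hω y)).hom =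
      (Signed.iso s (ρ.psiApp ω₂ ω₁ ω hω x)).hom ≫ ρ.innerMap ω h f := by
  have hd : π ω = π ω₂ * π ω₁ := by rw [← hω, map_mul]
  ext h'
  · exact ρ.psiApp_naturality ω₂ ω₁ ω hω hd (((Signed.split h).map f).pos h')
  · simp only [Signed.comp_neg, Signed.iso_hom_neg]
    rw [Iso.inv_comp_eq, ← Category.assoc, Iso.eq_comp_inv]
    exact ρ.psiApp_naturality ω₂ ω₁ ω hω hd (((Signed.split h).map f).neg h')

theorem innerMap_psiEApp (h : s = s * π 1) (f : x ⟶[s] y) :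
    ρ.innerMap 1 h f ≫ (Signed.iso s (ρ.psiEApp y)).hom =
      (Signed.iso s (ρ.psiEApp x)).hom ≫ f := by
  ext h'
  · exact ρ.psiEApp_naturality (((Signed.split h).map f).pos h')
  · simp only [Signed.comp_neg, Signed.iso_hom_neg]
    rw [Iso.inv_comp_eq, ← Category.assoc, Iso.eq_comp_inv]
    exact ρ.psiEApp_naturality (((Signed.split h).map f).neg h')

theorem innerMap_cap (ω ω' : Γ) (hω : ω * ω' = 1) (h : ε = s * π ω) (h' : s = ε * π ω')
    (f : x ⟶[s] y) :
    ρ.innerMap ω h (ρ.innerMap ω' h' f) ≫ (Signed.iso s (ρ.cap ω ω' hω y)).hom =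
      (Signed.iso s (ρ.cap ω ω' hω x)).hom ≫ f := by
  have h₁ : s = s * π 1 := by rw [map_one, mul_one]
  simp only [cap, Signed.iso_trans_hom, Category.assoc]
  rw [← ρ.innerMap_psiEApp h₁, ← Category.assoc, ρ.innerMap_psiApp ω ω' 1 hω h h' h₁,
    Category.assoc]

theorem innerMap_injective (ω : Γ) (h : ε = s * π ω) :
    Function.Injective (ρ.innerMap ω h : (x ⟶[ε] y) → _) := by
  intro f f' hf
  have h' : s = ε * π ω⁻¹ := by rw [h, map_inv, mul_inv_cancel_right]
  rw [← cancel_epi (Signed.iso ε (ρ.cap ω⁻¹ ω (inv_mul_cancel ω) x)).hom,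
    ← ρ.innerMap_cap ω⁻¹ ω (inv_mul_cancel ω) h' h, hf, ρ.innerMap_cap]

theorem innerMap_surjective (ω : Γ) (h : ε = s * π ω) :
    Function.Surjective (ρ.innerMap ω h : (x ⟶[ε] y) → _) := by
  intro a
  have h' : s = ε * π ω⁻¹ := by rw [h, map_inv, mul_inv_cancel_right]
  let cap z := Signed.iso ε (ρ.cap ω⁻¹ ω (inv_mul_cancel ω) z)
  refine ⟨(cap x).inv ≫ ρ.innerMap ω⁻¹ h' a ≫ (cap y).hom, ?_⟩
  apply ρ.innerMap_injective ω⁻¹ h'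
  rw [← cancel_mono (cap y).hom, ρ.innerMap_cap ω⁻¹ ω (inv_mul_cancel ω) h' h,
    Iso.hom_inv_id_assoc]

end InnerMap

instance act_isEquivalence (ω : Γ) : (ρ.act ω).IsEquivalence where
  faithful := ⟨fun {_ _} _ _ hf => ρ.innerMap_injective ω (one_mul (π ω)).symm
    (Signed.hom_ext_of_one rfl hf)⟩
  full := ⟨fun {_ _} a => by
    obtain ⟨f, hf⟩ := ρ.innerMap_surjective ω (one_mul (π ω)).symm (posHom rfl a)
    exact ⟨f, congrArg (fun b : SHom 1 _ _ => b.pos rfl) hf⟩⟩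
  essSurj := ⟨fun x => ⟨⟨ρ.obj ω⁻¹ x⟩, ⟨ρ.cap ω ω⁻¹ (mul_inv_cancel ω) x⟩⟩⟩

section IsTwisted

variable {ρ} {α : Γ → Γ → Γ → kˣ} {x : V}

theorem IsTwisted.signed_assoc (hρ : ρ.IsTwisted α) (s : ℤˣ) {c b a cb ba m : Γ} (hcb : c * b = cb)
    (hba : b * a = ba) (h : cb * a = m) (h' : c * ba = m) (x : V) :
    ((α c b a ^ (s : ℤ) : kˣ) : k) • ((Signed.iso s (ρ.psiApp c b cb hcb (ρ.obj a x))).hom ≫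
        (Signed.iso s (ρ.psiApp cb a m h x)).hom) =
      (Signed.iso s (ρ.actIso c (ρ.psiApp b a ba hba x))).hom ≫
        (Signed.iso s (ρ.psiApp c ba m h' x)).hom := by
  subst hcb hba h
  have assoc : smulIso (α c b a) (ρ.psiApp c b (c * b) rfl (ρ.obj a x) ≪≫
        ρ.psiApp (c * b) a (c * b * a) rfl x) =
      ρ.actIso c (ρ.psiApp b a (b * a) rfl x) ≪≫ ρ.psiApp c (b * a) (c * b * a) h' x :=
    Iso.ext (hρ.assoc c b a x)
  rcases Int.units_eq_one_or s with rfl | rfl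
  · exact Signed.hom_ext_of_one rfl (by simpa using congrArg Iso.hom assoc)
  · exact Signed.hom_ext_of_neg_one rfl (by simpa using congrArg Iso.inv assoc)

theorem IsTwisted.signed_actIso_cap (hρ : ρ.IsTwisted α) (s : ℤˣ) {ω p p' m : Γ}
    (hpp : p * p' = 1) (h : ω * p = m) (h' : m * p' = ω) (x : V) :
    (Signed.iso s (ρ.actIso ω (ρ.cap p p' hpp x))).hom =
      ((α ω p p' ^ (s : ℤ) : kˣ) : k) •
        ((Signed.iso s (ρ.psiApp ω p m h (ρ.obj p' x))).hom ≫
          (Signed.iso s (ρ.psiApp m p' ω h' x)).hom) := by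
  rw [hρ.signed_assoc s h hpp h' (mul_one ω), hρ.unit_right, cap, actIso_trans,
    Signed.iso_trans_hom]

theorem IsTwisted.signed_cap_obj (hρ : ρ.IsTwisted α) (s : ℤˣ) {q q' ω n : Γ}
    (hqq : q * q' = 1) (h : q' * ω = n) (h' : q * n = ω) (x : V) :
    ((α q q' ω ^ (s : ℤ) : kˣ) : k) • (Signed.iso s (ρ.cap q q' hqq (ρ.obj ω x))).hom =
      (Signed.iso s (ρ.actIso q (ρ.psiApp q' ω n h x))).hom ≫
        (Signed.iso s (ρ.psiApp q n ω h' x)).hom := by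
  rw [← hρ.signed_assoc s hqq h (one_mul ω) h', hρ.unit_left, cap, Signed.iso_trans_hom]

theorem IsTwisted.signed_actIso_cap_self (hρ : ρ.IsTwisted α) (s : ℤˣ) {ω ω' : Γ}
    (h : ω * ω' = 1) (h' : ω' * ω = 1) (x : V) :
    (Signed.iso s (ρ.actIso ω (ρ.cap ω' ω h' x))).hom =
      ((α ω ω' ω ^ (s : ℤ) : kˣ) : k) • (Signed.iso s (ρ.cap ω ω' h (ρ.obj ω x))).hom := by
  rw [hρ.signed_actIso_cap s h' h (one_mul ω), hρ.unit_left, cap, Signed.iso_trans_hom]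

end IsTwisted

end RealTwoRepData

namespace RealTwoRepData

variable {k : Type w} [Field k] {Γ : Type u₁} [Group Γ] {π : Γ →* ℤˣ}
  {V : Type u} [Category.{v} V] [Preadditive V] [Linear k V] (ρ : RealTwoRepData k π V)

/-! ### Elements of the categorical trace as signed transformations -/

section SignedTr

variable {g g' : Loop π}

theorem signedTr_comp_innerMap {ε : ℤˣ} {p : Γ} (hp : p = g.el ^ (ε : ℤ)) (h : ε = ε * π p)
    (φ : ρ.Tr g) {x y : V} (f : x ⟶[ε] y) :
    f ≫ ρ.signedTr ε p hp φ y = ρ.signedTr ε p hp φ x ≫ ρ.innerMap p h f := by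
  have hp₁ : π p = 1 := by rw [hp, loop_zpow_deg]
  rw [ρ.innerMap_pos p hp₁]
  exact ρ.signedTr_naturality p hp hp₁ φ f

theorem signedTr_comp_iso_actIso {ε : ℤˣ} {p : Γ} (hp : p = g.el ^ (ε : ℤ)) (φ : ρ.Tr g) {x y : V}
    (a : x ≅ y) :
    (Signed.iso ε a).hom ≫ ρ.signedTr ε p hp φ y =
      ρ.signedTr ε p hp φ x ≫ (Signed.iso ε (ρ.actIso p a)).hom := by
  have h : ε = ε * π p := by rw [hp, loop_zpow_deg, mul_one]
  rw [← ρ.innerMap_iso p h, ρ.signedTr_comp_innerMap hp h]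

theorem signedTr_one_pos {q : Γ} (hq : q = g.el ^ ((1 : ℤˣ) : ℤ)) (φ : ρ.Tr g) (x : V) :
    (ρ.signedTr 1 q hq φ x).pos rfl =
      ρ.trApp φ x ≫ (ρ.castIso (by simp [hq]) rfl).hom := rfl

theorem tr_ext_act {φ φ' : ρ.Tr g} (ω : Γ)
    (h : ∀ y, ρ.trApp φ (ρ.obj ω y) = ρ.trApp φ' (ρ.obj ω y)) : φ = φ' := by
  refine ρ.tr_ext fun x => ?_
  rw [← cancel_epi (ρ.cap ω ω⁻¹ (mul_inv_cancel ω) x).hom, trApp_naturality, trApp_naturality, h]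

theorem signedTr_one_beta (ω : Γ) (hω : realConj π ω g.el = g'.el) (φ : ρ.Tr g) {e : ℤˣ}
    (he : e = 1 * π ω) {q p m : Γ} (hq : q = g'.el ^ ((1 : ℤˣ) : ℤ)) (hp : p = g.el ^ (e : ℤ))
    (hm : q * ω = m) (hm' : ω * p = m) (x : V) :
    ρ.signedTr 1 q hq (ρ.beta ω hω φ) x =
      (Signed.iso 1 (ρ.cap ω ω⁻¹ (mul_inv_cancel ω) x)).inv ≫
        ρ.innerMap ω he (ρ.signedTr e p hp φ (ρ.obj ω⁻¹ x)) ≫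
          (Signed.iso 1 (ρ.psiApp ω p m hm' (ρ.obj ω⁻¹ x))).hom ≫
            (Signed.iso 1 (ρ.psiApp q ω m hm (ρ.obj ω⁻¹ x))).inv ≫
              (Signed.iso 1 (ρ.actIso q (ρ.cap ω ω⁻¹ (mul_inv_cancel ω) x))).hom := by
  obtain rfl : e = π ω := by simpa using he
  obtain rfl : q = g'.el := by simpa using hq
  subst hp hm'
  refine Signed.hom_ext_of_one rfl ?_
  rw [signedTr_one_pos]
  exact (Category.comp_id _).trans rfl

/-- Conjugation by `ω` characterizes `β_{g,ω}(φ)`, without reference to a choice of `ω⁻¹`. -/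
theorem signedTr_beta_one (ω : Γ) (hω : realConj π ω g.el = g'.el) (φ : ρ.Tr g) {e : ℤˣ}
    (he : e = 1 * π ω) {q p m : Γ} (hq : q = g'.el ^ ((1 : ℤˣ) : ℤ)) (hp : p = g.el ^ (e : ℤ))
    (hm : q * ω = m) (hm' : ω * p = m) (y : V) :
    ρ.signedTr 1 q hq (ρ.beta ω hω φ) (ρ.obj ω y) ≫ (Signed.iso 1 (ρ.psiApp q ω m hm y)).hom =
      ρ.innerMap ω he (ρ.signedTr e p hp φ y) ≫ (Signed.iso 1 (ρ.psiApp ω p m hm' y)).hom := by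
  have hq₁ : (1 : ℤˣ) = 1 * π q := by rw [hq, loop_zpow_deg, one_mul]
  have hp₁ : e = e * π p := by rw [hp, loop_zpow_deg, mul_one]
  have hm₁ : e = 1 * π m := by rw [← hm, map_mul, ← mul_assoc, ← hq₁, he]
  obtain ⟨a, ha⟩ := ρ.innerMap_surjective ω he
    (Signed.iso 1 (ρ.cap ω ω⁻¹ (mul_inv_cancel ω) (ρ.obj ω y))).hom
  rw [ρ.signedTr_one_beta ω hω φ he hq hp hm hm', ← ρ.innerMap_iso q hq₁, ← ha]
  simp only [Category.assoc]
  rw [ρ.innerMap_psiApp q ω m hm hq₁ he hm₁, Iso.inv_hom_id_assoc,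
    ← ρ.innerMap_psiApp ω p m hm' he hp₁ hm₁, Iso.inv_comp_eq, ← ha, ← Category.assoc,
    ← innerMap_comp, ← signedTr_comp_innerMap, innerMap_comp, Category.assoc]

theorem eq_smul_beta_of_signedTr (ω : Γ) (hω : realConj π ω g.el = g'.el) (φ : ρ.Tr g)
    (φ' : ρ.Tr g') (c : k) {e : ℤˣ} (he : e = 1 * π ω) {q p m : Γ}
    (hq : q = g'.el ^ ((1 : ℤˣ) : ℤ)) (hp : p = g.el ^ (e : ℤ)) (hm : q * ω = m)
    (hm' : ω * p = m)
    (h : ∀ y, ρ.signedTr 1 q hq φ' (ρ.obj ω y) ≫ (Signed.iso 1 (ρ.psiApp q ω m hm y)).hom =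
      c • (ρ.innerMap ω he (ρ.signedTr e p hp φ y) ≫
        (Signed.iso 1 (ρ.psiApp ω p m hm' y)).hom)) :
    φ' = c • ρ.beta ω hω φ := by
  refine ρ.tr_ext_act ω fun y => ?_
  have eq : ρ.signedTr 1 q hq φ' (ρ.obj ω y) =
      ρ.signedTr 1 q hq (c • ρ.beta ω hω φ) (ρ.obj ω y) := by
    rw [← cancel_mono (Signed.iso 1 (ρ.psiApp q ω m hm y)).hom, h, signedTr_smul,
      Linear.smul_comp, ρ.signedTr_beta_one ω hω φ he hq hp hm hm']
  exact (cancel_mono _).1 (congrArg (fun f : SHom 1 _ _ => f.pos rfl) eq)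

end SignedTr

/-! ### Bending and conjugation -/

section Bending

/-- The scalar by which bending twice differs from the identity. -/
def flipFactor (α : Γ → Γ → Γ → kˣ) (e : ℤˣ) (γ : Γ) : kˣ := if e = -1 then α γ γ⁻¹ γ else 1

/-- The scalar by which bending fails to commute with `β_{γ,ω}`. -/
def bendFactor (π : Γ →* ℤˣ) (α : Γ → Γ → Γ → kˣ) (s : ℤˣ) (ω γ : Γ) : kˣ :=
  if s = 1 then 1 else flipFactor α (π ω) γ *
    (α (ω * γ ^ (-((π ω : ℤˣ) : ℤ)) * ω⁻¹) ω (γ ^ ((π ω : ℤˣ) : ℤ)) /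
      (α (ω * γ ^ (-((π ω : ℤˣ) : ℤ)) * ω⁻¹) (ω * γ ^ ((π ω : ℤˣ) : ℤ) * ω⁻¹) ω *
        α ω (γ ^ (-((π ω : ℤˣ) : ℤ))) (γ ^ ((π ω : ℤˣ) : ℤ))))

theorem transgressionFun_eq (α : Γ → Γ → Γ → kˣ) (ω₂ ω₁ γ : Γ) :
    transgressionFun π α ω₂ ω₁ γ = bendFactor π α (π ω₂) ω₁ γ *
      (α ω₂ ω₁ (γ ^ ((π (ω₂ * ω₁) : ℤˣ) : ℤ)) *
        α (ω₂ * ω₁ * γ ^ ((π (ω₂ * ω₁) : ℤˣ) : ℤ) * (ω₂ * ω₁)⁻¹) ω₂ ω₁ /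
        α ω₂ (ω₁ * γ ^ ((π (ω₂ * ω₁) : ℤˣ) : ℤ) * ω₁⁻¹) ω₁) := by
  rw [transgressionFun, bendFactor, flipFactor]
  congr 1
  rcases Int.units_eq_one_or (π ω₂) with h₂ | h₂
  · simp [h₂]
  · rw [h₂, if_neg (show ¬(-1 : ℤˣ) = 1 by decide)]
    simp only [true_and]
    have : ((((-1 : ℤˣ) : ℤˣ) : ℤ) - 1) / 2 = -1 := by decide
    rw [this, zpow_neg_one, inv_div]
    congr 1
    split_ifs <;> simp

variable {ρ} {α : Γ → Γ → Γ → kˣ} {g g' : Loop π}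

theorem innerMap_signedTr_one_comp_cap (φ : ρ.Tr g) {p p' : Γ} (hp : p = g.el ^ ((1 : ℤˣ) : ℤ))
    (hp' : p' = g.el ^ ((-1 : ℤˣ) : ℤ)) (hpp : p' * p = 1) (h : 1 = 1 * π p') (x : V) :
    ρ.innerMap p' h (ρ.signedTr 1 p hp φ x) ≫ (Signed.iso 1 (ρ.cap p' p hpp x)).hom =
      Signed.flip rfl (ρ.signedTr (-1) p' hp' φ x) := by
  obtain rfl : p = g.el := by simpa using hp
  obtain rfl : p' = g.el⁻¹ := by simpa using hp'
  refine Signed.hom_ext_of_one rfl ?_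
  rw [ρ.innerMap_pos _ (by simpa using h.symm)]
  simp [signedTr, castIso, bend, Signed.flip]

/-- For `e = -1` this says that bending twice is multiplication by `α(γ, γ⁻¹, γ)`. -/
theorem IsTwisted.innerMap_signedTr_comp_cap (hρ : ρ.IsTwisted α) (φ : ρ.Tr g) {e e' : ℤˣ}
    (he : e' = -e) {p p' : Γ} (hp : p = g.el ^ (e : ℤ)) (hp' : p' = g.el ^ (e' : ℤ))
    (hpp : p' * p = 1) (h : e = e * π p') (x : V) :
    ρ.innerMap p' h (ρ.signedTr e p hp φ x) ≫ (Signed.iso e (ρ.cap p' p hpp x)).hom =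
      (flipFactor α e g.el : k) • Signed.flip he (ρ.signedTr e' p' hp' φ x) := by
  subst he
  rcases Int.units_eq_one_or e with rfl | rfl
  · rw [innerMap_signedTr_one_comp_cap φ hp hp', flipFactor, if_neg (by decide), Units.val_one,
      one_smul]
  have hpp' : p * p' = 1 := mul_eq_one_comm.1 hpp
  have h₁ : (1 : ℤˣ) = 1 * π p := by rw [hp, loop_zpow_deg, one_mul]
  have h₁' : (1 : ℤˣ) = 1 * π p' := by rw [hp', loop_zpow_deg, one_mul]
  have hα : α p' p p' = flipFactor α (-1) g.el := by simp [hp, hp', flipFactor]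
  have innerMap_bend : ρ.innerMap p' h₁' (Signed.flip rfl (ρ.signedTr (-1) p hp φ x)) =
      (flipFactor α (-1) g.el : k) • ((Signed.iso 1 (ρ.cap p' p hpp x)).hom ≫
        ρ.signedTr (- -1) p' hp' φ x) := by
    rw [← innerMap_signedTr_one_comp_cap φ hp' hp hpp' h₁, innerMap_comp, innerMap_iso,
      hρ.signed_actIso_cap_self 1 hpp hpp', Linear.comp_smul, innerMap_cap, hα, Units.val_one,
      zpow_one]
    rfl
  apply Signed.flip_injective (ε := 1) rfl
  rw [Signed.flip_comp, Signed.flip_iso, ρ.flip_innerMap p' h₁' h rfl rfl, innerMap_bend,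
    Linear.comp_smul, Iso.inv_hom_id_assoc]
  rfl

end Bending

end RealTwoRepData

namespace RealTwoRepData

variable {k : Type w} [Field k] {Γ : Type u₁} [Group Γ] {π : Γ →* ℤˣ}
  {V : Type u} [Category.{v} V] [Preadditive V] [Linear k V] {ρ : RealTwoRepData k π V}
  {α : Γ → Γ → Γ → kˣ} {g g' : Loop π}

/-! ### The categorical character is twisted by the transgression -/

theorem IsTwisted.smul_innerMap_flip_signedTr (hρ : ρ.IsTwisted α) (ω : Γ) (φ : ρ.Tr g)
    {e e' : ℤˣ} (he : e = 1 * π ω) (hee : e = -e') {p p' m : Γ} (hp : p = g.el ^ (e : ℤ))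
    (hp' : p' = g.el ^ (e' : ℤ)) (hm : ω * p' = m) (hm' : m * p = ω) (hdm : e = 1 * π m) (y : V) :
    (flipFactor α e g.el : k) • ρ.innerMap ω he (Signed.flip (by rw [hee, neg_neg])
        (ρ.signedTr e' p' hp' φ y)) =
      (α ω p' p : k) • ((Signed.iso 1 (ρ.psiApp ω p' m hm y)).hom ≫
        ρ.innerMap m hdm (ρ.signedTr e p hp φ y) ≫
          (Signed.iso 1 (ρ.psiApp m p ω hm' y)).hom) := by
  have hpp : p' * p = 1 := by
    rw [← mul_right_inj ω, ← mul_assoc, hm, hm', mul_one]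
  have hp₁ : e = e * π p' := by rw [hp', loop_zpow_deg, mul_one]
  rw [← innerMap_smul, ← hρ.innerMap_signedTr_comp_cap φ _ hp hp' hpp hp₁, innerMap_comp,
    innerMap_iso, hρ.signed_actIso_cap 1 hpp hm hm', Units.val_one, zpow_one, Linear.comp_smul,
    ← Category.assoc, ρ.innerMap_psiApp ω p' m hm he hp₁ hdm, Category.assoc]

theorem IsTwisted.smul_flip_signedTr_beta (hρ : ρ.IsTwisted α) (ω : Γ)
    (hω : realConj π ω g.el = g'.el) (φ : ρ.Tr g) {e : ℤˣ} (he : e = 1 * π ω) {p q m : Γ}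
    (hp : p = g.el ^ (e : ℤ)) (hq : q = g'.el ^ ((-1 : ℤˣ) : ℤ)) (hm : q * ω = m)
    (hm' : m * p = ω) (hdm : e = 1 * π m) (y : V) :
    (α q g'.el ω : k) • Signed.flip rfl (ρ.signedTr (-1) q hq (ρ.beta ω hω φ) (ρ.obj ω y)) =
      (α q ω p : k) • ((Signed.iso 1 (ρ.psiApp q ω m hm y)).hom ≫
        ρ.innerMap m hdm (ρ.signedTr e p hp φ y) ≫
          (Signed.iso 1 (ρ.psiApp m p ω hm' y)).hom) := by
  have hg' : g'.el = g'.el ^ ((1 : ℤˣ) : ℤ) := by simp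
  have hqg : q * g'.el = 1 := by simp [hq]
  have hq₁ : (1 : ℤˣ) = 1 * π q := by rw [hq, loop_zpow_deg, one_mul]
  have hωp : q * (ω * p) = ω := by rw [← mul_assoc, hm, hm']
  have hgω : g'.el * ω = ω * p := by
    rw [← mul_right_inj q, ← mul_assoc, hqg, one_mul, hωp]
  have cap_obj := hρ.signed_cap_obj 1 hqg hgω hωp y
  have assoc := hρ.signed_assoc 1 hm (rfl : ω * p = _) hm' hωp y
  rw [Units.val_one, zpow_one] at cap_obj assoc
  rw [← innerMap_signedTr_one_comp_cap (ρ.beta ω hω φ) hg' hq hqg hq₁, ← Linear.comp_smul, cap_obj,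
    ← ρ.innerMap_iso q hq₁, ← Category.assoc, ← innerMap_comp,
    ρ.signedTr_beta_one ω hω φ he hg' hp hgω rfl, innerMap_comp, Category.assoc, innerMap_iso,
    ← assoc, Linear.comp_smul, ← Category.assoc, ρ.innerMap_psiApp q ω m hm hq₁ he hdm,
    Category.assoc]

theorem IsTwisted.signedTr_beta_neg (hρ : ρ.IsTwisted α) (ω : Γ) (hω : realConj π ω g.el = g'.el)
    (φ : ρ.Tr g) {e : ℤˣ} (he : e = -1 * π ω) {q p m : Γ} (hq : q = g'.el ^ ((-1 : ℤˣ) : ℤ))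
    (hp : p = g.el ^ (e : ℤ)) (hm : q * ω = m) (hm' : ω * p = m) (y : V) :
    ρ.signedTr (-1) q hq (ρ.beta ω hω φ) (ρ.obj ω y) ≫
        (Signed.iso (-1) (ρ.psiApp q ω m hm y)).hom =
      (bendFactor π α (-1) ω g.el : k) • (ρ.innerMap ω he (ρ.signedTr e p hp φ y) ≫
        (Signed.iso (-1) (ρ.psiApp ω p m hm' y)).hom) := by
  have hee : π ω = -e := by rw [he, neg_mul, one_mul, neg_neg]
  have hdm : π ω = 1 * π m := by rw [← hm', map_mul, hp, loop_zpow_deg, mul_one, one_mul]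
  have hmp : m * g.el ^ ((π ω : ℤˣ) : ℤ) = ω := by
    rw [← hm', hp, mul_assoc, ← zpow_add, hee, Units.val_neg, add_neg_cancel, zpow_zero, mul_one]
  have bent := hρ.smul_flip_signedTr_beta ω hω φ (one_mul _).symm rfl hq hm hmp hdm y
  have bent' := hρ.smul_innerMap_flip_signedTr ω φ (one_mul _).symm hee rfl hp hm' hmp hdm y
  have bendFactor_eq : bendFactor π α (-1) ω g.el = flipFactor α (π ω) g.el *
      (α q ω (g.el ^ ((π ω : ℤˣ) : ℤ)) /
        (α q g'.el ω * α ω p (g.el ^ ((π ω : ℤˣ) : ℤ)))) := by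
    have hpe : g.el ^ (-((π ω : ℤˣ) : ℤ)) = p := by rw [hp, hee, Units.val_neg, neg_neg]
    rw [bendFactor, if_neg (by decide), hpe, hm', ← hm, mul_inv_cancel_right, ← hω, realConj]
  apply Signed.flip_injective (ε := 1) rfl
  rw [Signed.flip_comp, Signed.flip_iso, Signed.flip_smul, Signed.flip_comp, Signed.flip_iso,
    ρ.flip_innerMap ω (one_mul _).symm he (by rw [hee, neg_neg]) rfl,
    (smul_eq_iff_eq_inv_smul (α q g'.el ω)).1 bent,
    (smul_eq_iff_eq_inv_smul (flipFactor α (π ω) g.el)).1 bent', bendFactor_eq]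
  simp only [Units.smul_def, Linear.comp_smul, Iso.inv_hom_id_assoc, smul_smul]
  congr 1
  push_cast
  field_simp

theorem IsTwisted.signedTr_beta (hρ : ρ.IsTwisted α) (s : ℤˣ) (ω : Γ)
    (hω : realConj π ω g.el = g'.el) (φ : ρ.Tr g) {e : ℤˣ} (he : e = s * π ω) {q p m : Γ}
    (hq : q = g'.el ^ (s : ℤ)) (hp : p = g.el ^ (e : ℤ)) (hm : q * ω = m) (hm' : ω * p = m)
    (y : V) :
    ρ.signedTr s q hq (ρ.beta ω hω φ) (ρ.obj ω y) ≫ (Signed.iso s (ρ.psiApp q ω m hm y)).hom =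
      (bendFactor π α s ω g.el : k) • (ρ.innerMap ω he (ρ.signedTr e p hp φ y) ≫
        (Signed.iso s (ρ.psiApp ω p m hm' y)).hom) := by
  rcases Int.units_eq_one_or s with rfl | rfl
  · rw [bendFactor, if_pos rfl, Units.val_one, one_smul]
    exact ρ.signedTr_beta_one ω hω φ he hq hp hm hm' y
  · exact hρ.signedTr_beta_neg ω hω φ he hq hp hm hm' y

theorem IsTwisted.beta_one (hρ : ρ.IsTwisted α) (h : realConj π 1 g.el = g.el) (φ : ρ.Tr g) :
    ρ.beta 1 h φ = φ := by
  have hg : g.el = g.el ^ ((1 : ℤˣ) : ℤ) := by simp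
  have h₁ : (1 : ℤˣ) = 1 * π 1 := by rw [map_one, mul_one]
  refine Eq.symm ((ρ.eq_smul_beta_of_signedTr 1 h φ φ 1 h₁ hg hg (mul_one _) (one_mul _)
    fun y => ?_).trans (one_smul k _))
  rw [hρ.unit_right, hρ.unit_left, innerMap_psiEApp, one_smul, signedTr_comp_iso_actIso]

theorem IsTwisted.signedTr_beta_beta (hρ : ρ.IsTwisted α) {g₁ g₂ : Loop π} (ω₂ ω₁ : Γ)
    (h₁ : realConj π ω₁ g.el = g₁.el) (h₂ : realConj π ω₂ g₁.el = g₂.el) (φ : ρ.Tr g) {e : ℤˣ}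
    (he : e = π ω₂ * π ω₁) (he' : e = 1 * π (ω₂ * ω₁)) {p q r m : Γ} (hp : p = g.el ^ (e : ℤ))
    (hq : q = g₁.el ^ ((π ω₂ : ℤˣ) : ℤ)) (hr : r = g₂.el ^ ((1 : ℤˣ) : ℤ)) (hqω : q * ω₁ = ω₁ * p)
    (hrω : r * ω₂ = ω₂ * q) (hm : r * (ω₂ * ω₁) = m) (hm' : ω₂ * ω₁ * p = m) (y : V) :
    ρ.signedTr 1 r hr (ρ.beta ω₂ h₂ (ρ.beta ω₁ h₁ φ)) (ρ.obj (ω₂ * ω₁) y) ≫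
        (Signed.iso 1 (ρ.psiApp r (ω₂ * ω₁) m hm y)).hom =
      ((bendFactor π α (π ω₂) ω₁ g.el * (α ω₂ ω₁ p * α r ω₂ ω₁ / α ω₂ q ω₁) : kˣ) : k) •
        (ρ.innerMap (ω₂ * ω₁) he' (ρ.signedTr e p hp φ y) ≫
          (Signed.iso 1 (ρ.psiApp (ω₂ * ω₁) p m hm' y)).hom) := by
  have h₁π : π ω₂ = 1 * π ω₂ := (one_mul _).symm
  have hm'' : ω₂ * (ω₁ * p) = m := by rw [← mul_assoc, hm']
  have hbω : ω₂ * q * ω₁ = m := by rw [mul_assoc, hqω, hm'']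
  have assoc₁ := hρ.signed_assoc 1 hrω (rfl : ω₂ * ω₁ = _) hbω hm y
  have assoc₂ := hρ.signed_assoc 1 (rfl : ω₂ * q = _) hqω hbω hm'' y
  have assoc₃ := hρ.signed_assoc 1 (rfl : ω₂ * ω₁ = _) (rfl : ω₁ * p = _) hm' hm'' y
  rw [Units.val_one, zpow_one] at assoc₁ assoc₂ assoc₃
  rw [← cancel_epi (Signed.iso 1 (ρ.psiApp ω₂ ω₁ (ω₂ * ω₁) rfl y)).hom, ← Category.assoc,
    signedTr_comp_iso_actIso, Category.assoc, ← assoc₁, Linear.comp_smul, ← Category.assoc,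
    ρ.signedTr_beta_one ω₂ h₂ _ h₁π hr hq hrω rfl, Category.assoc,
    (smul_eq_iff_eq_inv_smul (α ω₂ q ω₁)).1 assoc₂, Units.smul_def, Linear.comp_smul,
    ← ρ.innerMap_iso ω₂ h₁π, ← Category.assoc, ← innerMap_comp,
    hρ.signedTr_beta (π ω₂) ω₁ h₁ φ he hq hp hqω rfl, innerMap_smul, innerMap_comp,
    Linear.smul_comp, Category.assoc, innerMap_iso, ← assoc₃, Linear.comp_smul, ← Category.assoc,
    ρ.innerMap_psiApp ω₂ ω₁ _ rfl h₁π he he', Category.assoc, Linear.comp_smul]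
  simp only [smul_smul]
  congr 1
  push_cast
  ring

theorem IsTwisted.beta_beta (hρ : ρ.IsTwisted α) {g₁ g₂ : Loop π} (ω₂ ω₁ : Γ)
    (h₁ : realConj π ω₁ g.el = g₁.el) (h₂ : realConj π ω₂ g₁.el = g₂.el)
    (h : realConj π (ω₂ * ω₁) g.el = g₂.el) (φ : ρ.Tr g) :
    ρ.beta ω₂ h₂ (ρ.beta ω₁ h₁ φ) =
      (transgressionFun π α ω₂ ω₁ g.el : k) • ρ.beta (ω₂ * ω₁) h φ := by
  obtain ⟨e, he⟩ : ∃ e, e = π ω₂ * π ω₁ := ⟨_, rfl⟩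
  obtain ⟨p, hp⟩ : ∃ p, p = g.el ^ (e : ℤ) := ⟨_, rfl⟩
  obtain ⟨q, hq⟩ : ∃ q, q = g₁.el ^ ((π ω₂ : ℤˣ) : ℤ) := ⟨_, rfl⟩
  have he' : e = 1 * π (ω₂ * ω₁) := by rw [he, map_mul, one_mul]
  have hg₂ : g₂.el = ω₂ * ω₁ * p * (ω₂ * ω₁)⁻¹ := by rw [← h, realConj, map_mul, hp, he]
  have hq' : q = ω₁ * p * ω₁⁻¹ := by
    rw [hq, ← h₁, realConj, hp, he]
    rcases Int.units_eq_one_or (π ω₂) with h' | h' <;> simp [h', mul_assoc]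
  have hg₂' : g₂.el = g₂.el ^ ((1 : ℤˣ) : ℤ) := by simp
  have hqω : q * ω₁ = ω₁ * p := by rw [hq', inv_mul_cancel_right]
  have hgω : g₂.el * ω₂ = ω₂ * q := by rw [hg₂, hq']; group
  have hm : g₂.el * (ω₂ * ω₁) = ω₂ * ω₁ * p := by rw [hg₂, inv_mul_cancel_right]
  refine ρ.eq_smul_beta_of_signedTr (ω₂ * ω₁) h φ _ _ he' hg₂' hp hm rfl fun y => ?_
  rw [hρ.signedTr_beta_beta ω₂ ω₁ h₁ h₂ φ he he' hp hq hg₂' hqω hgω hm rfl, transgressionFun_eq,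
    map_mul, ← he, ← hp, ← hg₂, ← hq']

theorem IsTwisted.isTwisted_realCatChar {α : ThreeCocycle k π} (hρ : ρ.IsTwisted α.toFun) :
    ρ.realCatChar.IsTwisted (transgression α) where
  map_id _ := LinearMap.ext fun φ => hρ.beta_one _ φ
  map_comp f₂ f₁ := LinearMap.ext fun φ => hρ.beta_beta f₂.1 f₁.1 f₁.2 f₂.2 _ φ

end RealTwoRepData

/-! ### Fibres of induced representations -/

section InducedRepresentations

variable {k : Type w} [Field k] {C : Type u₁} [Category.{v₁} C] {D : Type u₂} [Category.{v₂} D]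

/-- The pullback `F^*θ` of a `2`-cocycle along a functor. -/
def TwoCocycle.pullback (θ : TwoCocycle k D) (F : C ⥤ D) : TwoCocycle k C where
  toFun f₂ f₁ := θ.toFun (F.map f₂) (F.map f₁)
  cocycle f₃ f₂ f₁ := by rw [F.map_comp, F.map_comp, θ.cocycle]
  id_left f := by rw [F.map_id, θ.id_left]
  id_right f := by rw [F.map_id, θ.id_right]

variable (F : C ⥤ D) (θ : TwoCocycle k D) (E : BundleData.{w, v₁, u₁, v₃} k C)

theorem ind_map_indMk {x x' : D} (f : x ⟶ x') {y : C} (s : F.obj y ⟶ x) (v : E.fib y) :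
    (ind F θ E).map f (indMk F θ E s v) = (θ.toFun f s : k) • indMk F θ E (s ≫ f) v := by
  classical
  have h : indPreMap F θ E f (DirectSum.lof k _ _ ⟨y, s⟩ v) =
      (θ.toFun f s : k) • DirectSum.lof k _ _ ⟨y, s ≫ f⟩ v := DirectSum.toModule_lof k _ _
  exact congrArg (Submodule.Quotient.mk (p := indRel F θ E x')) h

theorem indMk_map {x : D} {y y' : C} (a : y ⟶ y') (s : F.obj y' ⟶ x) (v : E.fib y) :
    indMk F θ E s (E.map a v) = (θ.toFun s (F.map a) : k) • indMk F θ E (F.map a ≫ s) v :=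
  (Submodule.Quotient.eq _).2 (Submodule.subset_span ⟨y, y', a, s, v, rfl⟩)

theorem indMk_comp {x : D} {y y' : C} (a : y ⟶ y') (s : F.obj y' ⟶ x) (v : E.fib y) :
    indMk F θ E (F.map a ≫ s) v =
      (((θ.toFun s (F.map a))⁻¹ : kˣ) : k) • indMk F θ E s (E.map a v) := by
  rw [indMk_map, smul_smul, Units.inv_mul, one_smul]

theorem ind_map_indMk_of_comm {x x' : D} (f : x ⟶ x') {y y' : C} (a : y ⟶ y')
    (s : F.obj y ⟶ x) (s' : F.obj y' ⟶ x') (h : F.map a ≫ s' = s ≫ f) (v : E.fib y) :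
    (ind F θ E).map f (indMk F θ E s v) =
      ((θ.toFun f s / θ.toFun s' (F.map a) : kˣ) : k) • indMk F θ E s' (E.map a v) := by
  rw [ind_map_indMk, ← h, indMk_comp, smul_smul, div_eq_mul_inv, Units.val_mul]

theorem ind_hom_ext {x : D} {M : Type*} [AddCommGroup M] [Module k M]
    {f f' : (ind F θ E).fib x →ₗ[k] M}
    (h : ∀ (y : C) (s : F.obj y ⟶ x) (v : E.fib y),
      f (indMk F θ E s v) = f' (indMk F θ E s v)) : f = f' := by
  classical
  exact Submodule.linearMap_qext _ <| DirectSum.linearMap_ext k fun p =>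
    LinearMap.ext fun v => h p.1 p.2 v

theorem isTwisted_ind : (ind F θ E).IsTwisted θ where
  map_id x := ind_hom_ext F θ E fun y s v => by
    rw [ind_map_indMk, θ.id_left, Units.val_one, one_smul, Category.comp_id]; rfl
  map_comp f₂ f₁ := ind_hom_ext F θ E fun y s v => by
    rw [LinearMap.comp_apply, ind_map_indMk, map_smul, ind_map_indMk, LinearMap.smul_apply,
      ind_map_indMk, smul_smul, smul_smul, ← Units.val_mul, ← Units.val_mul, Category.assoc,
      θ.cocycle, mul_comm]

variable {F E} {x : D} {ι : Type*} {c : ι → C} {t : ∀ i, F.obj (c i) ⟶ x}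

/-- The family `t` of morphisms `F (c i) ⟶ x` is a transversal: each morphism `F y ⟶ x` factors
uniquely through a member of the family. -/
def IsTransversal (F : C ⥤ D) (t : ∀ i, F.obj (c i) ⟶ x) : Prop :=
  ∀ (y : C) (s : F.obj y ⟶ x), ∃! p : (i : ι) × (y ⟶ c i), F.map p.2 ≫ t p.1 = s

namespace IsTransversal

variable (ht : IsTransversal F t)
include ht

theorem ind_hom_ext {M : Type*} [AddCommGroup M] [Module k M]
    {f f' : (ind F θ E).fib x →ₗ[k] M}
    (h : ∀ (i : ι) (v : E.fib (c i)), f (indMk F θ E (t i) v) = f' (indMk F θ E (t i) v)) :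
    f = f' :=
  RealTwoRep.ind_hom_ext F θ E fun y s v => by
    obtain ⟨⟨i, a⟩, rfl, -⟩ := ht y s
    rw [indMk_comp, map_smul, map_smul, h]

variable [DecidableEq ι]

variable (E) in
/-- The coordinates `θ(t_i, F a)⁻¹ E(a) v ∈ E (c i)` of `s ⊗ v`, where `s = t_i ∘ F a`. -/
noncomputable def indCoordSymbol (p : (y : C) × (F.obj y ⟶ x)) :
    E.fib p.1 →ₗ[k] ∀ i, E.fib (c i) :=
  (((θ.toFun (t (ht p.1 p.2).choose.1) (F.map (ht p.1 p.2).choose.2))⁻¹ : kˣ) : k) •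
    LinearMap.single k (fun i => E.fib (c i)) (ht p.1 p.2).choose.1 ∘ₗ
      E.map (ht p.1 p.2).choose.2

theorem indCoordSymbol_apply {y : C} {i : ι} (a : y ⟶ c i) {s : F.obj y ⟶ x}
    (hs : F.map a ≫ t i = s) (v : E.fib y) :
    ht.indCoordSymbol θ E ⟨y, s⟩ v = (((θ.toFun (t i) (F.map a))⁻¹ : kˣ) : k) •
      (Pi.single i (E.map a v) : ∀ i, E.fib (c i)) := by
  have h : (ht y s).choose = ⟨i, a⟩ :=
    (ht y s).unique (ht y s).choose_spec.1 (y₂ := ⟨i, a⟩) hs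
  exact congrArg (fun p : (i : ι) × (y ⟶ c i) => (((θ.toFun (t p.1) (F.map p.2))⁻¹ : kˣ) : k) •
    (Pi.single p.1 (E.map p.2 v) : ∀ i, E.fib (c i))) h

variable {θ} (hE : E.IsTwisted (θ.pullback F))
include hE

open scoped DirectSum Classical in
theorem indRel_le_ker_indCoordSymbol :
    indRel F θ E x ≤ LinearMap.ker (DirectSum.toModule k _ (∀ i, E.fib (c i))
      (ht.indCoordSymbol θ E)) := by
  refine Submodule.span_le.2 ?_
  rintro z ⟨y, y', a, s, v, rfl⟩
  obtain ⟨⟨i, b⟩, rfl, -⟩ := ht y' s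
  have hs : F.map (a ≫ b) ≫ t i = F.map a ≫ F.map b ≫ t i := by
    rw [F.map_comp, Category.assoc]
  have hab : E.map b (E.map a v) = (θ.toFun (F.map b) (F.map a) : k) • E.map (a ≫ b) v :=
    LinearMap.congr_fun (hE.map_comp b a) v
  have hθ := θ.cocycle (t i) (F.map b) (F.map a)
  rw [← F.map_comp] at hθ
  rw [SetLike.mem_coe, LinearMap.mem_ker, map_sub, map_smul, DirectSum.toModule_lof,
    DirectSum.toModule_lof, ht.indCoordSymbol_apply θ b rfl,
    ht.indCoordSymbol_apply θ (a ≫ b) hs, hab, Pi.single_smul, smul_smul, smul_smul,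
    ← Units.val_mul, ← Units.val_mul, sub_eq_zero]
  congr 2
  rw [inv_mul_eq_iff_eq_mul, ← mul_assoc, hθ, mul_comm, inv_mul_cancel_left]

/-- The map from the fibre over `x` of an induced representation to `∏ i, E (c i)` given by a
transversal `t`, under which `t_i ⊗ v` has the single coordinate `v` at `i`. -/
noncomputable def indCoord : (ind F θ E).fib x →ₗ[k] ∀ i, E.fib (c i) := by
  classical
  exact Submodule.liftQ _ _ (ht.indRel_le_ker_indCoordSymbol hE)

theorem indCoord_indMk (i : ι) (v : E.fib (c i)) :
    ht.indCoord hE (indMk F θ E (t i) v) = Pi.single i v := by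
  classical
  have h : ht.indCoord hE (indMk F θ E (t i) v) = ht.indCoordSymbol θ E ⟨c i, t i⟩ v :=
    DirectSum.toModule_lof k _ _
  rw [h, ht.indCoordSymbol_apply θ (𝟙 (c i)) (by rw [F.map_id, Category.id_comp]), F.map_id,
    θ.id_right, inv_one, Units.val_one, one_smul, hE.map_id]
  rfl

theorem indCoord_bijective [Finite ι] : Function.Bijective (ht.indCoord hE) := by
  classical
  have := Fintype.ofFinite ι
  let mk (i : ι) : E.fib (c i) →ₗ[k] (ind F θ E).fib x :=
    (indRel F θ E x).mkQ ∘ₗ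
      DirectSum.lof k _ (fun p : (y : C) × (F.obj y ⟶ x) => E.fib p.1) ⟨c i, t i⟩
  let A : (∀ i, E.fib (c i)) →ₗ[k] (ind F θ E).fib x := LinearMap.lsum k _ k mk
  have hA (i : ι) (v : E.fib (c i)) : A (Pi.single i v) = indMk F θ E (t i) v :=
    LinearMap.lsum_piSingle ..
  have h₁ : A ∘ₗ ht.indCoord hE = LinearMap.id := ht.ind_hom_ext θ fun i v => by
    rw [LinearMap.comp_apply, indCoord_indMk, hA, LinearMap.id_apply]
  have h₂ : ht.indCoord hE ∘ₗ A = LinearMap.id := LinearMap.pi_ext fun i v => by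
    rw [LinearMap.comp_apply, hA, indCoord_indMk, LinearMap.id_apply]
  exact Function.bijective_iff_has_inverse.2
    ⟨A, fun z => LinearMap.congr_fun h₁ z, fun z => LinearMap.congr_fun h₂ z⟩

end IsTransversal

end InducedRepresentations

/-! ### The Real induction as a twisted Real 2-representation -/

namespace RealTwoRepData

section Transport

variable {k : Type w} [Field k] {Γ : Type u₁} [Group Γ] {π : Γ →* ℤˣ}
  {V : Type u} [Category.{v} V] [Preadditive V] [Linear k V] (ρ : RealTwoRepData k π V)

theorem actIso_refl (ω : Γ) (x : V) : ρ.actIso ω (Iso.refl x) = Iso.refl _ :=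
  Iso.ext ((ρ.act ω).map_id ⟨x⟩)

theorem actIso_symm (ω : Γ) {x y : V} (K : x ≅ y) : ρ.actIso ω K.symm = (ρ.actIso ω K).symm := rfl

theorem actIso_psiApp (ω₂ ω₁ ω : Γ) (h : ω₂ * ω₁ = ω) {x y : V} (K : x ≅ y) :
    ρ.actIso ω₂ (ρ.actIso ω₁ K) ≪≫ ρ.psiApp ω₂ ω₁ ω h y =
      ρ.psiApp ω₂ ω₁ ω h x ≪≫ ρ.actIso ω K := by
  have h' : π ω = π ω₂ * π ω₁ := by rw [← h, map_mul]
  have hψ := ρ.psiApp_naturality ω₂ ω₁ ω h h' (Signed.iso (π ω) K).hom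
  rw [innerMap_iso] at hψ
  exact Iso.ext hψ

/-- The composition isomorphism `ψ_{ω₂,ω₁}`, transported along identifications of `y`, `z`, `t`
with values of `ρ`: the entries of a Real induction are of this form. -/
def psiVia (ω₂ ω₁ ω : Γ) (h : ω₂ * ω₁ = ω) {x y z t : V} (K₂ : z ≅ ρ.obj ω₂ y)
    (K₁ : y ≅ ρ.obj ω₁ x) (K : t ≅ ρ.obj ω x) : z ≅ t :=
  K₂ ≪≫ ρ.actIso ω₂ K₁ ≪≫ ρ.psiApp ω₂ ω₁ ω h x ≪≫ K.symm

variable {c b a cb ba m : Γ} {x xa xba xcba ya yb yc yd : V} (Ka : xa ≅ ρ.obj a x)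
  (Kb : xba ≅ ρ.obj b xa) (Kc : xcba ≅ ρ.obj c xba) (La : ya ≅ ρ.obj cb xa) (Lb : yb ≅ ρ.obj ba x)
  (Lc : yc ≅ ρ.obj c yb) (Ld : yd ≅ ρ.obj m x)

theorem psiVia_trans_psiVia (hcb : c * b = cb) (h : cb * a = m) :
    ρ.psiVia c b cb hcb Kc Kb La ≪≫ ρ.psiVia cb a m h La Ka Ld =
      (Kc ≪≫ ρ.actIso c Kb ≪≫ ρ.actIso c (ρ.actIso b Ka)) ≪≫
        (ρ.psiApp c b cb hcb (ρ.obj a x) ≪≫ ρ.psiApp cb a m h x) ≪≫ Ld.symm := by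
  have hψ := congrArg Iso.hom (ρ.actIso_psiApp c b cb hcb Ka)
  simp only [Iso.trans_hom] at hψ
  ext
  simp [psiVia, reassoc_of% hψ]

theorem actIso_psiVia_trans_psiVia (hba : b * a = ba) (h : c * ba = m) :
    (Kc ≪≫ ρ.actIso c (ρ.psiVia b a ba hba Kb Ka Lb) ≪≫ Lc.symm) ≪≫
        ρ.psiVia c ba m h Lc Lb Ld =
      (Kc ≪≫ ρ.actIso c Kb ≪≫ ρ.actIso c (ρ.actIso b Ka)) ≪≫
        (ρ.actIso c (ρ.psiApp b a ba hba x) ≪≫ ρ.psiApp c ba m h x) ≪≫ Ld.symm := by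
  ext
  simp [psiVia, actIso_trans, actIso_symm]

variable {ρ} {α : Γ → Γ → Γ → kˣ}

theorem IsTwisted.signed_psiVia_assoc (hρ : ρ.IsTwisted α) (s : ℤˣ) (hcb : c * b = cb)
    (hba : b * a = ba) (h : cb * a = m) (h' : c * ba = m) (t r₁ r₂ r₃ r₄ : kˣ)
    (hr : t * (r₁ * r₂) = r₃ * r₄ * α c b a ^ (s : ℤ)) :
    (t : k) • (((r₁ : k) • (Signed.iso s (ρ.psiVia c b cb hcb Kc Kb La)).hom) ≫
        ((r₂ : k) • (Signed.iso s (ρ.psiVia cb a m h La Ka Ld)).hom)) =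
      ((r₃ : k) • (Signed.iso s
          (Kc ≪≫ ρ.actIso c (ρ.psiVia b a ba hba Kb Ka Lb) ≪≫ Lc.symm)).hom) ≫
        ((r₄ : k) • (Signed.iso s (ρ.psiVia c ba m h' Lc Lb Ld)).hom) := by
  have hψ := hρ.signed_assoc s hcb hba h h' x
  rw [Linear.smul_comp, Linear.comp_smul, Linear.smul_comp, Linear.comp_smul,
    ← Signed.iso_trans_hom, ← Signed.iso_trans_hom, psiVia_trans_psiVia,
    actIso_psiVia_trans_psiVia]
  simp only [Signed.iso_trans_hom, Category.assoc]
  rw [← reassoc_of% hψ]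
  simp only [Linear.smul_comp, Linear.comp_smul, Category.assoc, smul_smul, ← Units.val_mul]
  rw [hr, mul_assoc r₃]

theorem IsTwisted.psiVia_one_left (hρ : ρ.IsTwisted α) {η ω : Γ} (hη : η = 1)
    (h : η * ω = ω) {x y z : V} (K₂ : z ≅ ρ.obj η y) (K₁ : y ≅ ρ.obj ω x) :
    ρ.psiVia η ω ω h K₂ K₁ K₁ = K₂ ≪≫ ρ.castIso hη rfl ≪≫ ρ.psiEApp y := by
  subst hη
  have hψ := ρ.psiEApp_naturality (Signed.iso (π 1) K₁).hom
  rw [psiVia, hρ.unit_left]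
  ext
  simp only [castIso, eqToIso_refl, Iso.refl_trans, Iso.trans_hom, Iso.symm_hom, actIso,
    Functor.mapIso_hom]
  rw [reassoc_of% hψ]
  simp

theorem IsTwisted.psiVia_one_right (hρ : ρ.IsTwisted α) {η ω : Γ} (hη : η = 1)
    (h : ω * η = ω) {x y z t : V} (K₂ : z ≅ ρ.obj ω y) (K₁ : y ≅ ρ.obj η x) (K : t ≅ ρ.obj ω x) :
    ρ.psiVia ω η ω h K₂ K₁ K =
      K₂ ≪≫ ρ.actIso ω (K₁ ≪≫ ρ.castIso hη rfl ≪≫ ρ.psiEApp x) ≪≫ K.symm := by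
  subst hη
  rw [psiVia, hρ.unit_right]
  simp [castIso, actIso_trans]

end Transport

section Entries

variable {k : Type w} [Field k] {Γ : Type u₁} [Group Γ] {π : Γ →* ℤˣ} {H : Subgroup Γ}
  {V : Type u} [Category.{v} V] {σ : Γ ⧸ H → Γ}

/-- The `i` component of a signed morphism of the product category `∏_q {}^{π(σ_q)}V`. -/
def rindComp {ε e : ℤˣ} {i : Γ ⧸ H} (he : e = ε * π (σ i)) {x y : RIndCat π V σ}
    (f : x ⟶[ε] y) : (x i).un ⟶[e] (y i).un :=
  (Signed.merge he).map
    (⟨fun h => f.pos h i, fun h => f.neg h i⟩ : (⟨x i⟩ : Signed ε (Signed (π (σ i)) V)) ⟶ ⟨y i⟩)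

variable [Preadditive V] [Linear k V]

theorem rindComp_iso {ε e : ℤˣ} {i : Γ ⧸ H} (he : e = ε * π (σ i)) {x y : RIndCat π V σ}
    (P : x ≅ y) (r : kˣ) (Q : (x i).un ≅ (y i).un)
    (hP : P.hom i = (r : k) • (Signed.iso (π (σ i)) Q).hom) :
    rindComp he (Signed.iso ε P).hom =
      ((r ^ (ε : ℤ) : kˣ) : k) • (Signed.iso e Q).hom := by
  have hP' : P.inv i = ((r⁻¹ : kˣ) : k) • (Signed.iso (π (σ i)) Q).inv :=
    congrArg Iso.inv (Iso.ext hP : Pi.isoApp P i = smulIso r (Signed.iso (π (σ i)) Q))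
  subst he
  rcases Int.units_eq_one_or ε with rfl | rfl
  · rw [Units.val_one, zpow_one]
    ext h
    · exact congrArg (fun f : SHom (π (σ i)) _ _ => f.pos ((one_mul _).symm.trans h)) hP
    · exact congrArg (fun f : SHom (π (σ i)) _ _ => f.neg ((one_mul _).symm.trans h)) hP
  · rw [Units.val_neg, Units.val_one, zpow_neg_one]
    ext h
    · exact congrArg (fun f : SHom (π (σ i)) _ _ => f.neg
        (neg_eq_iff_eq_neg.1 ((neg_one_mul _).symm.trans h))) hP'
    · exact congrArg (fun f : SHom (π (σ i)) _ _ => f.pos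
        (neg_injective ((neg_one_mul _).symm.trans h))) hP'

variable (ρ : RealTwoRepData k (π.comp H.subtype) V) (hσ : ∀ q, (σ q : Γ ⧸ H) = q)

/-- The identification of the `j` component of `RInd(ρ)(ω)(x)` with its `(j, i)` entry, where
`ω i = j`. -/
def rindCast (ω : Γ) {i j : Γ ⧸ H} (h : ω • i = j) (x : RIndCat π V σ) :
    ((ρ.rindAct σ hσ ω).obj ⟨x⟩ j).un ≅ ρ.obj (trans σ hσ ω i j h) (x i).un :=
  ρ.castIso (x := (x (ω⁻¹ • j)).un) (x' := (x i).un)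
    (show trans σ hσ ω (ω⁻¹ • j) j (smul_inv_smul _ _) = trans σ hσ ω i j h by
      subst h; simp only [inv_smul_smul]) (by subst h; rw [inv_smul_smul])

theorem rindAct_map_apply (ω : Γ) {i j : Γ ⧸ H} (h : ω • i = j) {e : ℤˣ} (he : e = π ω * π (σ i))
    (he' : e = π (σ j) * (π.comp H.subtype) (trans σ hσ ω i j h)) {x y : RIndCat π V σ}
    (f : x ⟶[π ω] y) :
    (ρ.rindAct σ hσ ω).map f j =
      (Signed.iso (π (σ j)) (ρ.rindCast hσ ω h x)).hom ≫
        ρ.innerMap (trans σ hσ ω i j h) he' (rindComp he f) ≫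
        (Signed.iso (π (σ j)) (ρ.rindCast hσ ω h y)).inv := by
  obtain rfl : i = ω⁻¹ • j := by rw [← h, inv_smul_smul]
  subst he
  have hr (z : RIndCat π V σ) : ρ.rindCast hσ ω h z = Iso.refl _ := rfl
  rw [hr, hr]
  exact ((Category.id_comp _).trans (Category.comp_id _)).symm

variable (α : ThreeCocycle k π)

theorem rind_actIso_hom_apply (ω : Γ) {i j : Γ ⧸ H} (h : ω • i = j) {x y : RIndCat π V σ}
    (P : x ≅ y) (r : kˣ) (Q : (x i).un ≅ (y i).un)
    (hP : P.hom i = (r : k) • (Signed.iso (π (σ i)) Q).hom) :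
    ((ρ.rind σ hσ α).actIso ω P).hom j = ((r ^ ((π ω : ℤˣ) : ℤ) : kˣ) : k) •
      (Signed.iso (π (σ j)) (ρ.rindCast hσ ω h x ≪≫ ρ.actIso (trans σ hσ ω i j h) Q ≪≫
        (ρ.rindCast hσ ω h y).symm)).hom := by
  refine (ρ.rindAct_map_apply hσ ω h rfl (trans_deg σ hσ ω i j h) (Signed.iso (π ω) P).hom).trans ?_
  rw [rindComp_iso rfl P r Q hP, innerMap_smul, innerMap_iso, Linear.smul_comp, Linear.comp_smul]
  rfl

/-- The scalar in the composition isomorphism of the Real induction. -/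
def rindFactor (ω₂ ω₁ : Γ) {i j l : Γ ⧸ H} (h₁ : ω₁ • i = j) (h₂ : ω₂ • j = l) : kˣ :=
  α.toFun ω₂ (σ j) (trans σ hσ ω₁ i j h₁ : Γ) / (α.toFun ω₂ ω₁ (σ i) *
    α.toFun (σ l) (trans σ hσ ω₂ j l h₂ : Γ) (trans σ hσ ω₁ i j h₁ : Γ))

theorem rind_psiApp_hom_apply (ω₂ ω₁ ω : Γ) (hω : ω₂ * ω₁ = ω) {i j l : Γ ⧸ H} (h₁ : ω₁ • i = j)
    (h₂ : ω₂ • j = l) (h : ω • i = l) (x : RIndCat π V σ) :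
    ((ρ.rind σ hσ α).psiApp ω₂ ω₁ ω hω x).hom l =
      (rindFactor hσ α ω₂ ω₁ h₁ h₂ : k) • (Signed.iso (π (σ l))
        (ρ.psiVia (trans σ hσ ω₂ j l h₂) (trans σ hσ ω₁ i j h₁) (trans σ hσ ω i l h)
          (trans_mul σ hσ ω₂ ω₁ ω hω i j l h₁ h₂ h)
          (ρ.rindCast hσ ω₂ h₂ ((ρ.rind σ hσ α).obj ω₁ x)) (ρ.rindCast hσ ω₁ h₁ x)
          (ρ.rindCast hσ ω h x))).hom := by
  obtain rfl : j = ω₂⁻¹ • l := by rw [← h₂, inv_smul_smul]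
  obtain rfl : i = ω₁⁻¹ • ω₂⁻¹ • l := by rw [← h₁, inv_smul_smul]
  have hi : ω₁⁻¹ • ω₂⁻¹ • l = ω⁻¹ • l := by rw [← hω, mul_inv_rev, mul_smul]
  change (ρ.rindPsiApp σ hσ α ω₂ ω₁ ω hω _ _ _ l _ _ _ hi x).hom = _
  rw [rindPsiApp, smulIso_hom]
  refine congrArg (fun f => (_ : k) • (Signed.iso (π (σ l)) f).hom) ?_
  refine Eq.trans ?_ ((Iso.refl_trans _).trans
    ((congrArg (· ≪≫ _) (ρ.actIso_refl _ _)).trans (Iso.refl_trans _))).symm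
  congr 1

theorem rind_psiEApp_hom_apply (l : Γ ⧸ H) (h : (1 : Γ) • l = l) (x : RIndCat π V σ) :
    ((ρ.rind σ hσ α).psiEApp x).hom l = (Signed.iso (π (σ l)) (ρ.rindCast hσ 1 h x ≪≫
      ρ.castIso (trans_one σ hσ l l h) rfl ≪≫ ρ.psiEApp (x l).un)).hom := by
  change (ρ.rindPsiEApp σ hσ _ l _ (by rw [inv_one, one_smul]) x).hom = _
  rw [rindPsiEApp]
  refine congrArg (fun f => (Signed.iso (π (σ l)) f).hom) ?_
  rw [← Iso.trans_assoc]
  congr 1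
  simp only [rindCast, castIso]
  exact (eqToIso_trans _ _).symm

theorem mul_trans (ω : Γ) {i j : Γ ⧸ H} (h : ω • i = j) :
    σ j * (trans σ hσ ω i j h : Γ) = ω * σ i := by simp [trans]

theorem rindFactor_cocycle (c b a : Γ) {i j l m : Γ ⧸ H} (h₁ : a • i = j) (h₂ : b • j = l)
    (h₃ : c • l = m) (hba : (b * a) • i = l) (hcb : (c * b) • j = m) :
    α.toFun c b a * (rindFactor hσ α c b h₂ h₃ * rindFactor hσ α (c * b) a h₁ hcb) =
      rindFactor hσ α b a h₁ h₂ ^ ((π c : ℤˣ) : ℤ) * rindFactor hσ α c (b * a) hba h₃ *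
        α.toFun (trans σ hσ c l m h₃) (trans σ hσ b j l h₂) (trans σ hσ a i j h₁) ^
          ((π (σ m) : ℤˣ) : ℤ) := by
  apply Additive.ofMul.injective
  have r₁ := α.additive c b a (σ i)
  have r₂ := α.additive c b (σ j) (trans σ hσ a i j h₁)
  have r₃ := α.additive c (σ l) (trans σ hσ b j l h₂) (trans σ hσ a i j h₁)
  have r₄ := α.additive (σ m) (trans σ hσ c l m h₃) (trans σ hσ b j l h₂) (trans σ hσ a i j h₁)
  rw [mul_trans] at r₂ r₃ r₄
  have t₁ := congrArg (Subtype.val : H → Γ) (trans_mul σ hσ b a (b * a) rfl i j l h₁ h₂ hba)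
  have t₂ := congrArg (Subtype.val : H → Γ) (trans_mul σ hσ c b (c * b) rfl j l m h₂ h₃ hcb)
  rw [Subgroup.coe_mul] at t₁ t₂
  rw [t₁] at r₃ r₄
  rw [t₂] at r₄
  simp only [rindFactor, ofMul_mul, ofMul_div, ofMul_zpow]
  linear_combination (norm := module) r₂ - r₁ - r₃ + r₄

variable {ρ}

theorem IsTwisted.rind_assoc (hρ : ρ.IsTwisted (α.restrict H).toFun) (c b a : Γ)
    (x : RIndCat π V σ) :
    (α.toFun c b a : k) • (((ρ.rind σ hσ α).psiApp c b (c * b) rfl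
          ((ρ.rind σ hσ α).obj a x)).hom ≫
        ((ρ.rind σ hσ α).psiApp (c * b) a (c * b * a) rfl x).hom) =
      ((ρ.rind σ hσ α).actIso c ((ρ.rind σ hσ α).psiApp b a (b * a) rfl x)).hom ≫
        ((ρ.rind σ hσ α).psiApp c (b * a) (c * b * a) (mul_assoc _ _ _).symm x).hom := by
  funext m
  obtain ⟨l, h₃⟩ : ∃ l, c • l = m := ⟨c⁻¹ • m, smul_inv_smul _ _⟩
  obtain ⟨j, h₂⟩ : ∃ j, b • j = l := ⟨b⁻¹ • l, smul_inv_smul _ _⟩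
  obtain ⟨i, h₁⟩ : ∃ i, a • i = j := ⟨a⁻¹ • j, smul_inv_smul _ _⟩
  have hba : (b * a) • i = l := by rw [mul_smul, h₁, h₂]
  have hcb : (c * b) • j = m := by rw [mul_smul, h₂, h₃]
  have hcba : (c * b * a) • i = m := by rw [mul_smul, h₁, hcb]
  refine (congrArg ((α.toFun c b a : k) • ·) (congrArg₂ (· ≫ ·)
    (ρ.rind_psiApp_hom_apply hσ α c b (c * b) rfl h₂ h₃ hcb ((ρ.rind σ hσ α).obj a x))
    (ρ.rind_psiApp_hom_apply hσ α (c * b) a (c * b * a) rfl h₁ hcb hcba x))).trans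
    (Eq.trans ?_ (congrArg₂ (· ≫ ·)
      (ρ.rind_actIso_hom_apply hσ α c h₃ _ _ _
        (ρ.rind_psiApp_hom_apply hσ α b a (b * a) rfl h₁ h₂ hba x))
      (ρ.rind_psiApp_hom_apply hσ α c (b * a) (c * b * a) (mul_assoc _ _ _).symm hba h₃ hcba
        x)).symm)
  exact hρ.signed_psiVia_assoc _ _ _ _ _ _ _ (π (σ m))
    (trans_mul σ hσ c b (c * b) rfl j l m h₂ h₃ hcb)
    (trans_mul σ hσ b a (b * a) rfl i j l h₁ h₂ hba)
    (trans_mul σ hσ (c * b) a (c * b * a) rfl i j m h₁ hcb hcba)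
    (trans_mul σ hσ c (b * a) (c * b * a) (mul_assoc _ _ _).symm i l m hba h₃ hcba)
    _ _ _ _ _ (rindFactor_cocycle hσ α c b a h₁ h₂ h₃ hba hcb)

theorem IsTwisted.isTwisted_rind (hρ : ρ.IsTwisted (α.restrict H).toFun) :
    (ρ.rind σ hσ α).IsTwisted α.toFun where
  isEquivalence ω := inferInstance
  assoc := hρ.rind_assoc hσ α
  unit_left ω x := by
    refine Iso.ext (funext fun l => ?_)
    obtain ⟨i, h⟩ : ∃ i, ω • i = l := ⟨ω⁻¹ • l, smul_inv_smul _ _⟩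
    have hf : rindFactor hσ α 1 ω h (one_smul _ l) = 1 := by
      simp [rindFactor, α.one_left, trans_one σ hσ l l, α.one_mid]
    rw [ρ.rind_psiApp_hom_apply hσ α 1 ω ω _ h (one_smul _ l) h x,
      ρ.rind_psiEApp_hom_apply hσ α l (one_smul _ l), hf, Units.val_one, one_smul]
    exact congrArg (fun K => (Signed.iso (π (σ l)) K).hom)
      (hρ.psiVia_one_left (trans_one σ hσ l l (one_smul _ l)) _ _ _)
  unit_right ω x := by
    refine Iso.ext (funext fun l => ?_)
    obtain ⟨i, h⟩ : ∃ i, ω • i = l := ⟨ω⁻¹ • l, smul_inv_smul _ _⟩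
    have hf : rindFactor hσ α ω 1 (one_smul _ i) h = 1 := by
      simp [rindFactor, α.one_mid, trans_one σ hσ i i, α.one_right]
    rw [ρ.rind_psiApp_hom_apply hσ α ω 1 ω _ (one_smul _ i) h h x, hf,
      ρ.rind_actIso_hom_apply hσ α ω h _ 1 _
        ((ρ.rind_psiEApp_hom_apply hσ α i (one_smul _ i) x).trans (one_smul k _).symm),
      one_zpow]
    exact congrArg (fun K => ((1 : kˣ) : k) • (Signed.iso (π (σ l)) K).hom)
      (hρ.psiVia_one_right (trans_one σ hσ i i (one_smul _ i)) _ _ _ _)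

end Entries

end RealTwoRepData

/-! ### Bending through signed actions -/

namespace RealTwoRepData

section Bend

variable {k : Type w} [Field k] {Γ : Type u₁} [Group Γ] {π : Γ →* ℤˣ}
  {V : Type u} [Category.{v} V] [Preadditive V] [Linear k V] (ρ : RealTwoRepData k π V)
  {g : Loop π}

section PosHom

variable {C : Type u} [Category.{v} C] {ε : ℤˣ} (hε : ε = 1) {x y : C}

theorem posHom_injective : Function.Injective (posHom hε : (x ⟶ y) → (x ⟶[ε] y)) :=
  fun _ _ h => congrArg (fun a : SHom ε x y => a.pos hε) h

theorem posHom_pos (f : x ⟶[ε] y) : posHom hε (f.pos hε) = f := Signed.hom_ext_of_one hε rfl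

end PosHom

theorem innerMap_posHom {ε ε' : ℤˣ} {p : Γ} (hp : π p = 1) (h : ε = ε' * π p) (hε : ε = 1)
    (hε' : ε' = 1) {x y : V} (f : x ⟶ y) :
    ρ.innerMap p h (posHom hε f) = posHom hε' ((ρ.act p).map (posHom hp f)) := by
  rw [ρ.innerMap_pos p hp]
  exact Signed.hom_ext_of_one hε' rfl

theorem innerMap_zero {ε ε' : ℤˣ} (ω : Γ) (h : ε = ε' * π ω) {x y : V} :
    ρ.innerMap ω h (0 : x ⟶[ε] y) = 0 := by
  simpa using ρ.innerMap_smul ω h 0 (0 : x ⟶[ε] y)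

theorem innerMap_id {ε ε' : ℤˣ} (ω : Γ) (h : ε = ε' * π ω) (x : V) :
    ρ.innerMap ω h (𝟙 (⟨x⟩ : Signed ε V)) = 𝟙 _ :=
  (Signed.split h ⋙ Signed.functor ε' (ρ.act ω)).map_id _

theorem signedTr_pos (hp : g.el = g.el ^ ((1 : ℤˣ) : ℤ)) (φ : ρ.Tr g) (x : V)
    (h : (1 : ℤˣ) = 1) : (ρ.signedTr 1 g.el hp φ x).pos h = ρ.trApp φ x := by
  simp [signedTr, castIso]

theorem signedTr_neg (hp : g.el⁻¹ = g.el ^ ((-1 : ℤˣ) : ℤ)) (φ : ρ.Tr g) (x : V)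
    (h : (-1 : ℤˣ) = -1) : (ρ.signedTr (-1) g.el⁻¹ hp φ x).neg h = ρ.bend φ x := by
  simp [signedTr, castIso]

theorem bend_injective : Function.Injective (ρ.bend : ρ.Tr g → _) := fun _ _ h =>
  ρ.tr_ext fun x => posHom_injective _
    ((ρ.act g.el⁻¹).map_injective ((cancel_mono _).1 (congrFun h x)))

theorem signedTr_injective {s : ℤˣ} {p : Γ} (hp : p = g.el ^ (s : ℤ)) :
    Function.Injective (ρ.signedTr s p hp) := by
  intro φ φ' h
  rcases Int.units_eq_one_or s with rfl | rfl
  · obtain rfl : p = g.el := by simpa using hp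
    refine ρ.tr_ext fun x => ?_
    rw [← ρ.signedTr_pos hp φ x rfl, ← ρ.signedTr_pos hp φ' x rfl, h]
  · obtain rfl : p = g.el⁻¹ := by simpa using hp
    refine ρ.bend_injective (funext fun x => ?_)
    rw [← ρ.signedTr_neg hp φ x rfl, ← ρ.signedTr_neg hp φ' x rfl, h]

theorem exists_trApp_eq (a : ∀ x, x ⟶ ρ.obj g.el x)
    (ha : ∀ {x y : V} (f : x ⟶ y), f ≫ a y = a x ≫ (ρ.act g.el).map (posHom g.deg f)) :
    ∃ φ : ρ.Tr g, ∀ x, ρ.trApp φ x = a x :=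
  ⟨⟨fun x => a x.un, fun _ _ f => (ha (f.pos g.deg)).trans
    (congrArg (fun b => a _ ≫ (ρ.act g.el).map b) (posHom_pos g.deg f))⟩, fun _ => rfl⟩

theorem comp_cap_inv (hg : π g.el⁻¹ = 1) {x y : V} (f : x ⟶ y) :
    f ≫ (ρ.cap g.el⁻¹ g.el (inv_mul_cancel _) y).inv =
      (ρ.cap g.el⁻¹ g.el (inv_mul_cancel _) x).inv ≫
        (ρ.act g.el⁻¹).map (posHom hg ((ρ.act g.el).map (posHom g.deg f))) := by
  have h : π 1 = π g.el⁻¹ * π g.el := by rw [← map_mul, inv_mul_cancel]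
  rw [← ρ.innerMap_posHom g.deg h (map_one π) hg, Iso.comp_inv_eq, Category.assoc,
    ρ.cap_naturality g.el⁻¹ g.el (inv_mul_cancel _) h f, Iso.inv_hom_id_assoc]

theorem exists_bend_eq (hg : π g.el⁻¹ = 1) (t : ∀ x, ρ.obj g.el⁻¹ x ⟶ x)
    (ht : ∀ {x y : V} (f : x ⟶ y), (ρ.act g.el⁻¹).map (posHom hg f) ≫ t y = t x ≫ f) :
    ∃ φ : ρ.Tr g, ∀ x, ρ.bend φ x = t x := by
  have hex (x : V) : ∃ a : x ⟶ ρ.obj g.el x, (ρ.act g.el⁻¹).map (posHom hg a) =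
      t x ≫ (ρ.cap g.el⁻¹ g.el (inv_mul_cancel _) x).inv := by
    obtain ⟨a, ha⟩ := (ρ.act g.el⁻¹).map_surjective (X := ⟨x⟩) (Y := ⟨ρ.obj g.el x⟩)
      (t x ≫ (ρ.cap g.el⁻¹ g.el (inv_mul_cancel _) x).inv)
    exact ⟨a.pos hg, by rw [posHom_pos, ha]⟩
  choose a ha using hex
  obtain ⟨φ, hφ⟩ := ρ.exists_trApp_eq a fun {x y} f => by
    apply posHom_injective hg
    apply (ρ.act g.el⁻¹).map_injective
    rw [posHom_comp, posHom_comp, Functor.map_comp, Functor.map_comp, ha, ha,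
      reassoc_of% ht f, Category.assoc, ρ.comp_cap_inv hg]
  refine ⟨φ, fun x => ?_⟩
  rw [bend, hφ, ha, Category.assoc, Iso.inv_hom_id, Category.comp_id]

theorem exists_signedTr_eq {s : ℤˣ} {p : Γ} (hp : p = g.el ^ (s : ℤ)) (hs : s = s * π p)
    (t : ∀ x : V, x ⟶[s] ρ.obj p x)
    (ht : ∀ {x y : V} (f : x ⟶[s] y), f ≫ t y = t x ≫ ρ.innerMap p hs f) :
    ∃ φ : ρ.Tr g, ∀ x, ρ.signedTr s p hp φ x = t x := by
  rcases Int.units_eq_one_or s with rfl | rfl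
  · obtain rfl : p = g.el := by simpa using hp
    obtain ⟨φ, hφ⟩ := ρ.exists_trApp_eq (fun x => (t x).pos rfl) fun f => by
      have h := ht (posHom rfl f)
      rw [ρ.innerMap_posHom g.deg hs rfl rfl] at h
      exact congrArg (fun a : SHom (1 : ℤˣ) _ _ => a.pos rfl) h
    exact ⟨φ, fun x => Signed.hom_ext_of_one rfl ((ρ.signedTr_pos hp φ x rfl).trans (hφ x))⟩
  · obtain rfl : p = g.el⁻¹ := by simpa using hp
    have hg : π g.el⁻¹ = 1 := by rw [map_inv, g.deg, inv_one]
    obtain ⟨φ, hφ⟩ := ρ.exists_bend_eq hg (fun x => (t x).neg rfl) fun {x y} f => by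
      have h := ht (x := y) (y := x) ⟨fun h => absurd h (by decide), fun _ => f⟩
      rw [ρ.innerMap_pos g.el⁻¹ hg] at h
      exact (congrArg (fun a : SHom (-1 : ℤˣ) _ _ => a.neg rfl) h).symm
    exact ⟨φ, fun x => Signed.hom_ext_of_neg_one rfl ((ρ.signedTr_neg hp φ x rfl).trans (hφ x))⟩

end Bend

section PsiVia

variable {k : Type w} [Field k] {Γ : Type u₁} [Group Γ] {π : Γ →* ℤˣ}
  {V : Type u} [Category.{v} V] [Preadditive V] [Linear k V] {ρ : RealTwoRepData k π V}
  {α : Γ → Γ → Γ → kˣ} {g g' : Loop π}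

theorem IsTwisted.signedTr_bend_psiVia (hρ : ρ.IsTwisted α) {s e : ℤˣ} (he : e = -s)
    (φ : ρ.Tr g) {η η' μ : Γ} (hη : η = g.el ^ (s : ℤ)) (hη' : η' = g.el ^ (e : ℤ))
    (hμ : η' * η = μ) (hμ' : μ = 1) (hs : s = s * π η') {x xa xb xc xd : V}
    (K : xa ≅ ρ.obj η' x) (K' : xb ≅ ρ.obj η x) (L : xc ≅ ρ.obj η' xb) (M : xd ≅ ρ.obj μ x)
    (r : kˣ) :
    ((Signed.iso s K).hom ≫ ρ.innerMap η' hs (ρ.signedTr s η hη φ x ≫ (Signed.iso s K').inv) ≫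
        (Signed.iso s L).inv) ≫
      ((r : k) • (Signed.iso s (ρ.psiVia η' η μ hμ L K' M)).hom) ≫
        (Signed.iso s (M ≪≫ ρ.castIso hμ' rfl ≪≫ ρ.psiEApp x)).hom =
      ((flipFactor α s g.el * r : kˣ) : k) •
        ((Signed.iso s K).hom ≫ Signed.flip he (ρ.signedTr e η' hη' φ x)) := by
  subst hμ'
  have hbend := hρ.innerMap_signedTr_comp_cap φ he hη hη' hμ hs x
  have hK' : ρ.innerMap η' hs (Signed.iso s K').inv = (Signed.iso s (ρ.actIso η' K')).inv :=
    ρ.innerMap_iso η' hs K'.symm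
  simp only [cap, Signed.iso_trans_hom] at hbend
  rw [mul_comm, Units.val_mul, mul_smul, ← Linear.comp_smul, ← hbend]
  simp only [psiVia, castIso, eqToIso_refl, Iso.refl_trans, innerMap_comp, hK',
    Signed.iso_trans_hom, Linear.smul_comp, Linear.comp_smul, Category.assoc,
    Iso.inv_hom_id_assoc]
  congr 5
  exact Iso.inv_hom_id_assoc (Signed.iso s M) _

theorem IsTwisted.signedTr_beta_psiVia (hρ : ρ.IsTwisted α) {s e : ℤˣ} {a : Γ}
    (he : e = s * π a) (ha : realConj π a g.el = g'.el) (φ : ρ.Tr g) {q p μ : Γ}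
    (hq : q = g'.el ^ (s : ℤ)) (hp : p = g.el ^ (e : ℤ)) (hμ : q * a = μ) (hμ' : a * p = μ)
    {x xa xb xc xd xe : V} (K : xa ≅ ρ.obj a x) (L : xb ≅ ρ.obj q xa) (M : xc ≅ ρ.obj μ x)
    (N : xd ≅ ρ.obj p x) (P : xe ≅ ρ.obj a xd) (f : x ⟶[e] xd) (t r₁ r₂ d : kˣ)
    (hf : f ≫ (Signed.iso e N).hom = (d : k) • ρ.signedTr e p hp φ x)
    (hr : t * r₁ * bendFactor π α s a g.el = d * r₂) :
    ((t : k) • (ρ.signedTr s q hq (ρ.beta a ha φ) xa ≫ (Signed.iso s L).inv)) ≫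
        ((r₁ : k) • (Signed.iso s (ρ.psiVia q a μ hμ L K M)).hom) =
      ((Signed.iso s K).hom ≫ ρ.innerMap a he f ≫ (Signed.iso s P).inv) ≫
        ((r₂ : k) • (Signed.iso s (ρ.psiVia a p μ hμ' P N M)).hom) := by
  have hK := ρ.signedTr_comp_iso_actIso hq (ρ.beta a ha φ) K
  have hβ := hρ.signedTr_beta s a ha φ he hq hp hμ hμ' x
  have hf' := congrArg (ρ.innerMap a he) hf
  rw [innerMap_comp, innerMap_iso, innerMap_smul] at hf'
  simp only [psiVia, Signed.iso_trans_hom, Linear.smul_comp, Linear.comp_smul, Category.assoc,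
    Iso.inv_hom_id_assoc, smul_smul, ← Units.val_mul]
  rw [← reassoc_of% hK, reassoc_of% hβ, reassoc_of% hf']
  simp only [Linear.smul_comp, Linear.comp_smul, Category.assoc, smul_smul, ← Units.val_mul]
  rw [mul_comm r₁, hr, mul_comm d]

end PsiVia

end RealTwoRepData

/-! ### Summands of the categorical trace of a Real induction -/

theorem realConj_injective {Γ : Type u₁} [Group Γ] (π : Γ →* ℤˣ) (ω : Γ) :
    Function.Injective (realConj π ω) := by
  intro a b h
  have h' := congrArg (realConj π ω⁻¹) h
  rwa [← realConj_mul, ← realConj_mul, inv_mul_cancel, realConj_one, realConj_one] at h'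

namespace RealTwoRepData

section Conjugation

variable {Γ : Type u₁} [Group Γ] {π : Γ →* ℤˣ} {H : Subgroup Γ} {σ : Γ ⧸ H → Γ}
  (hσ : ∀ q, (σ q : Γ ⧸ H) = q)

theorem trans_eq_fixedLoop_zpow {g : Loop π} {q : Γ ⧸ H} (hq : g.el • q = q) :
    trans σ hσ g.el q q hq = (fixedLoop σ hσ g q hq).el ^ ((π (σ q) : ℤˣ) : ℤ) := by
  rcases Int.units_eq_one_or (π (σ q)) with h | h <;> simp [fixedLoop, h]

theorem trans_zpow_eq_fixedLoop_zpow {g : Loop π} {q : Γ ⧸ H} (hq : g.el • q = q) {ε e : ℤˣ}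
    {p : Γ} (hp : p = g.el ^ (ε : ℤ)) (hpq : p • q = q) (he : e = ε * π (σ q)) :
    trans σ hσ p q q hpq = (fixedLoop σ hσ g q hq).el ^ (e : ℤ) := by
  subst he
  rcases Int.units_eq_one_or ε with rfl | rfl
  · obtain rfl : p = g.el := by simpa using hp
    rw [one_mul]
    exact trans_eq_fixedLoop_zpow hσ hq
  · obtain rfl : p = g.el⁻¹ := by simpa using hp
    rw [neg_one_mul, Units.val_neg, zpow_neg, ← trans_eq_fixedLoop_zpow hσ hq]
    apply Subtype.ext
    simp [trans, mul_assoc]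

theorem realConj_trans_fixedLoop {g g' : Loop π} {f : Γ} (hf : realConj π f g.el = g'.el)
    {q l : Γ ⧸ H} (hq : g.el • q = q) (hl : g'.el • l = l) (hql : f • q = l) :
    realConj (π.comp H.subtype) (trans σ hσ f q l hql) (fixedLoop σ hσ g q hq).el =
      (fixedLoop σ hσ g' l hl).el := by
  have hcoe : ((realConj (π.comp H.subtype) (trans σ hσ f q l hql)
      (fixedLoop σ hσ g q hq).el : H) : Γ) =
        realConj π (trans σ hσ f q l hql : Γ) ((fixedLoop σ hσ g q hq).el : Γ) := by
    simp [realConj]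
  refine Subtype.ext (hcoe.trans (realConj_injective π (σ l) ?_))
  rw [← realConj_mul, mul_trans, realConj_mul]
  exact (congrArg (realConj π f) (fixedLoopHom σ hσ g q hq).2).trans
    (hf.trans (fixedLoopHom σ hσ g' l hl).2.symm)

end Conjugation

section Components

variable {Γ : Type u₁} [Group Γ] {π : Γ →* ℤˣ} {H : Subgroup Γ} {V : Type u} [Category.{v} V]
  {σ : Γ ⧸ H → Γ} {ε : ℤˣ} {i : Γ ⧸ H} {x y : RIndCat π V σ}

theorem rindComp_of_eq_one (hε : ε = 1) (he : π (σ i) = ε * π (σ i)) (f : x ⟶[ε] y) :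
    rindComp he f = f.pos hε i := by
  subst hε
  ext h <;> rfl

theorem flip_rindComp {e : ℤˣ} (hε : ε = -1) (he : e = ε * π (σ i)) (he' : e = -π (σ i))
    (f : x ⟶[ε] y) : Signed.flip he' (rindComp he f) = f.neg hε i := by
  subst hε
  ext h <;> rfl

end Components

section Summand

variable {k : Type w} [Field k] {Γ : Type u₁} [Group Γ] {π : Γ →* ℤˣ} {H : Subgroup Γ}
  {V : Type u} [Category.{v} V] [Preadditive V] [Linear k V]
  (ρ : RealTwoRepData k (π.comp H.subtype) V) {σ : Γ ⧸ H → Γ} (hσ : ∀ q, (σ q : Γ ⧸ H) = q)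
  (α : ThreeCocycle k π)

theorem rindAct_map_apply_eq_zero (ω : Γ) {i j : Γ ⧸ H} (h : ω • i = j) {e : ℤˣ}
    (he : e = π ω * π (σ i)) {x y : RIndCat π V σ} {f : x ⟶[π ω] y} (hf : rindComp he f = 0) :
    (ρ.rindAct σ hσ ω).map f j = 0 := by
  rw [ρ.rindAct_map_apply hσ ω h he (he.trans (trans_deg σ hσ ω i j h)), hf, innerMap_zero]
  exact (congrArg (_ ≫ ·) Limits.zero_comp).trans Limits.comp_zero

variable {g : Loop π} {q : Γ ⧸ H} (hq : g.el • q = q)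

/-- The `q` component of the natural transformation attached to `v`. -/
def summandEntry (v : ρ.Tr (fixedLoop σ hσ g q hq)) (x : RIndCat π V σ) :
    x q ⟶ (ρ.rind σ hσ α).obj g.el x q :=
  (ρ.signedTr (π (σ q)) (trans σ hσ g.el q q hq) (trans_eq_fixedLoop_zpow hσ hq) v (x q).un :
      (x q).un ⟶[π (σ q)] _) ≫
    (Signed.iso (π (σ q)) (ρ.rindCast hσ g.el hq x)).inv

theorem summandEntry_naturality (v : ρ.Tr (fixedLoop σ hσ g q hq)) {x y : RIndCat π V σ}
    (f : x ⟶[π g.el] y) :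
    f.pos g.deg q ≫ ρ.summandEntry hσ α hq v y =
      ρ.summandEntry hσ α hq v x ≫ (ρ.rindAct σ hσ g.el).map f q := by
  have hd : π (σ q) = π g.el * π (σ q) := by rw [g.deg, one_mul]
  have hd' := hd.trans (trans_deg σ hσ g.el q q hq)
  have hv : f.pos g.deg q ≫ ρ.signedTr (π (σ q)) _ (trans_eq_fixedLoop_zpow hσ hq) v (y q).un =
      ρ.signedTr (π (σ q)) _ (trans_eq_fixedLoop_zpow hσ hq) v (x q).un ≫
        ρ.innerMap (trans σ hσ g.el q q hq) hd' (f.pos g.deg q) :=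
    ρ.signedTr_comp_innerMap _ hd' v (f.pos g.deg q)
  have hmap := ρ.rindAct_map_apply hσ g.el hq hd hd' f
  rw [rindComp_of_eq_one g.deg hd] at hmap
  refine Eq.trans ?_ (congrArg (ρ.summandEntry hσ α hq v x ≫ ·) hmap).symm
  refine (Category.assoc _ _ _).symm.trans ((congrArg (· ≫ _) hv).trans ?_)
  exact (Category.assoc _ _ _).trans ((congrArg (_ ≫ ·)
    (Iso.inv_hom_id_assoc _ _).symm).trans (Category.assoc _ _ _).symm)

theorem summandEntry_add (v v' : ρ.Tr (fixedLoop σ hσ g q hq)) (x : RIndCat π V σ) :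
    ρ.summandEntry hσ α hq (v + v') x =
      ρ.summandEntry hσ α hq v x + ρ.summandEntry hσ α hq v' x :=
  (congrArg (· ≫ _) (ρ.signedTr_add _ _ _ v v' _)).trans (Preadditive.add_comp _ _ _ _ _ _)

theorem summandEntry_smul (c : k) (v : ρ.Tr (fixedLoop σ hσ g q hq)) (x : RIndCat π V σ) :
    ρ.summandEntry hσ α hq (c • v) x = c • ρ.summandEntry hσ α hq v x :=
  (congrArg (· ≫ _) (ρ.signedTr_smul _ _ _ c v _)).trans (Linear.smul_comp _ _ _ _ _ _)

theorem summandEntry_comp_iso_hom (v : ρ.Tr (fixedLoop σ hσ g q hq)) (x : RIndCat π V σ) :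
    (ρ.summandEntry hσ α hq v x ≫ (Signed.iso (π (σ q)) (ρ.rindCast hσ g.el hq x)).hom :
        (x q).un ⟶[π (σ q)] ρ.obj (trans σ hσ g.el q q hq) (x q).un) =
      ρ.signedTr (π (σ q)) _ (trans_eq_fixedLoop_zpow hσ hq) v (x q).un :=
  (Category.assoc _ _ _).trans
    ((congrArg (_ ≫ ·) (Iso.inv_hom_id _)).trans (Category.comp_id _))

theorem summandEntry_injective {v v' : ρ.Tr (fixedLoop σ hσ g q hq)}
    (h : ∀ x, ρ.summandEntry hσ α hq v x = ρ.summandEntry hσ α hq v' x) : v = v' :=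
  ρ.signedTr_injective (trans_eq_fixedLoop_zpow hσ hq) <| funext fun x =>
    (ρ.summandEntry_comp_iso_hom hσ α hq v fun _ => ⟨x⟩).symm.trans
      ((congrArg (· ≫ _) (h _)).trans (ρ.summandEntry_comp_iso_hom hσ α hq v' fun _ => ⟨x⟩))

open scoped Classical in
/-- The natural transformation `1 ⇒ RInd(ρ)(g)` concentrated at the fixed coset `q` which is
attached to an element of the categorical trace of `ρ` over `σ_q⁻¹ g^{π(σ_q)} σ_q`. -/
noncomputable def summand : ρ.Tr (fixedLoop σ hσ g q hq) →ₗ[k] (ρ.rind σ hσ α).Tr g where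
  toFun v :=
    { app x := Pi.single (M := fun l => x.un l ⟶ (ρ.rind σ hσ α).obj g.el x.un l) q
        (ρ.summandEntry hσ α hq v x.un)
      naturality x y f := by
        refine funext fun l => ?_
        change f.pos g.deg l ≫ Pi.single (M := fun l => y.un l ⟶ (ρ.rind σ hσ α).obj g.el y.un l) q
            (ρ.summandEntry hσ α hq v y.un) l =
          Pi.single (M := fun l => x.un l ⟶ (ρ.rind σ hσ α).obj g.el x.un l) q
            (ρ.summandEntry hσ α hq v x.un) l ≫ (ρ.rindAct σ hσ g.el).map f l
        by_cases h : l = q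
        · subst h
          rw [Pi.single_eq_same, Pi.single_eq_same]
          exact ρ.summandEntry_naturality hσ α hq v f
        · rw [Pi.single_eq_of_ne h, Pi.single_eq_of_ne h]
          exact Limits.comp_zero.trans Limits.zero_comp.symm }
  map_add' v v' := (ρ.rind σ hσ α).tr_ext fun x =>
    (congrArg (Pi.single q) (ρ.summandEntry_add hσ α hq v v' x)).trans (Pi.single_add _ _ _)
  map_smul' c v := (ρ.rind σ hσ α).tr_ext fun x =>
    (congrArg (Pi.single q) (ρ.summandEntry_smul hσ α hq c v x)).trans (Pi.single_smul _ _ _)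

theorem trApp_summand_self (v : ρ.Tr (fixedLoop σ hσ g q hq)) (x : RIndCat π V σ) :
    (ρ.rind σ hσ α).trApp (ρ.summand hσ α hq v) x q = ρ.summandEntry hσ α hq v x := by
  classical
  exact Pi.single_eq_same (M := fun l => x l ⟶ (ρ.rind σ hσ α).obj g.el x l) q _

theorem trApp_summand_of_ne (v : ρ.Tr (fixedLoop σ hσ g q hq)) (x : RIndCat π V σ) {r : Γ ⧸ H}
    (hr : r ≠ q) : (ρ.rind σ hσ α).trApp (ρ.summand hσ α hq v) x r = 0 := by
  classical
  exact Pi.single_eq_of_ne (M := fun l => x l ⟶ (ρ.rind σ hσ α).obj g.el x l) hr _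

theorem isSummandOf_summand (v : ρ.Tr (fixedLoop σ hσ g q hq)) :
    IsSummandOf σ hσ ρ α g q hq v (ρ.summand hσ α hq v) where
  diagonal x _ := by
    rw [trApp_summand_self]
    exact ρ.summandEntry_comp_iso_hom hσ α hq v x
  off_diagonal x _ hr := ρ.trApp_summand_of_ne hσ α hq v x hr

end Summand

end RealTwoRepData

/-! ### The action of the loop groupoid on the summands -/

namespace RealTwoRepData

theorem eq_beta_of_trApp {k : Type w} [Field k] {Γ : Type u₁} [Group Γ] {π : Γ →* ℤˣ}
    {V : Type u} [Category.{v} V] [Preadditive V] [Linear k V] (ρ : RealTwoRepData k π V)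
    {g g' : Loop π} {ω : Γ} (hω : realConj π ω g.el = g'.el) {φ : ρ.Tr g} {φ' : ρ.Tr g'}
    {p m : Γ} (hp : p = g.el ^ ((π ω : ℤˣ) : ℤ)) (hm : g'.el * ω = m) (hm' : ω * p = m)
    (h : ∀ y, ρ.trApp φ' (ρ.obj ω y) ≫ (ρ.psiApp g'.el ω m hm y).hom =
      (ρ.act ω).map (ρ.signedTr (π ω) p hp φ y) ≫ (ρ.psiApp ω p m hm' y).hom) :
    φ' = ρ.beta ω hω φ := by
  have hq : g'.el = g'.el ^ ((1 : ℤˣ) : ℤ) := by simp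
  refine (ρ.eq_smul_beta_of_signedTr ω hω φ φ' 1 (one_mul _).symm hq hp hm hm' fun y => ?_).trans
    (one_smul k _)
  rw [one_smul]
  refine Signed.hom_ext_of_one rfl (Eq.trans ?_ (h y))
  exact congrArg (· ≫ _) (ρ.signedTr_pos hq φ' _ rfl)

variable {k : Type w} [Field k] {Γ : Type u₁} [Group Γ] {π : Γ →* ℤˣ} {H : Subgroup Γ}
  {V : Type u} [Category.{v} V] [Preadditive V] [Linear k V]
  {ρ : RealTwoRepData k (π.comp H.subtype) V} {σ : Γ ⧸ H → Γ} (hσ : ∀ q, (σ q : Γ ⧸ H) = q)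
  {α : ThreeCocycle k π} {g g' : Loop π} {q l : Γ ⧸ H}

section Scalars

theorem flipFactor_mul_rindFactor (hq : g.el • q = q) (hq' : g.el⁻¹ • q = q) :
    flipFactor (α.restrict H).toFun (π (σ q)) (fixedLoop σ hσ g q hq).el *
        rindFactor hσ α g.el⁻¹ g.el hq hq' =
      bendFactor π α.toFun (-1) (σ q) (fixedLoop σ hσ g q hq).el := by
  have hη := congrArg (Subtype.val : H → Γ) (trans_eq_fixedLoop_zpow hσ hq)
  have hη' := congrArg (Subtype.val : H → Γ)
    (trans_zpow_eq_fixedLoop_zpow hσ hq (ε := -1) (by simp) hq' (neg_one_mul _).symm)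
  rw [Subgroup.coe_zpow] at hη hη'
  rw [Units.val_neg] at hη'
  rw [bendFactor, if_neg (by decide), ← hη, ← hη', mul_trans, mul_trans, mul_inv_cancel_right,
    mul_inv_cancel_right]
  rfl

/-- The quotient of transgressions is the scalar by which `f (σ_q ⊗ v)` differs from `σ_l ⊗ β(v)`;
the other factors come from bending and from the structure of the Real induction. -/
theorem transgression_mul_rindFactor {f p : Γ} (hf : realConj π f g.el = g'.el)
    (hq : g.el • q = q) (hl : g'.el • l = l) (hql : f • q = l)
    (hp : p = g.el ^ ((π f : ℤˣ) : ℤ)) (hpq : p • q = q) :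
    transgressionFun π α.toFun f (σ q) (fixedLoop σ hσ g q hq).el /
          transgressionFun π α.toFun (σ l) (trans σ hσ f q l hql) (fixedLoop σ hσ g q hq).el *
        rindFactor hσ α g'.el f hql hl *
        bendFactor (π.comp H.subtype) (α.restrict H).toFun (π (σ l)) (trans σ hσ f q l hql)
          (fixedLoop σ hσ g q hq).el =
      bendFactor π α.toFun (π f) (σ q) (fixedLoop σ hσ g q hq).el *
        rindFactor hσ α f p hpq hql := by
  have hP := congrArg (Subtype.val : H → Γ)
    (trans_zpow_eq_fixedLoop_zpow hσ hq hp hpq (map_mul π f (σ q)))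
  rw [Subgroup.coe_zpow] at hP
  have hbend : bendFactor (π.comp H.subtype) (α.restrict H).toFun (π (σ l))
      (trans σ hσ f q l hql) (fixedLoop σ hσ g q hq).el =
        bendFactor π α.toFun (π (σ l)) (trans σ hσ f q l hql : Γ)
          ((fixedLoop σ hσ g q hq).el : Γ) := by
    simp [bendFactor, flipFactor]
  have hpσ : σ q * (trans σ hσ p q q hpq : Γ) * (σ q)⁻¹ = p := by
    rw [mul_trans, mul_inv_cancel_right]
  have hg' : f * σ q * (trans σ hσ p q q hpq : Γ) * (f * σ q)⁻¹ = g'.el := by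
    rw [mul_assoc f, mul_trans, ← hf, realConj, hp]
    group
  have hconj : (trans σ hσ f q l hql : Γ) * (trans σ hσ p q q hpq : Γ) *
      (trans σ hσ f q l hql : Γ)⁻¹ = (trans σ hσ g'.el l l hl : Γ) := by
    have hl' : (trans σ hσ g'.el l l hl : Γ) = (σ l)⁻¹ * (g'.el * σ l) := rfl
    rw [hl', ← hg', ← mul_trans hσ f hql]
    group
  rw [transgressionFun_eq, transgressionFun_eq, mul_trans, ← hP, hg', hpσ, hconj, hbend,
    rindFactor, rindFactor]
  apply Additive.ofMul.injective
  simp only [ofMul_mul, ofMul_div]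
  abel

end Scalars

section BendSummand

variable (ρ α)

theorem rind_bend_apply (T : (ρ.rind σ hσ α).Tr g) (x : RIndCat π V σ) {i j : Γ ⧸ H}
    (h : g.el⁻¹ • j = i)
    (hi : π (σ j) = π (σ i) * (π.comp H.subtype) (trans σ hσ g.el⁻¹ j i h)) :
    (ρ.rind σ hσ α).bend T x i =
      ((Signed.iso (π (σ i)) (ρ.rindCast hσ g.el⁻¹ h x)).hom ≫
        ρ.innerMap (trans σ hσ g.el⁻¹ j i h) hi ((ρ.rind σ hσ α).trApp T x j) ≫
        (Signed.iso (π (σ i)) (ρ.rindCast hσ g.el⁻¹ h ((ρ.rind σ hσ α).obj g.el x))).inv) ≫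
      ((ρ.rind σ hσ α).cap g.el⁻¹ g.el (inv_mul_cancel _) x).hom i := by
  have hd : π g.el⁻¹ = 1 := by rw [map_inv, g.deg, inv_one]
  have he : π (σ j) = π g.el⁻¹ * π (σ j) := by rw [hd, one_mul]
  have hmap := ρ.rindAct_map_apply hσ g.el⁻¹ h he hi (posHom hd ((ρ.rind σ hσ α).trApp T x))
  rw [rindComp_of_eq_one hd he] at hmap
  exact congrArg (· ≫ ((ρ.rind σ hσ α).cap g.el⁻¹ g.el (inv_mul_cancel _) x).hom i) hmap

theorem rind_bend_apply_eq_zero (T : (ρ.rind σ hσ α).Tr g) (x : RIndCat π V σ) {i j : Γ ⧸ H}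
    (h : g.el⁻¹ • j = i) (hT : (ρ.rind σ hσ α).trApp T x j = 0) :
    (ρ.rind σ hσ α).bend T x i = 0 := by
  have hd : π g.el⁻¹ = 1 := by rw [map_inv, g.deg, inv_one]
  have he : π (σ j) = π g.el⁻¹ * π (σ j) := by rw [hd, one_mul]
  refine (congrArg (· ≫ _) (ρ.rindAct_map_apply_eq_zero hσ g.el⁻¹ h he ?_)).trans
    Limits.zero_comp
  exact (rindComp_of_eq_one hd he _).trans hT

variable {hσ} in
theorem rindComp_signedTr_summand_of_ne (hq : g.el • q = q) (v : ρ.Tr (fixedLoop σ hσ g q hq))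
    {ε e : ℤˣ} {p : Γ} (hp : p = g.el ^ (ε : ℤ)) {i : Γ ⧸ H} (hi : i ≠ q)
    (he : e = ε * π (σ i)) (y : RIndCat π V σ) :
    rindComp he ((ρ.rind σ hσ α).signedTr ε p hp (ρ.summand hσ α hq v) y) = 0 := by
  rcases Int.units_eq_one_or ε with rfl | rfl
  · obtain rfl : p = g.el := by simpa using hp
    obtain rfl : e = π (σ i) := by simpa using he
    rw [rindComp_of_eq_one rfl he, signedTr_pos]
    exact ρ.trApp_summand_of_ne hσ α hq v y hi
  · obtain rfl : p = g.el⁻¹ := by simpa using hp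
    have he' : e = -π (σ i) := by simpa using he
    have hj : g.el • i ≠ q := fun h => hi (smul_left_cancel g.el (h.trans hq.symm))
    apply Signed.flip_injective he'
    rw [flip_rindComp rfl he he', signedTr_neg]
    exact ρ.rind_bend_apply_eq_zero hσ α _ y (inv_smul_smul _ _)
      (ρ.trApp_summand_of_ne hσ α hq v y hj)

variable {ρ α hσ}

theorem IsTwisted.bend_summand_apply (hρ : ρ.IsTwisted (α.restrict H).toFun)
    (hq : g.el • q = q) (hq' : g.el⁻¹ • q = q) (v : ρ.Tr (fixedLoop σ hσ g q hq)) {e : ℤˣ}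
    (he : e = -π (σ q))
    (hη : trans σ hσ g.el⁻¹ q q hq' = (fixedLoop σ hσ g q hq).el ^ (e : ℤ))
    (y : RIndCat π V σ) :
    (ρ.rind σ hσ α).bend (ρ.summand hσ α hq v) y q =
      (bendFactor π α.toFun (-1) (σ q) (fixedLoop σ hσ g q hq).el : k) •
        ((Signed.iso (π (σ q)) (ρ.rindCast hσ g.el⁻¹ hq' y)).hom ≫
          Signed.flip he (ρ.signedTr e (trans σ hσ g.el⁻¹ q q hq') hη v (y q).un)) := by
  have hd : π (σ q) = π (σ q) * (π.comp H.subtype) (trans σ hσ g.el⁻¹ q q hq') := by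
    rw [← trans_deg σ hσ g.el⁻¹, map_inv, g.deg, inv_one, one_mul]
  rw [ρ.rind_bend_apply hσ α _ y hq' hd, trApp_summand_self, ← flipFactor_mul_rindFactor hσ hq hq']
  refine Eq.trans (congrArg (_ ≫ ·) ?_) (hρ.signedTr_bend_psiVia he v
    (trans_eq_fixedLoop_zpow hσ hq) hη
    (trans_mul σ hσ g.el⁻¹ g.el 1 (inv_mul_cancel _) q q q hq hq' (one_smul _ q))
    (trans_one σ hσ q q (one_smul _ q)) hd (ρ.rindCast hσ g.el⁻¹ hq' y)
    (ρ.rindCast hσ g.el hq y) (ρ.rindCast hσ g.el⁻¹ hq' ((ρ.rind σ hσ α).obj g.el y))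
    (ρ.rindCast hσ 1 (one_smul _ q) y) (rindFactor hσ α g.el⁻¹ g.el hq hq'))
  exact congrArg₂ (· ≫ ·)
    (ρ.rind_psiApp_hom_apply hσ α g.el⁻¹ g.el 1 (inv_mul_cancel _) hq hq' (one_smul _ q) y)
    (ρ.rind_psiEApp_hom_apply hσ α q (one_smul _ q) y)

theorem IsTwisted.rindComp_signedTr_summand (hρ : ρ.IsTwisted (α.restrict H).toFun)
    (hq : g.el • q = q) (v : ρ.Tr (fixedLoop σ hσ g q hq)) {ε e : ℤˣ} {p : Γ}
    (hp : p = g.el ^ (ε : ℤ)) (hpq : p • q = q) (he : e = ε * π (σ q)) (y : RIndCat π V σ) :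
    (rindComp he ((ρ.rind σ hσ α).signedTr ε p hp (ρ.summand hσ α hq v) y) ≫
        (Signed.iso e (ρ.rindCast hσ p hpq y)).hom :
          (y q).un ⟶[e] ρ.obj (trans σ hσ p q q hpq) (y q).un) =
      (bendFactor π α.toFun ε (σ q) (fixedLoop σ hσ g q hq).el : k) •
        ρ.signedTr e (trans σ hσ p q q hpq)
          (trans_zpow_eq_fixedLoop_zpow hσ hq hp hpq he) v (y q).un := by
  have hη := trans_zpow_eq_fixedLoop_zpow hσ hq hp hpq he
  rcases Int.units_eq_one_or ε with rfl | rfl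
  · obtain rfl : p = g.el := by simpa using hp
    obtain rfl : e = π (σ q) := by simpa using he
    rw [rindComp_of_eq_one rfl he, signedTr_pos, trApp_summand_self, bendFactor, if_pos rfl,
      Units.val_one, one_smul]
    exact ρ.summandEntry_comp_iso_hom hσ α hq v y
  · obtain rfl : p = g.el⁻¹ := by simpa using hp
    have he' : e = -π (σ q) := by simpa using he
    have hflip := flip_rindComp rfl he he'
      ((ρ.rind σ hσ α).signedTr (-1) g.el⁻¹ hp (ρ.summand hσ α hq v) y)
    rw [signedTr_neg, hρ.bend_summand_apply hq hpq v he' hη] at hflip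
    apply Signed.flip_injective he'
    refine Eq.trans (congrArg
      ((Signed.iso (π (σ q)) (ρ.rindCast hσ g.el⁻¹ hpq y)).inv ≫ ·) hflip) ?_
    exact (Linear.comp_smul _ _ _ _ _ _).trans (congrArg (_ • ·) (Iso.inv_hom_id_assoc _ _))

end BendSummand

section BetaSummand

variable {hσ}

theorem IsTwisted.smul_trApp_summand_apply (hρ : ρ.IsTwisted (α.restrict H).toFun) {f p m : Γ}
    (hf : realConj π f g.el = g'.el) (hp : p = g.el ^ ((π f : ℤˣ) : ℤ)) (hm : g'.el * f = m)
    (hm' : f * p = m) (hq : g.el • q = q) (hl : g'.el • l = l) (hql : f • q = l) (hpq : p • q = q)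
    (hmq : m • q = l) (v : ρ.Tr (fixedLoop σ hσ g q hq)) (y : RIndCat π V σ) :
    (((transgressionFun π α.toFun f (σ q) (fixedLoop σ hσ g q hq).el /
          transgressionFun π α.toFun (σ l) (trans σ hσ f q l hql)
            (fixedLoop σ hσ g q hq).el : kˣ) : k) •
        (ρ.rind σ hσ α).trApp (ρ.summand hσ α hl (ρ.beta (trans σ hσ f q l hql)
          (realConj_trans_fixedLoop hσ hf hq hl hql) v)) ((ρ.rind σ hσ α).obj f y) l) ≫
        ((ρ.rind σ hσ α).psiApp g'.el f m hm y).hom l =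
      (ρ.rindAct σ hσ f).map ((ρ.rind σ hσ α).signedTr (π f) p hp (ρ.summand hσ α hq v) y) l ≫
        ((ρ.rind σ hσ α).psiApp f p m hm' y).hom l := by
  rw [trApp_summand_self,
    ρ.rindAct_map_apply hσ f hql rfl (trans_deg σ hσ f q l hql)]
  refine (congrArg (_ ≫ ·) (ρ.rind_psiApp_hom_apply hσ α g'.el f m hm hql hl hmq y)).trans
    (Eq.trans ?_
      (congrArg (_ ≫ ·) (ρ.rind_psiApp_hom_apply hσ α f p m hm' hpq hql hmq y)).symm)
  exact hρ.signedTr_beta_psiVia (trans_deg σ hσ f q l hql)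
    (realConj_trans_fixedLoop hσ hf hq hl hql) v (trans_eq_fixedLoop_zpow hσ hl)
    (trans_zpow_eq_fixedLoop_zpow hσ hq hp hpq rfl)
    (trans_mul σ hσ g'.el f m hm q l l hql hl hmq) (trans_mul σ hσ f p m hm' q q l hpq hql hmq)
    (ρ.rindCast hσ f hql y) (ρ.rindCast hσ g'.el hl ((ρ.rind σ hσ α).obj f y))
    (ρ.rindCast hσ m hmq y) (ρ.rindCast hσ p hpq y)
    (ρ.rindCast hσ f hql ((ρ.rind σ hσ α).obj p y)) _ _ _ _ _
    (hρ.rindComp_signedTr_summand hq v hp hpq rfl y)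
    (transgression_mul_rindFactor hσ hf hq hl hql hp hpq)

theorem IsTwisted.beta_summand (hρ : ρ.IsTwisted (α.restrict H).toFun) {f : Γ}
    (hf : realConj π f g.el = g'.el) (hq : g.el • q = q) (hl : g'.el • l = l) (hql : f • q = l)
    (v : ρ.Tr (fixedLoop σ hσ g q hq)) :
    (ρ.rind σ hσ α).beta f hf (ρ.summand hσ α hq v) =
      ((transgressionFun π α.toFun f (σ q) (fixedLoop σ hσ g q hq).el /
        transgressionFun π α.toFun (σ l) (trans σ hσ f q l hql)
          (fixedLoop σ hσ g q hq).el : kˣ) : k) •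
      ρ.summand hσ α hl (ρ.beta (trans σ hσ f q l hql)
        (realConj_trans_fixedLoop hσ hf hq hl hql) v) := by
  obtain ⟨p, hp⟩ : ∃ p, p = g.el ^ ((π f : ℤˣ) : ℤ) := ⟨_, rfl⟩
  have hm : g'.el * f = f * p := by rw [← hf, realConj, hp, inv_mul_cancel_right]
  have hpq : p • q = q := by
    apply smul_left_cancel f
    rw [← mul_smul, ← hm, mul_smul, hql, hl]
  have hmq : (f * p) • q = l := by rw [mul_smul, hpq, hql]
  refine ((ρ.rind σ hσ α).eq_beta_of_trApp hf hp hm rfl fun y => ?_).symm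
  rw [trApp_smul]
  refine funext fun r => ?_
  by_cases hr : r = l
  · subst hr
    exact hρ.smul_trApp_summand_apply hf hp hm rfl hq hl hql hpq hmq v y
  · have hrq : f⁻¹ • r ≠ q := fun h => hr (by rw [← hql, ← h, smul_inv_smul])
    refine Eq.trans ?_ (Eq.symm ((congrArg (· ≫ _) (ρ.rindAct_map_apply_eq_zero hσ f
      (smul_inv_smul f r) rfl (ρ.rindComp_signedTr_summand_of_ne α hq v hp hrq rfl y))).trans
        Limits.zero_comp))
    have hzero := ρ.trApp_summand_of_ne hσ α hl (ρ.beta (trans σ hσ f q l hql)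
      (realConj_trans_fixedLoop hσ hf hq hl hql) v) ((ρ.rind σ hσ α).obj f y) hr
    exact (congrArg (· ≫ _) ((congrArg (fun a => (_ : k) • a) hzero).trans (smul_zero _))).trans
      Limits.zero_comp

end BetaSummand

end RealTwoRepData

/-! ### Decomposition of the categorical trace of a Real induction -/

section FixedCosets

variable {Γ : Type u₁} [Group Γ] {π : Γ →* ℤˣ}

theorem mul_eq_of_realConj_eq {ω γ γ' : Γ} (h : realConj π ω γ = γ') :
    γ' * ω = ω * γ ^ ((π ω : ℤˣ) : ℤ) := by
  rw [← h, realConj, inv_mul_cancel_right]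

variable {H : Subgroup Γ}

theorem smul_smul_eq_of_realConj_eq {ω γ γ' : Γ} (h : realConj π ω γ = γ') {q : Γ ⧸ H}
    (hq : γ • q = q) : γ' • ω • q = ω • q := by
  have hfix : γ ^ ((π ω : ℤˣ) : ℤ) • q = q :=
    (MulAction.stabilizer Γ q).zpow_mem hq _
  rw [← mul_smul, mul_eq_of_realConj_eq h, mul_smul, hfix]

variable {σ : Γ ⧸ H → Γ} (hσ : ∀ q, (σ q : Γ ⧸ H) = q)

theorem isTransversal_fixedLoopHom (g : Loop π) :
    IsTransversal (loopInclusion π H)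
      fun q : {q : Γ ⧸ H // g.el • q = q} => fixedLoopHom σ hσ g q.1 q.2 := by
  intro y s
  have hq : g.el • (s.1 : Γ ⧸ H) = s.1 := by
    have hy : (y.el : Γ) • ((1 : Γ) : Γ ⧸ H) = (1 : Γ) := by
      change ((y.el * 1 : Γ) : Γ ⧸ H) = (1 : Γ)
      rw [eq_comm, QuotientGroup.eq, inv_one, one_mul, mul_one]
      exact y.el.2
    have hs : s.1 • ((1 : Γ) : Γ ⧸ H) = s.1 := congrArg QuotientGroup.mk (mul_one s.1)
    rw [← hs]
    exact smul_smul_eq_of_realConj_eq s.2 hy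
  have hm : (σ s.1)⁻¹ * s.1 ∈ H := by rw [← QuotientGroup.eq, hσ]
  have hc : realConj (π.comp H.subtype) ⟨(σ s.1)⁻¹ * s.1, hm⟩ y.el =
      (fixedLoop σ hσ g s.1 hq).el := by
    have hcoe : ((realConj (π.comp H.subtype) ⟨(σ s.1)⁻¹ * s.1, hm⟩ y.el : H) : Γ) =
        realConj π ((σ s.1)⁻¹ * s.1) (y.el : Γ) := by
      simp [realConj]
    refine Subtype.ext (realConj_injective π (σ s.1) ?_)
    rw [hcoe, ← realConj_mul, mul_inv_cancel_left]
    exact s.2.trans (fixedLoopHom σ hσ g s.1 hq).2.symm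
  refine ⟨⟨⟨s.1, hq⟩, ⟨⟨(σ s.1)⁻¹ * s.1, hm⟩, hc⟩⟩, Subtype.ext (mul_inv_cancel_left _ _), ?_⟩
  rintro ⟨⟨q, hq'⟩, a⟩ ha
  have ha' : σ q * (a.1 : Γ) = s.1 := congrArg Subtype.val ha
  obtain rfl : q = s.1 := by
    rw [← hσ q, QuotientGroup.eq, ← ha', inv_mul_cancel_left]
    exact a.1.2
  congr 1
  exact Subtype.ext (Subtype.ext (eq_inv_mul_of_mul_eq ha'))

end FixedCosets

attribute [ext] TwoCocycle

theorem transgression_restrict {k : Type w} [Field k] {Γ : Type u₁} [Group Γ] {π : Γ →* ℤˣ}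
    {H : Subgroup Γ} (α : ThreeCocycle k π) :
    transgression (α.restrict H) = (transgression α).pullback (loopInclusion π H) := by
  refine TwoCocycle.ext ?_
  funext x y z b a
  simp only [transgression, transgressionFun, TwoCocycle.pullback, loopInclusion,
    ThreeCocycle.restrict_toFun, MonoidHom.comp_apply, Subgroup.subtype_apply, Subgroup.coe_mul,
    Subgroup.coe_inv, Subgroup.coe_zpow]
  rfl

namespace RealTwoRepData

variable {k : Type w} [Field k] {Γ : Type u₁} [Group Γ] {π : Γ →* ℤˣ} {H : Subgroup Γ}
  {V : Type u} [Category.{v} V] [Preadditive V] [Linear k V]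
  (ρ : RealTwoRepData k (π.comp H.subtype) V) {σ : Γ ⧸ H → Γ} (hσ : ∀ q, (σ q : Γ ⧸ H) = q)
  (α : ThreeCocycle k π) {g : Loop π}

section Components

variable (T : (ρ.rind σ hσ α).Tr g)

theorem trApp_rind_eq_zero (x : RIndCat π V σ) {l : Γ ⧸ H} (hl : g.el • l ≠ l) :
    (ρ.rind σ hσ α).trApp T x l = 0 := by
  classical
  have hne : g.el⁻¹ • l ≠ l := fun h => hl (by rw [← inv_smul_eq_iff.1 h])
  have hd : π (σ (g.el⁻¹ • l)) = π g.el * π (σ (g.el⁻¹ • l)) := by rw [g.deg, one_mul]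
  -- Naturality with respect to the projection to the component `l`, which `g` moves away.
  let f : x ⟶ x := Pi.single (M := fun j => x j ⟶ x j) l (𝟙 _)
  have hf : f l = 𝟙 _ := Pi.single_eq_same (M := fun j => x j ⟶ x j) l _
  have hf' : f (g.el⁻¹ • l) = 0 := Pi.single_eq_of_ne (M := fun j => x j ⟶ x j) hne _
  have hmap : (ρ.rindAct σ hσ g.el).map (posHom g.deg f) l = 0 :=
    ρ.rindAct_map_apply_eq_zero hσ g.el (smul_inv_smul _ _) hd
      ((rindComp_of_eq_one g.deg hd _).trans hf')
  have hnat := congrFun ((ρ.rind σ hσ α).trApp_naturality T f) l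
  exact ((Category.id_comp _).symm.trans (congrArg (· ≫ _) hf.symm)).trans
    (hnat.trans ((congrArg (_ ≫ ·) hmap).trans Limits.comp_zero))

variable {q : Γ ⧸ H} (hq : g.el • q = q)
  (hd : π (σ q) = π (σ q) * (π.comp H.subtype) (trans σ hσ g.el q q hq))

theorem trApp_rind_comp_iso_naturality {x y : RIndCat π V σ} (f : x q ⟶ y q) :
    f ≫ (ρ.rind σ hσ α).trApp T y q ≫ (Signed.iso (π (σ q)) (ρ.rindCast hσ g.el hq y)).hom =
      ((ρ.rind σ hσ α).trApp T x q ≫ (Signed.iso (π (σ q)) (ρ.rindCast hσ g.el hq x)).hom) ≫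
        ρ.innerMap (trans σ hσ g.el q q hq) hd f := by
  classical
  have he : π (σ q) = π g.el * π (σ q) := by rw [g.deg, one_mul]
  let f' : x ⟶ y := Pi.single (M := fun j => x j ⟶ y j) q f
  have hf' : f' q = f := Pi.single_eq_same (M := fun j => x j ⟶ y j) q f
  have hmap := ρ.rindAct_map_apply hσ g.el hq he hd (posHom g.deg f')
  have hcomp : rindComp he (posHom g.deg f') = f := (rindComp_of_eq_one g.deg he _).trans hf'
  rw [hcomp] at hmap
  have hnat := (congrFun ((ρ.rind σ hσ α).trApp_naturality T f') q).trans
    (congrArg (_ ≫ ·) hmap)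
  have hnat' := (congrArg (· ≫ (ρ.rind σ hσ α).trApp T y q) hf'.symm).trans hnat
  refine (Category.assoc _ _ _).symm.trans ((congrArg (· ≫ _) hnat').trans ?_)
  refine (Category.assoc _ _ _).trans (Eq.trans (congrArg (_ ≫ ·) ?_) (Category.assoc _ _ _).symm)
  exact (Category.assoc _ _ _).trans ((congrArg (_ ≫ ·) ((Category.assoc _ _ _).trans
    ((congrArg (_ ≫ ·) (Iso.inv_hom_id _)).trans (Category.comp_id _)))))

theorem exists_eq_summandEntry :
    ∃ v : ρ.Tr (fixedLoop σ hσ g q hq), ∀ x,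
      (ρ.rind σ hσ α).trApp T x q = ρ.summandEntry hσ α hq v x := by
  have hd : π (σ q) = π (σ q) * (π.comp H.subtype) (trans σ hσ g.el q q hq) := by
    rw [← trans_deg σ hσ g.el, g.deg, one_mul]
  let t (x : RIndCat π V σ) : (x q).un ⟶[π (σ q)] ρ.obj (trans σ hσ g.el q q hq) (x q).un :=
    (ρ.rind σ hσ α).trApp T x q ≫ (Signed.iso (π (σ q)) (ρ.rindCast hσ g.el hq x)).hom
  obtain ⟨v, hv⟩ := ρ.exists_signedTr_eq (trans_eq_fixedLoop_zpow hσ hq) hd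
    (fun z => t fun _ => ⟨z⟩) fun {z z'} f =>
      ρ.trApp_rind_comp_iso_naturality hσ α T hq hd (x := fun _ => ⟨z⟩) (y := fun _ => ⟨z'⟩) f
  refine ⟨v, fun x => ?_⟩
  have ht : t x = t fun _ => ⟨(x q).un⟩ := by
    have h := ρ.trApp_rind_comp_iso_naturality hσ α T hq hd
      (x := fun _ => ⟨(x q).un⟩) (y := x) (𝟙 (x q))
    exact (Category.id_comp _).symm.trans (h.trans
      ((congrArg (_ ≫ ·) (ρ.innerMap_id _ hd (x q).un)).trans (Category.comp_id _)))
  exact (Iso.eq_comp_inv _).2 (ht.trans (hv _).symm)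

end Components

variable {ρ α} in
theorem IsTwisted.isTwisted_realCatChar_pullback (hρ : ρ.IsTwisted (α.restrict H).toFun) :
    ρ.realCatChar.IsTwisted ((transgression α).pullback (loopInclusion π H)) :=
  transgression_restrict α ▸ hρ.isTwisted_realCatChar

variable [H.FiniteIndex]

open scoped Classical in
/-- The map from the product of the categorical traces of `ρ` over the cosets fixed by `g` to the
categorical trace of the Real induction which sums up the natural transformations `summand`. -/
noncomputable def summandSum (g : Loop π) :
    (∀ q : {q : Γ ⧸ H // g.el • q = q}, ρ.Tr (fixedLoop σ hσ g q.1 q.2)) →ₗ[k]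
      (ρ.rind σ hσ α).Tr g :=
  letI := Fintype.ofFinite {q : Γ ⧸ H // g.el • q = q}
  LinearMap.lsum k _ k fun q => ρ.summand hσ α q.2

open scoped Classical in
theorem summandSum_single (q : {q : Γ ⧸ H // g.el • q = q})
    (v : ρ.Tr (fixedLoop σ hσ g q.1 q.2)) :
    ρ.summandSum hσ α g (Pi.single q v) = ρ.summand hσ α q.2 v := by
  let := Fintype.ofFinite {q : Γ ⧸ H // g.el • q = q}
  exact LinearMap.lsum_piSingle ..

theorem trApp_summandSum
    (v : ∀ q : {q : Γ ⧸ H // g.el • q = q}, ρ.Tr (fixedLoop σ hσ g q.1 q.2))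
    (x : RIndCat π V σ) {q : Γ ⧸ H} (hq : g.el • q = q) :
    (ρ.rind σ hσ α).trApp (ρ.summandSum hσ α g v) x q =
      ρ.summandEntry hσ α hq (v ⟨q, hq⟩) x := by
  let := Fintype.ofFinite {q : Γ ⧸ H // g.el • q = q}
  let ev : (ρ.rind σ hσ α).Tr g →+ (x q ⟶ (ρ.rind σ hσ α).obj g.el x q) :=
    { toFun T := (ρ.rind σ hσ α).trApp T x q
      map_zero' := rfl
      map_add' _ _ := rfl }
  have hsum : ρ.summandSum hσ α g v = ∑ r, ρ.summand hσ α r.2 (v r) := by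
    rw [summandSum, LinearMap.lsum_apply, LinearMap.sum_apply]
    exact Finset.sum_congr (by ext; simp) fun _ _ => rfl
  change ev (ρ.summandSum hσ α g v) = _
  rw [hsum, map_sum, Fintype.sum_eq_single ⟨q, hq⟩ fun r hr => ?_]
  · exact ρ.trApp_summand_self hσ α hq _ x
  · exact ρ.trApp_summand_of_ne hσ α r.2 _ x fun h => hr (Subtype.ext h.symm)

theorem summandSum_bijective (g : Loop π) : Function.Bijective (ρ.summandSum hσ α g) := by
  refine ⟨fun v v' h => funext fun q => ρ.summandEntry_injective hσ α q.2 fun x => ?_,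
    fun T => ?_⟩
  · rw [← ρ.trApp_summandSum hσ α v x q.2, h, ρ.trApp_summandSum]
  · choose v hv using fun q : {q : Γ ⧸ H // g.el • q = q} =>
      ρ.exists_eq_summandEntry hσ α T q.2
    refine ⟨v, (ρ.rind σ hσ α).tr_ext fun x => funext fun q => ?_⟩
    by_cases hq : g.el • q = q
    · exact (ρ.trApp_summandSum hσ α v x hq).trans (hv ⟨q, hq⟩ x).symm
    · rw [ρ.trApp_rind_eq_zero hσ α _ x hq, ρ.trApp_rind_eq_zero hσ α _ x hq]

section Comparison

variable {ρ α} (hρ : ρ.IsTwisted (α.restrict H).toFun)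

open scoped Classical in
/-- The isomorphism which sends `σ_q ⊗ v` to the natural transformation attached to `v`. Both
sides are the product of the categorical traces of `ρ` over the cosets fixed by `g`. -/
noncomputable def indEquivRind (g : Loop π) :
    (ind (loopInclusion π H) (transgression α) ρ.realCatChar).fib g ≃ₗ[k]
      (ρ.rind σ hσ α).realCatChar.fib g :=
  (LinearEquiv.ofBijective
      ((isTransversal_fixedLoopHom hσ g).indCoord hρ.isTwisted_realCatChar_pullback)
      ((isTransversal_fixedLoopHom hσ g).indCoord_bijective
        hρ.isTwisted_realCatChar_pullback)).trans
    (LinearEquiv.ofBijective (ρ.summandSum hσ α g) (ρ.summandSum_bijective hσ α g))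

theorem indEquivRind_indMk {q : Γ ⧸ H} (hq : g.el • q = q)
    (v : ρ.Tr (fixedLoop σ hσ g q hq)) :
    indEquivRind hσ hρ g (indMk (loopInclusion π H) (transgression α) ρ.realCatChar
      (fixedLoopHom σ hσ g q hq) v) = ρ.summand hσ α hq v := by
  classical
  refine Eq.trans ?_ (ρ.summandSum_single hσ α ⟨q, hq⟩ v)
  exact congrArg (ρ.summandSum hσ α g)
    ((isTransversal_fixedLoopHom hσ g).indCoord_indMk hρ.isTwisted_realCatChar_pullback ⟨q, hq⟩ v)

theorem indEquivRind_map {g' : Loop π} (f : g ⟶ g')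
    (z : (ind (loopInclusion π H) (transgression α) ρ.realCatChar).fib g) :
    indEquivRind hσ hρ g'
        ((ind (loopInclusion π H) (transgression α) ρ.realCatChar).map f z) =
      (ρ.rind σ hσ α).realCatChar.map f (indEquivRind hσ hρ g z) := by
  suffices h : (indEquivRind hσ hρ g').toLinearMap ∘ₗ
      (ind (loopInclusion π H) (transgression α) ρ.realCatChar).map f =
      (ρ.rind σ hσ α).realCatChar.map f ∘ₗ (indEquivRind hσ hρ g).toLinearMap from
    LinearMap.congr_fun h z
  refine (isTransversal_fixedLoopHom hσ g).ind_hom_ext _ fun ⟨q, hq⟩ v => ?_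
  have hl : g'.el • f.1 • q = f.1 • q := smul_smul_eq_of_realConj_eq f.2 hq
  let a : fixedLoop σ hσ g q hq ⟶ fixedLoop σ hσ g' (f.1 • q) hl :=
    ⟨trans σ hσ f.1 q (f.1 • q) rfl, realConj_trans_fixedLoop hσ f.2 hq hl rfl⟩
  have ha : (loopInclusion π H).map a ≫ fixedLoopHom σ hσ g' (f.1 • q) hl =
      fixedLoopHom σ hσ g q hq ≫ f := Subtype.ext (mul_inv_cancel_left _ _)
  have hmap := ind_map_indMk_of_comm (loopInclusion π H) (transgression α) ρ.realCatChar f a _ _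
    ha v
  refine (congrArg (indEquivRind hσ hρ g') hmap).trans ?_
  rw [map_smul]
  refine (congrArg (_ • ·) (indEquivRind_indMk hσ hρ hl _)).trans ?_
  refine Eq.trans ?_ (congrArg ((ρ.rind σ hσ α).realCatChar.map f)
    (indEquivRind_indMk hσ hρ hq v)).symm
  exact (hρ.beta_summand f.2 hq hl rfl v).symm

end Comparison

end RealTwoRepData

end RealTwoRep

theorem mainTheorem4_general {k : Type w} [Field k] {Γ : Type u₁} [Group Γ] (π : Γ →* ℤˣ)
    (H : Subgroup Γ) [H.FiniteIndex] (α : ThreeCocycle k π)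
    (σ : Γ ⧸ H → Γ) (hσ : ∀ q, (σ q : Γ ⧸ H) = q)
    {V : Type u} [Category.{v} V] [Preadditive V] [Linear k V]
    (ρ : RealTwoRepData k (π.comp H.subtype) V) (hρ : ρ.IsTwisted (α.restrict H).toFun) :
    (ρ.rind σ hσ α).IsTwisted α.toFun ∧
    ρ.realCatChar.IsTwisted (transgression (α.restrict H)) ∧
    (ρ.rind σ hσ α).realCatChar.IsTwisted (transgression α) ∧
    (ind (loopInclusion π H) (transgression α) ρ.realCatChar).IsTwisted (transgression α) ∧
    ∃ Φ : BundleData.Iso (ρ.rind σ hσ α).realCatChar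
        (ind (loopInclusion π H) (transgression α) ρ.realCatChar),
      ∀ (g : Loop π) (q : Γ ⧸ H) (hq : g.el • q = q) (v : ρ.Tr (fixedLoop σ hσ g q hq)),
        IsSummandOf σ hσ ρ α g q hq v ((Φ.equiv g).symm
          (indMk (loopInclusion π H) (transgression α) ρ.realCatChar
            (fixedLoopHom σ hσ g q hq) v)) := by
  have hR := hρ.isTwisted_rind hσ α
  refine ⟨hR, hρ.isTwisted_realCatChar, hR.isTwisted_realCatChar, isTwisted_ind _ _ _,
    { equiv g := (RealTwoRepData.indEquivRind hσ hρ g).symm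
      comm f e := ?_ }, fun g q hq v => ?_⟩
  · rw [LinearEquiv.symm_apply_eq, RealTwoRepData.indEquivRind_map, LinearEquiv.apply_symm_apply]
  · exact RealTwoRepData.indEquivRind_indMk hσ hρ hq v ▸ ρ.isSummandOf_summand hσ α hq v

theorem mainTheorem4 {k : Type w} [Field k] {Γ : Type u₁} [Group Γ] [Finite Γ] (π : Γ →* ℤˣ)
    (H : Subgroup Γ) (hH : Function.Surjective (π.comp H.subtype)) (α : ThreeCocycle k π)
    (σ : Γ ⧸ H → Γ) (hσ : ∀ q, (σ q : Γ ⧸ H) = q)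
    {V : Type u} [Category.{v} V] [Preadditive V] [Linear k V]
    (ρ : RealTwoRepData k (π.comp H.subtype) V) (hρ : ρ.IsTwisted (α.restrict H).toFun) :
    (ρ.rind σ hσ α).IsTwisted α.toFun ∧
    ρ.realCatChar.IsTwisted (transgression (α.restrict H)) ∧
    (ρ.rind σ hσ α).realCatChar.IsTwisted (transgression α) ∧
    (ind (loopInclusion π H) (transgression α) ρ.realCatChar).IsTwisted (transgression α) ∧
    ∃ Φ : BundleData.Iso (ρ.rind σ hσ α).realCatChar
        (ind (loopInclusion π H) (transgression α) ρ.realCatChar),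
      ∀ (g : Loop π) (q : Γ ⧸ H) (hq : g.el • q = q) (v : ρ.Tr (fixedLoop σ hσ g q hq)),
        IsSummandOf σ hσ ρ α g q hq v ((Φ.equiv g).symm
          (indMk (loopInclusion π H) (transgression α) ρ.realCatChar
            (fixedLoopHom σ hσ g q hq) v)) :=
  mainTheorem4_general π H α σ hσ ρ hρ
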